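/- **Notation.** Let $h(x)=\frac1\pi e^{-|x|^2}$ on $\mathbb R^2$. For a radial function $f$ write $f(x)=f_r(|x|)$; let $x^\perp=(x_2,-x_1)$ and let $J_0$ be the Bessel function of the first kind of order $0$. Put $\hat h(s)=\int_0^\infty r\,h_r(r)J_0(rs)\,dr$, $\;Z(r)=\int_0^\infty s\,|2\pi\hat h(s)|^2J_0(s\sqrt r)\,ds$ $(r\ge 0)$, $\;G(x)=-\frac1{2\pi}\int_{\mathbb R^2}\log|x-y|\,h(y)\,dy$ (so $-\Delta G=h$), $\;P_K(r)=-2\pi r\,G_r'(r)$, $\;H_G(r)=-\log r-2\pi G_r(r)$, $\;H_P(r)=\log\sqrt r+H_G(\sqrt r)$. **(1) Hypotheses on $h$.** $h\in C^1(\mathbb R^2)\cap W^{1,1}(\mathbb R^2)$ is positive and radial, with $h_r'(r)<0$ for $r>0$ and $\int_{\mathbb R^2}h\,dx=2\pi\int_0^\infty r\,h_r(r)\,dr=1$; the functions $\mathbf 1_{|x|\le1}(1-\log|x|)^{-1}h$, $|x|\nabla h$ and, for some $\eta>0$, $|x|^{3+\eta}h$ are in $L^\infty(\mathbb R^2)$;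 and $\mathbf 1_{|x|>1}|x|h$, $|x|\nabla h$ are in $L^1(\mathbb R^2)$. **(2) The function $Z$.** For every $r\ge0$ the integral defining $Z(r)$ converges absolutely and $Z(r)=e^{-r/2}$; moreover $\frac1{2\pi}Z(|x|^2)=\int_{\mathbb R^2}h(x-y)h(y)\,dy=\frac1{2\pi}e^{-|x|^2/2}$ for all $x\in\mathbb R^2$. The function $Z$ is strictly decreasing and strictly convex on $[0,\infty)$. **(3)** $Z$ and $H_P$ are twice continuously differentiable on $(0,\infty)$ and $Z''(r)H_P'(r)-Z'(r)H_P''(r)>0$ for all $r>0$. **(4) Enstrophy dissipation.** Let $\Gamma_1\ge\Gamma_2>0>\Gamma_3$ with $\frac1{\Gamma_1}+\frac1{\Gamma_2}+\frac1{\Gamma_3}=0$. Put $\psi(r)=\left(\frac1{1+r}\right)^{1/\Gamma_1}\left(\frac r{1+r}\right)^{1/\Gamma_2}$ and $k_\pm=\left(\frac{\Gamma_1+\Gamma_2\pm\sqrt{\Gamma_1^2+\Gamma_1\Gamma_2+\Gamma_2^2}}{\Gamma_2}\right)^2$; let $k_0\in\{k_+,k_-\}$ minimize $\psi(\frac{\Gamma_1}{\Gamma_2}k)$,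 and let $$\frac{\Gamma_1^2\Gamma_2^2}{4\pi(\Gamma_1+\Gamma_2)}\log\frac{\psi(\frac{\Gamma_1}{\Gamma_2}k_0)}{\psi(\frac{\Gamma_1}{\Gamma_2})}<\mathscr H_c<0 .$$ For $\varepsilon>0$ consider the regularized three-vortex system $$\dot x_n=-\frac1{2\pi}\sum_{m\ne n}\Gamma_m\frac{(x_n-x_m)^\perp}{|x_n-x_m|^2}\,P_K\!\left(\frac{|x_n-x_m|}{\varepsilon}\right)\qquad(n=1,2,3),$$ where the summand is $0$ if $x_n=x_m$. Let $X=(X_1,X_2,X_3)$ be a solution on $\mathbb R$ of this system with $\varepsilon=1$, with pairwise distinct initial points and with $-\frac1{2\pi}\sum_{n<m}\Gamma_n\Gamma_mH_P(L_{mn}(0)^2)=\mathscr H_c$, where $L_{mn}=|X_m-X_n|$. Assume that neither as $t\to+\infty$ nor as $t\to-\infty$ do the distances $(L_{mn}(t))$ converge to the distances of a relative equilibrium (a solution of the system with $\varepsilon=1$, coincident points allowed, whose mutual distances are constant in time), and that the distances $(L_{mn}(t))$ are not periodic in $t$. Put $$\mathscr Z_0(\tau)=-\frac1{2\pi}\sum_{n<m}\Gamma_n\Gamma_m\,Z(L_{mn}(\tau)^2).$$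 Then $\mathscr Z_0$ is integrable on $\mathbb R$ and $z_0=\int_{\mathbb R}\mathscr Z_0\,d\tau>0$. Moreover, for every $t^*\in\mathbb R$, the functions $x_n^\varepsilon(t)=\varepsilon X_n\!\left(\frac{t-t^*}{\varepsilon^2}\right)$ solve the system with parameter $\varepsilon$ for every $\varepsilon>0$; $|x_m^\varepsilon(t^*)-x_n^\varepsilon(t^*)|\to0$ as $\varepsilon\to0^+$; and the variational part of the enstrophy $$\mathscr Z^\varepsilon(t)=\frac1{2\pi\varepsilon^2}\sum_{n<m}\Gamma_n\Gamma_m\int_0^\infty s\,|2\pi\hat h(s)|^2J_0\!\left(s\,\frac{|x_m^\varepsilon(t)-x_n^\varepsilon(t)|}{\varepsilon}\right)ds$$ is continuous in $t$ and converges to $-z_0\,\delta(\cdot-t^*)$ in the sense of distributions as $\varepsilon\to0^+$. Thus enstrophy is dissipated at the collapse. -/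

import Mathlib

open MeasureTheory Set Filter Topology
open scoped ENNReal ContDiff

noncomputable section

namespace EulerPoincare

/-- The Euclidean plane. -/
abbrev Plane : Type := EuclideanSpace ℝ (Fin 2)

/-- `x^⊥ = (x₂, -x₁)`. -/
def perp (x : Plane) : Plane := !₂[x 1, -x 0]

/-- The radial profile `f_r` of a radial function: `f_r(r) = f(r, 0)`, so `f x = f_r ‖x‖`. -/
def profile (f : Plane → ℝ) (r : ℝ) : ℝ := f !₂[r, 0]

/-- The Bessel function of the first kind of order zero (Bessel's integral). -/
def besselJ0 (x : ℝ) : ℝ :=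
  1 / (2 * Real.pi) * ∫ θ in (-Real.pi)..Real.pi, Real.cos (x * Real.cos θ)

/-- The weight `χ_log⁻`. -/
def chiLogMinus (x : Plane) : ℝ := if ‖x‖ ≤ 1 then (1 - Real.log ‖x‖)⁻¹ else 0

/-- The weight `χ_α⁺`. -/
def chiPlus (α : ℝ) (x : Plane) : ℝ := if ‖x‖ ≤ 1 then 0 else ‖x‖ ^ α

/-- The weight `χ_α`. -/
def chi (α : ℝ) (x : Plane) : ℝ := ‖x‖ ^ α

/-- The conditions on the smoothing function `h` under which the enstrophy variation of three
regularized point vortices is studied (they include those of the well-posedness theory,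
`h ∈ W^{1,1}` and `χ_1⁺ h ∈ L¹`). -/
structure SmoothingHypotheses (h : Plane → ℝ) : Prop where
  contDiff : ContDiff ℝ 1 h
  pos : ∀ x, 0 < h x
  radial : ∀ x y, ‖x‖ = ‖y‖ → h x = h y
  integrable : Integrable h
  integrable_gradient : Integrable (gradient h)
  integrable_chiPlus : Integrable (fun x => chiPlus 1 x * h x)
  chiLogMinus_bounded : MemLp (fun x => chiLogMinus x * h x) ∞ volume
  chi_gradient_bounded : MemLp (fun x => chi 1 x • gradient h x) ∞ volume
  chi_gradient_integrable : Integrable (fun x => chi 1 x • gradient h x)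
  chi_bounded : ∃ η : ℝ, 0 < η ∧ MemLp (fun x => chi (3 + η) x * h x) ∞ volume
  integral_eq_one : ∫ x, h x = 1
  radial_integral_eq_one : 2 * Real.pi * ∫ r in Ioi (0 : ℝ), r * profile h r = 1
  deriv_profile_neg : ∀ r : ℝ, 0 < r → deriv (profile h) r < 0

/-- The Gaussian smoothing function. -/
def gaussianKernel (x : Plane) : ℝ := Real.exp (-‖x‖ ^ 2) / Real.pi

/-! ### Functions derived from the smoothing function -/

/-- The Hankel transform `ĥ(s) = ∫₀^∞ r h_r(r) J₀(r s) dr`. -/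
def hankel (h : Plane → ℝ) (s : ℝ) : ℝ :=
  ∫ r in Ioi (0 : ℝ), r * profile h r * besselJ0 (r * s)

/-- The integrand `s |2π ĥ(s)|² J₀(s L)`. -/
def enstrophyIntegrand (h : Plane → ℝ) (L s : ℝ) : ℝ :=
  s * |2 * Real.pi * hankel h s| ^ 2 * besselJ0 (s * L)

/-- `∫₀^∞ s |2π ĥ(s)|² J₀(s L) ds`. -/
def enstrophyIntegral (h : Plane → ℝ) (L : ℝ) : ℝ :=
  ∫ s in Ioi (0 : ℝ), enstrophyIntegrand h L s

/-- `Z(r) = ∫₀^∞ s |2π ĥ(s)|² J₀(s √r) ds`. -/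
def funZ (h : Plane → ℝ) (r : ℝ) : ℝ := enstrophyIntegral h (Real.sqrt r)

/-- The logarithmic potential `G¹`, the solution of `-Δ G¹ = h`. -/
def potential (h : Plane → ℝ) (x : Plane) : ℝ :=
  -(1 / (2 * Real.pi)) * ∫ y, Real.log ‖x - y‖ * h y

/-- `P_K(r) = -2π r (G_r¹)'(r)`. -/
def funPK (h : Plane → ℝ) (r : ℝ) : ℝ := -2 * Real.pi * r * deriv (profile (potential h)) r

/-- `H_G(r) = -log r - 2π G_r¹(r)`. -/
def funHG (h : Plane → ℝ) (r : ℝ) : ℝ := -Real.log r - 2 * Real.pi * profile (potential h) r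

/-- `H_P(r) = log √r + H_G(√r)`. -/
def funHP (h : Plane → ℝ) (r : ℝ) : ℝ := Real.log (Real.sqrt r) + funHG h (Real.sqrt r)

/-! ### The Euler-Poincaré point vortex system -/

/-- Global-in-time solutions of the point vortex system with regularization parameter `ε`,
`dx_n/dt = -(1/2π) ∑_{m ≠ n} Γ_m (x_n - x_m)^⊥ / l_{mn}² · P_K(l_{mn}/ε)`.
(For coincident points the summand is `0`, in accordance with `K^ε(0) = 0`.) -/
def IsSolution (h : Plane → ℝ) (ε : ℝ) {N : ℕ} (Γ : Fin N → ℝ) (x : Fin N → ℝ → Plane) : Prop :=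
  ∀ n t, HasDerivAt (x n)
    (-(1 / (2 * Real.pi)) • ∑ m ∈ Finset.univ.erase n,
      (Γ m / dist (x m t) (x n t) ^ 2 * funPK h (dist (x m t) (x n t) / ε)) •
        perp (x n t - x m t)) t

/-- The Hamiltonian of the system with `ε = 1`,
`-(1/2π) ∑_{n < m} Γ_n Γ_m H_P(L_{mn}²)`. -/
def hamiltonian (h : Plane → ℝ) {N : ℕ} (Γ : Fin N → ℝ) (X : Fin N → Plane) : ℝ :=
  -(1 / (2 * Real.pi)) * ∑ n, ∑ m ∈ Finset.Ioi n, Γ n * Γ m * funHP h (dist (X m) (X n) ^ 2)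

/-- The variational part of the enstrophy,
`𝒵^ε(t) = 1/(2π ε²) ∑_{n < m} Γ_n Γ_m ∫₀^∞ s |2π ĥ(s)|² J₀(s l_{mn}(t)/ε) ds`. -/
def enstrophyVariation (h : Plane → ℝ) (ε : ℝ) {N : ℕ} (Γ : Fin N → ℝ) (x : Fin N → ℝ → Plane)
    (t : ℝ) : ℝ :=
  1 / (2 * Real.pi * ε ^ 2) * ∑ n, ∑ m ∈ Finset.Ioi n,
    Γ n * Γ m * enstrophyIntegral h (dist (x m t) (x n t) / ε)

/-- `𝒵₀(τ) = -(1/2π) ∑_{n < m} Γ_n Γ_m ∫₀^∞ s |2π ĥ(s)|² J₀(s L_{mn}(τ)) ds`. -/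
def scaledEnstrophy (h : Plane → ℝ) {N : ℕ} (Γ : Fin N → ℝ) (X : Fin N → ℝ → Plane)
    (τ : ℝ) : ℝ :=
  -(1 / (2 * Real.pi)) * ∑ n, ∑ m ∈ Finset.Ioi n,
    Γ n * Γ m * enstrophyIntegral h (dist (X m τ) (X n τ))

/-- `z₀ = ∫_{-∞}^{∞} 𝒵₀(τ) dτ`. -/
def enstrophyMass (h : Plane → ℝ) {N : ℕ} (Γ : Fin N → ℝ) (X : Fin N → ℝ → Plane) : ℝ :=
  ∫ τ, scaledEnstrophy h Γ X τ

/-- Recovery of the `ε`-point vortices from the scaled variables,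
`x_n^ε(t) = ε X_n((t - t^*)/ε²)`. -/
def unscale (ε tstar : ℝ) {N : ℕ} (X : Fin N → ℝ → Plane) : Fin N → ℝ → Plane :=
  fun n t => ε • X n ((t - tstar) / ε ^ 2)

/-- Along `l` (time to `+∞` or to `-∞`) the mutual distances of `X` converge to those of a relative
equilibrium, that is, of a solution `Y` whose mutual distances are constant in time. -/
def ConvergesToRelativeEquilibrium (h : Plane → ℝ) {N : ℕ} (Γ : Fin N → ℝ)
    (X : Fin N → ℝ → Plane) (l : Filter ℝ) : Prop :=
  ∃ Y : Fin N → ℝ → Plane, IsSolution h 1 Γ Y ∧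
    (∀ m n t, dist (Y m t) (Y n t) = dist (Y m 0) (Y n 0)) ∧
    ∀ m n, Tendsto (fun t => dist (X m t) (X n t)) l (𝓝 (dist (Y m 0) (Y n 0)))

/-- The mutual distances of `X` are periodic in time. -/
def HasPeriodicDistances {N : ℕ} (X : Fin N → ℝ → Plane) : Prop :=
  ∃ T : ℝ, 0 < T ∧ ∀ m n t, dist (X m (t + T)) (X n (t + T)) = dist (X m t) (X n t)

/-! ### The range of the Hamiltonian -/

/-- `ψ(r) = (1/(1+r))^{1/Γ₁} (r/(1+r))^{1/Γ₂}`. -/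
def psi (Γ₁ Γ₂ r : ℝ) : ℝ := (1 / (1 + r)) ^ (1 / Γ₁) * (r / (1 + r)) ^ (1 / Γ₂)

def kPlus (Γ₁ Γ₂ : ℝ) : ℝ := ((Γ₁ + Γ₂ + Real.sqrt (Γ₁ ^ 2 + Γ₁ * Γ₂ + Γ₂ ^ 2)) / Γ₂) ^ 2

def kMinus (Γ₁ Γ₂ : ℝ) : ℝ := ((Γ₁ + Γ₂ - Real.sqrt (Γ₁ ^ 2 + Γ₁ * Γ₂ + Γ₂ ^ 2)) / Γ₂) ^ 2

open Classical in
/-- The one of `k_+`, `k_-` at which `k ↦ ψ(Γ₁ k / Γ₂)` is smaller. -/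
def kZero (Γ₁ Γ₂ : ℝ) : ℝ :=
  if psi Γ₁ Γ₂ (Γ₁ / Γ₂ * kPlus Γ₁ Γ₂) ≤ psi Γ₁ Γ₂ (Γ₁ / Γ₂ * kMinus Γ₁ Γ₂) then kPlus Γ₁ Γ₂
  else kMinus Γ₁ Γ₂

/-- The lower end of the admissible range of the Hamiltonian. -/
def hamiltonianLowerBound (Γ₁ Γ₂ : ℝ) : ℝ :=
  Γ₁ ^ 2 * Γ₂ ^ 2 / (4 * Real.pi * (Γ₁ + Γ₂)) *
    Real.log (psi Γ₁ Γ₂ (Γ₁ / Γ₂ * kZero Γ₁ Γ₂) * (psi Γ₁ Γ₂ (Γ₁ / Γ₂))⁻¹)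

end EulerPoincare

end

open EulerPoincare

noncomputable section

namespace EulerPoincare

/-! ### Elementary functions of the Gaussian system -/

/-! For the Gaussian everything is explicit: `Z(r) = e^{-r/2}`, and `H_P` is `logPotential`, here
written L, with derivative g/2 where g is `expQuotient`. Write a, b > 0 > c for the circulations, x,
y, z for the squared sides opposite the corresponding vortices, and p = b/(a+b), q = a/(a+b). The
vanishing sum of reciprocals gives ap = bq = -c. Hence the energy becomes pL(x) + qL(y) - L(z) = e,
with e < 0, and the scaled enstrophy is a positive multiple of pZ(x) + qZ(y) - Z(z).

Positivity is Jensen's inequality. The Wronskian inequality says that Z is convex as a function of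
L. If L(w) = pL(x) + qL(y), then pZ(x) + qZ(y) ≥ Z(w), while e < 0 forces w < z and so Z(w) > Z(z)
(`enstrophy_density_pos`).

Integrability needs the long time behaviour of the closed system for x, y, z and twice the oriented
area A. This system is reversible under A ↦ -A, so two zeros of A make the distances periodic.
Excluding periodicity, A has a fixed sign near each end of time. When two sides agree, e < 0
determines how each compares with the third, so every difference of sides can cross zero in one
direction only. The sides are therefore eventually ordered, x and y are eventually monotone, and
each converges or tends to infinity.

If the sides converge, all rates vanish in the limit. The limit is collinear, because an equilateral
limit has e = 0, and it is realized by a rigid motion; this case is excluded by hypothesis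
(`limit_equilibrium`, `exists_relativeEquilibrium`). Otherwise all sides tend to infinity with a
ratio fixed by e, and |A| stays above a positive constant (`eventually_one_le_area`). Then the
smaller of x and y, say x, satisfies x' ≥ const/x, which makes e^{-x/2} integrable.

Finally, the enstrophy variation is a parabolic rescaling of an integrable function of positive
mass, and dominated convergence gives the Dirac mass. -/

/-- The entire function `x ↦ (1 - e^{-x}) / x`. -/
def expQuotient (x : ℝ) : ℝ := dslope (fun u : ℝ => -Real.exp (-u)) 0 x

theorem expQuotient_of_ne {x : ℝ} (hx : x ≠ 0) : expQuotient x = (1 - Real.exp (-x)) / x := by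
  rw [expQuotient, dslope_of_ne _ hx, slope_def_field]
  simp
  ring

theorem expQuotient_zero : expQuotient 0 = 1 := by
  rw [expQuotient, dslope_same]
  have : HasDerivAt (fun u : ℝ => -Real.exp (-u)) (-(Real.exp (-0) * -1)) 0 :=
    ((hasDerivAt_id (0 : ℝ)).neg.exp).neg
  rw [this.deriv]
  simp

theorem mul_expQuotient (x : ℝ) : x * expQuotient x = 1 - Real.exp (-x) := by
  rcases eq_or_ne x 0 with rfl | hx
  · simp
  · rw [expQuotient_of_ne hx]
    field_simp

/-- Regularity across 0 comes from the power series of the divided slope. It makes the reduced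
vector field C¹ even where vortices coincide, so that uniqueness of solutions applies. -/
theorem contDiff_expQuotient : ContDiff ℝ 1 expQuotient := by
  rw [contDiff_iff_contDiffAt]
  intro x
  rcases eq_or_ne x 0 with rfl | hx
  · have h : AnalyticAt ℝ (fun u : ℝ => -Real.exp (-u)) 0 := by fun_prop
    obtain ⟨p, hp⟩ := h
    exact (hp.has_fpower_series_dslope_fslope).analyticAt.contDiffAt
  · have h : (fun u : ℝ => (1 - Real.exp (-u)) / u) =ᶠ[𝓝 x] expQuotient := by
      filter_upwards [isOpen_ne.mem_nhds hx] with u hu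
      exact (expQuotient_of_ne hu).symm
    refine ContDiffAt.congr_of_eventuallyEq ?_ h.symm
    exact ContDiffAt.div (by fun_prop) contDiffAt_id hx

theorem continuous_expQuotient : Continuous expQuotient := contDiff_expQuotient.continuous

theorem hasDerivAt_one_sub_exp_div {x : ℝ} (hx : x ≠ 0) :
    HasDerivAt (fun u : ℝ => (1 - Real.exp (-u)) / u)
      ((x * Real.exp (-x) - (1 - Real.exp (-x))) / x ^ 2) x := by
  have h1 : HasDerivAt (fun u : ℝ => 1 - Real.exp (-u)) (-(Real.exp (-x) * -1)) x :=
    ((hasDerivAt_id x).neg.exp).const_sub 1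
  convert! h1.div (hasDerivAt_id x) hx using 1
  simp
  ring

/-- The numerator of the derivative is e^{-x}(x + 1 - e^x). Monotonicity turns every comparison of
side lengths into the sign of a rate of change. -/
theorem strictAntiOn_expQuotient : StrictAntiOn expQuotient (Ici 0) := by
  refine strictAntiOn_of_deriv_neg (convex_Ici 0) continuous_expQuotient.continuousOn ?_
  intro x hx
  rw [interior_Ici] at hx
  have hx : 0 < x := hx
  have h : (fun u : ℝ => (1 - Real.exp (-u)) / u) =ᶠ[𝓝 x] expQuotient := by
    filter_upwards [isOpen_ne.mem_nhds hx.ne'] with u hu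
    exact (expQuotient_of_ne hu).symm
  rw [← h.deriv_eq, (hasDerivAt_one_sub_exp_div hx.ne').deriv]
  refine div_neg_of_neg_of_pos ?_ (by positivity)
  have h2 : x + 1 < Real.exp x := Real.add_one_lt_exp hx.ne'
  have h3 : Real.exp x * Real.exp (-x) = 1 := by rw [← Real.exp_add]; simp
  nlinarith [Real.exp_pos (-x)]

theorem expQuotient_pos {x : ℝ} (hx : 0 ≤ x) : 0 < expQuotient x := by
  rcases hx.eq_or_lt with rfl | hx
  · simp [expQuotient_zero]
  · rw [expQuotient_of_ne hx.ne']
    exact div_pos (by simpa using hx) hx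

/-! ### The logarithmic interaction and its exponential integral tail. -/

theorem integrableOn_exp_neg_mul_log : IntegrableOn (fun u : ℝ => Real.exp (-u) * Real.log u) (Ioi 0) := by
  have h1 : IntegrableOn (fun u : ℝ => Real.exp (-u) * Real.log u) (Ioc 0 1) := by
    have : IntervalIntegrable (fun u : ℝ => Real.exp (-u) * Real.log u) volume 0 1 :=
      intervalIntegral.intervalIntegrable_log'.continuousOn_mul (by fun_prop)
    rwa [intervalIntegrable_iff_integrableOn_Ioc_of_le zero_le_one] at this
  have h2 : IntegrableOn (fun u : ℝ => Real.exp (-u) * Real.log u) (Ioi 1) := by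
    have h3 : IntegrableOn (fun u : ℝ => Real.exp (-u) * u) (Ioi 0) := by
      have := Real.GammaIntegral_convergent (s := 2) (by norm_num)
      refine this.congr_fun (fun u hu => ?_) measurableSet_Ioi
      norm_num
    refine Integrable.mono' (h3.mono_set (Ioi_subset_Ioi zero_le_one)) ?_ ?_
    · exact ((by fun_prop : Measurable fun u : ℝ => Real.exp (-u)).mul
        Real.measurable_log).aestronglyMeasurable
    · refine (ae_restrict_iff' measurableSet_Ioi).2 (ae_of_all _ fun u hu => ?_)
      have hu : 1 < u := hu
      rw [Real.norm_eq_abs, abs_mul, abs_of_pos (Real.exp_pos _), abs_of_nonneg (Real.log_nonneg hu.le)]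
      exact mul_le_mul_of_nonneg_left (Real.log_le_self (by linarith)) (Real.exp_pos _).le
  rw [← Ioc_union_Ioi_eq_Ioi (zero_le_one (α := ℝ))]
  exact h1.union h2

/-- The logarithmic interaction `½ ∫₀^∞ e^{-u} log (max x u) du`. -/
def logPotential (x : ℝ) : ℝ :=
  1 / 2 * ((1 - Real.exp (-x)) * Real.log x + ∫ u in Ioi x, Real.exp (-u) * Real.log u)

theorem integral_Ioi_exp_neg_mul_log {x : ℝ} (hx : 0 ≤ x) :
    ∫ u in Ioi x, Real.exp (-u) * Real.log u =
      (∫ u in Ioi (0 : ℝ), Real.exp (-u) * Real.log u) -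
        ∫ u in (0 : ℝ)..x, Real.exp (-u) * Real.log u := by
  have h := intervalIntegral.integral_interval_add_Ioi integrableOn_exp_neg_mul_log
    (integrableOn_exp_neg_mul_log.mono_set (Ioi_subset_Ioi hx))
  linarith

theorem intervalIntegrable_exp_neg_mul_log (a b : ℝ) :
    IntervalIntegrable (fun u : ℝ => Real.exp (-u) * Real.log u) volume a b :=
  intervalIntegral.intervalIntegrable_log'.continuousOn_mul (by fun_prop)

/-- The only singular term, (1 - e^{-x}) log x, equals g(x) · x log x with g = `expQuotient`, and x
log x is continuous at 0. The endpoint matters because sides may vanish. -/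
theorem continuousOn_logPotential : ContinuousOn logPotential (Ici 0) := by
  have h : ContinuousOn (fun x : ℝ => 1 / 2 * (expQuotient x * (x * Real.log x) +
      ((∫ u in Ioi (0 : ℝ), Real.exp (-u) * Real.log u) -
        ∫ u in (0 : ℝ)..x, Real.exp (-u) * Real.log u))) (Ici 0) := by
    apply Continuous.continuousOn
    refine continuous_const.mul ((continuous_expQuotient.mul Real.continuous_mul_log).add
      (continuous_const.sub ?_))
    exact intervalIntegral.continuous_primitive intervalIntegrable_exp_neg_mul_log 0
  refine h.congr fun x hx => ?_
  rw [logPotential, integral_Ioi_exp_neg_mul_log hx, ← mul_expQuotient]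
  ring

/-- The two contributions ± e^{-x} log x cancel, leaving only the derivative of the logarithm. -/
theorem hasDerivAt_logPotential {x : ℝ} (hx : 0 < x) :
    HasDerivAt logPotential (expQuotient x / 2) x := by
  have h1 : HasDerivAt (fun x : ℝ => ∫ u in (0 : ℝ)..x, Real.exp (-u) * Real.log u)
      (Real.exp (-x) * Real.log x) x := by
    refine intervalIntegral.integral_hasDerivAt_right (intervalIntegrable_exp_neg_mul_log _ _) ?_ ?_
    · exact ((by fun_prop : Measurable fun u : ℝ => Real.exp (-u)).mul
        Real.measurable_log).stronglyMeasurable.stronglyMeasurableAtFilter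
    · exact ContinuousAt.mul (by fun_prop) (Real.continuousAt_log hx.ne')
  have h2 : HasDerivAt (fun u : ℝ => 1 - Real.exp (-u)) (-(Real.exp (-x) * -1)) x :=
    ((hasDerivAt_id x).neg.exp).const_sub 1
  have h3 := ((h2.mul (Real.hasDerivAt_log hx.ne')).add (h1.const_sub
    (∫ u in Ioi (0 : ℝ), Real.exp (-u) * Real.log u))).const_mul (1 / 2)
  have h4 : HasDerivAt logPotential _ x := h3.congr_of_eventuallyEq (by
    filter_upwards [Ioi_mem_nhds hx] with y hy
    rw [logPotential, integral_Ioi_exp_neg_mul_log (le_of_lt hy)]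
    rfl)
  convert h4 using 1
  rw [expQuotient_of_ne hx.ne']
  field_simp
  ring

theorem strictMonoOn_logPotential : StrictMonoOn logPotential (Ici 0) := by
  refine strictMonoOn_of_deriv_pos (convex_Ici 0) continuousOn_logPotential ?_
  intro x hx
  rw [interior_Ici] at hx
  rw [(hasDerivAt_logPotential hx).deriv]
  exact half_pos (expQuotient_pos (le_of_lt hx))

/-- The deviation of twice the logarithmic interaction from the logarithm (an exponential
integral). -/
def logTail (x : ℝ) : ℝ := 2 * logPotential x - Real.log x

theorem hasDerivAt_logTail {x : ℝ} (hx : 0 < x) : HasDerivAt logTail (-(Real.exp (-x) / x)) x := by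
  convert! ((hasDerivAt_logPotential hx).const_mul 2).sub (Real.hasDerivAt_log hx.ne') using 1
  rw [expQuotient_of_ne hx.ne']
  field_simp
  ring

theorem tendsto_logTail : Tendsto logTail atTop (𝓝 0) := by
  have h1 : Tendsto (fun x : ℝ => ∫ u in (0 : ℝ)..x, Real.exp (-u) * Real.log u) atTop
      (𝓝 (∫ u in Ioi (0 : ℝ), Real.exp (-u) * Real.log u)) :=
    intervalIntegral_tendsto_integral_Ioi 0 integrableOn_exp_neg_mul_log tendsto_id
  have h2 : Tendsto (fun x : ℝ => Real.exp (-x) * Real.log x) atTop (𝓝 0) := by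
    have h3 : Tendsto (fun x : ℝ => x * Real.exp (-x)) atTop (𝓝 0) := by
      simpa using Real.tendsto_pow_mul_exp_neg_atTop_nhds_zero 1
    refine squeeze_zero' ?_ ?_ h3
    · filter_upwards [eventually_ge_atTop 1] with x hx
      exact mul_nonneg (Real.exp_pos _).le (Real.log_nonneg hx)
    · filter_upwards [eventually_ge_atTop 1] with x hx
      rw [mul_comm]
      exact mul_le_mul_of_nonneg_right (Real.log_le_self (by linarith)) (Real.exp_pos _).le
  have h4 := ((tendsto_const_nhds (x := ∫ u in Ioi (0 : ℝ), Real.exp (-u) * Real.log u)).sub h1).sub h2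
  simp only [sub_self] at h4
  refine h4.congr' ?_
  filter_upwards [eventually_ge_atTop 0] with x hx
  rw [logTail, logPotential, integral_Ioi_exp_neg_mul_log hx]
  ring

theorem strictAntiOn_logTail : StrictAntiOn logTail (Ioi 0) := by
  refine strictAntiOn_of_deriv_neg (convex_Ioi 0)
    (fun x hx => (hasDerivAt_logTail hx).continuousAt.continuousWithinAt) ?_
  intro x hx
  rw [interior_Ioi] at hx
  have hx : 0 < x := hx
  rw [(hasDerivAt_logTail hx).deriv]
  have : 0 < Real.exp (-x) / x := by positivity
  linarith

theorem logTail_pos {x : ℝ} (hx : 0 < x) : 0 < logTail x := by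
  have h1 : logTail (x + 1) < logTail x :=
    strictAntiOn_logTail (show x ∈ Ioi 0 from hx) (show x + 1 ∈ Ioi 0 by simp; linarith) (by linarith)
  have h2 : 0 ≤ logTail (x + 1) := by
    refine le_of_tendsto tendsto_logTail ?_
    filter_upwards [eventually_ge_atTop (x + 1)] with y hy
    exact strictAntiOn_logTail.antitoneOn (show x + 1 ∈ Ioi 0 by simp; linarith)
      (show y ∈ Ioi 0 by simp; linarith) hy
  linarith

/-- The difference of the two sides has derivative e^{-x}/x² ≥ 0 and tends to 0 at infinity, so it
is nonpositive. -/
theorem logTail_le {x : ℝ} (hx : 0 < x) : logTail x ≤ Real.exp (-x) / x := by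
  have hd : ∀ y : ℝ, 0 < y → HasDerivAt (fun u => logTail u - Real.exp (-u) / u)
      (Real.exp (-y) / y ^ 2) y := by
    intro y hy
    have h2 : HasDerivAt (fun u : ℝ => Real.exp (-u)) (Real.exp (-y) * -1) y :=
      (hasDerivAt_id y).neg.exp
    convert! (hasDerivAt_logTail hy).sub (h2.div (hasDerivAt_id y) hy.ne') using 1
    simp
    field_simp
    ring
  have hmono : MonotoneOn (fun u => logTail u - Real.exp (-u) / u) (Ioi 0) := by
    refine monotoneOn_of_deriv_nonneg (convex_Ioi 0)
      (fun y hy => (hd y hy).continuousAt.continuousWithinAt)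
      (fun y hy => ((hd y (by simpa using hy)).differentiableAt.differentiableWithinAt)) ?_
    intro y hy
    rw [interior_Ioi] at hy
    rw [(hd y hy).deriv]
    positivity
  have hlim : Tendsto (fun u => logTail u - Real.exp (-u) / u) atTop (𝓝 (0 - 0)) := by
    refine tendsto_logTail.sub ?_
    exact (Real.tendsto_exp_neg_atTop_nhds_zero).div_atTop tendsto_id
  have : logTail x - Real.exp (-x) / x ≤ 0 - 0 := by
    refine ge_of_tendsto hlim ?_
    filter_upwards [eventually_ge_atTop x] with y hy
    exact hmono hx (show (0:ℝ) < y by linarith) hy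
  linarith

/-- By `logTail_le`, e^u `logTail u` is nonincreasing. This makes the tail of a much longer side
negligible against that of a shorter one. -/
theorem logTail_add_le {x d : ℝ} (hx : 0 < x) (hd : 0 ≤ d) :
    logTail (x + d) ≤ Real.exp (-d) * logTail x := by
  have hder : ∀ y : ℝ, 0 < y → HasDerivAt (fun u => Real.exp u * logTail u)
      (Real.exp y * logTail y + Real.exp y * -(Real.exp (-y) / y)) y := fun y hy =>
    (Real.hasDerivAt_exp y).mul (hasDerivAt_logTail hy)
  have hanti : AntitoneOn (fun u => Real.exp u * logTail u) (Ioi 0) := by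
    refine antitoneOn_of_deriv_nonpos (convex_Ioi 0)
      (fun y hy => (hder y hy).continuousAt.continuousWithinAt)
      (fun y hy => ((hder y (by simpa using hy)).differentiableAt.differentiableWithinAt)) ?_
    intro y hy
    rw [interior_Ioi] at hy
    rw [(hder y hy).deriv]
    nlinarith [logTail_le hy, Real.exp_pos y]
  have h := hanti (show x ∈ Ioi 0 from hx) (show x + d ∈ Ioi 0 by simp; linarith) (by linarith)
  simp only [Real.exp_add] at h
  have h3 : Real.exp (-d) * Real.exp d = 1 := by rw [← Real.exp_add]; simp
  have h4 : Real.exp x * (Real.exp d * logTail (x + d)) ≤ Real.exp x * logTail x := by linarith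
  have h5 := le_of_mul_le_mul_left h4 (Real.exp_pos x)
  calc logTail (x + d) = Real.exp (-d) * (Real.exp d * logTail (x + d)) := by
        rw [← mul_assoc, h3, one_mul]
    _ ≤ _ := mul_le_mul_of_nonneg_left h5 (Real.exp_pos _).le

/-- The interaction of `Z = e^{-r/2}` with the logarithmic potential. -/
theorem exp_wronskian_pos {r : ℝ} (hr : 0 < r) : 0 < r - 2 + (r + 2) * Real.exp (-r) := by
  have hd : ∀ x : ℝ, HasDerivAt (fun r : ℝ => r - 2 + (r + 2) * Real.exp (-r))
      (1 + (1 * Real.exp (-x) + (x + 2) * (Real.exp (-x) * -1))) x := fun x =>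
    ((hasDerivAt_id x).sub_const 2).add (((hasDerivAt_id x).add_const 2).mul
      ((hasDerivAt_id x).neg.exp))
  have hm : StrictMonoOn (fun r : ℝ => r - 2 + (r + 2) * Real.exp (-r)) (Ici 0) := by
    refine strictMonoOn_of_deriv_pos (convex_Ici 0)
      (fun x _ => (hd x).continuousAt.continuousWithinAt) ?_
    intro x hx
    rw [interior_Ici] at hx
    have hx : 0 < x := hx
    rw [(hd x).deriv]
    have h2 : x + 1 < Real.exp x := Real.add_one_lt_exp hx.ne'
    have h3 : Real.exp x * Real.exp (-x) = 1 := by rw [← Real.exp_add]; simp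
    nlinarith [Real.exp_pos (-x)]
  have := hm (show (0 : ℝ) ∈ Ici 0 by simp) (show r ∈ Ici 0 from hr.le) hr
  simpa using this

/-- This is Z'' H_P' - Z' H_P'' written out. Clearing denominators leaves the positive quantity of
`exp_wronskian_pos`. -/
theorem wronskian_pos {r : ℝ} (hr : 0 < r) :
    0 < Real.exp (-r / 2) / 4 * (expQuotient r / 2) +
      Real.exp (-r / 2) / 2 * (((r * Real.exp (-r) - (1 - Real.exp (-r))) / r ^ 2) / 2) := by
  have h := exp_wronskian_pos hr
  rw [expQuotient_of_ne hr.ne']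
  have : Real.exp (-r / 2) / 4 * ((1 - Real.exp (-r)) / r / 2) +
      Real.exp (-r / 2) / 2 * (((r * Real.exp (-r) - (1 - Real.exp (-r))) / r ^ 2) / 2)
      = Real.exp (-r / 2) * (r - 2 + (r + 2) * Real.exp (-r)) / (8 * r ^ 2) := by
    field_simp
    ring
  rw [this]
  positivity

/-! ### Integration in polar coordinates and the Hankel transform of a Gaussian -/

theorem measurePreserving_plane :
    MeasurePreserving (Complex.measurableEquivRealProd.symm.trans
      Complex.orthonormalBasisOneI.measurableEquiv) :=
  (Complex.volume_preserving_equiv_real_prod.symm).trans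
    Complex.orthonormalBasisOneI.measurePreserving_measurableEquiv

theorem plane_equiv_apply (p : ℝ × ℝ) :
    (Complex.measurableEquivRealProd.symm.trans
      Complex.orthonormalBasisOneI.measurableEquiv) p = !₂[p.1, p.2] := by
  change Complex.orthonormalBasisOneI.repr (Complex.measurableEquivRealProd.symm p) = _
  ext i
  rw [Complex.orthonormalBasisOneI_repr_apply]
  fin_cases i <;> simp [Complex.measurableEquivRealProd]

/-- Change of variables on the product of half-line and interval, followed by Fubini. Integrability
of the angular integral is kept because it is part of Weber's formula. -/
theorem integral_polar {f : Plane → ℝ} (hf : Integrable f) :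
    IntegrableOn (fun r => ∫ θ in (-Real.pi)..Real.pi, r * f !₂[r * Real.cos θ, r * Real.sin θ])
      (Ioi 0) ∧
    ∫ x, f x = ∫ r in Ioi (0 : ℝ), ∫ θ in (-Real.pi)..Real.pi,
      r * f !₂[r * Real.cos θ, r * Real.sin θ] := by
  have hF : Integrable (fun p : ℝ × ℝ => f !₂[p.1, p.2]) := by
    have := (measurePreserving_plane.integrable_comp_emb
      (MeasurableEquiv.measurableEmbedding _) (g := f)).2 hf
    refine this.congr (ae_of_all _ fun p => ?_)
    simp only [Function.comp, plane_equiv_apply]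
  have hI : ∫ x, f x = ∫ p : ℝ × ℝ, f !₂[p.1, p.2] := by
    rw [← measurePreserving_plane.integral_comp (MeasurableEquiv.measurableEmbedding _)]
    simp only [plane_equiv_apply]
  have hP : IntegrableOn (fun p : ℝ × ℝ => p.1 * f !₂[p.1 * Real.cos p.2, p.1 * Real.sin p.2])
      (Ioi 0 ×ˢ Ioo (-Real.pi) Real.pi) := by
    have h1 : IntegrableOn (fun p : ℝ × ℝ => f !₂[p.1, p.2])
        (polarCoord.symm '' polarCoord.target) := hF.integrableOn
    rw [integrableOn_image_iff_integrableOn_abs_det_fderiv_smul volume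
      polarCoord.open_target.measurableSet
      (fun p _ => (hasFDerivAt_polarCoord_symm p).hasFDerivWithinAt)
      polarCoord.symm.injOn] at h1
    refine h1.congr_fun (fun p hp => ?_) polarCoord.open_target.measurableSet
    have hp1 : 0 < p.1 := hp.1
    simp [det_fderivPolarCoordSymm, abs_of_pos hp1]
  have hP' : Integrable (fun p : ℝ × ℝ => p.1 * f !₂[p.1 * Real.cos p.2, p.1 * Real.sin p.2])
      ((volume.restrict (Ioi 0)).prod (volume.restrict (Ioo (-Real.pi) Real.pi))) := by
    rw [Measure.prod_restrict]; exact hP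
  have hcv : ∀ r : ℝ, ∫ θ in (-Real.pi)..Real.pi, r * f !₂[r * Real.cos θ, r * Real.sin θ] =
      ∫ θ in Ioo (-Real.pi) Real.pi, r * f !₂[r * Real.cos θ, r * Real.sin θ] := fun r => by
    rw [intervalIntegral.integral_of_le (by linarith [Real.pi_pos]), integral_Ioc_eq_integral_Ioo]
  simp only [hcv]
  refine ⟨hP'.integral_prod_left, ?_⟩
  rw [hI, ← integral_comp_polarCoord_symm]
  calc _ = ∫ p in Ioi 0 ×ˢ Ioo (-Real.pi) Real.pi,
        p.1 * f !₂[p.1 * Real.cos p.2, p.1 * Real.sin p.2] := by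
        simp [polarCoord_target]
    _ = _ := setIntegral_prod _ hP

/-- Real part of the Fourier transform of a complex Gaussian at frequency b along the first axis. -/
theorem integrable_gaussian_mul_cos {a : ℝ} (ha : 0 < a) (b : ℝ) :
    Integrable (fun x : Plane => Real.exp (-a * ‖x‖ ^ 2) * Real.cos (b * x 0)) ∧
    ∫ x : Plane, Real.exp (-a * ‖x‖ ^ 2) * Real.cos (b * x 0) =
      Real.pi / a * Real.exp (-b ^ 2 / (4 * a)) := by
  have hre : ∀ x : Plane, RCLike.re (Complex.exp (-(a : ℂ) * ‖x‖ ^ 2 +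
      (b * Complex.I) * (inner ℝ (!₂[1, 0] : Plane) x : ℝ))) =
      Real.exp (-a * ‖x‖ ^ 2) * Real.cos (b * x 0) := by
    intro x
    have h2 : (inner ℝ (!₂[1, 0] : Plane) x : ℝ) = x 0 := by
      simp [PiLp.inner_apply, Fin.sum_univ_two]
    have h3 : -(a : ℂ) * ‖x‖ ^ 2 + (b * Complex.I) * (x 0 : ℝ) =
        ((-a * ‖x‖ ^ 2 : ℝ) : ℂ) + ((b * x 0 : ℝ) : ℂ) * Complex.I := by
      push_cast; ring
    rw [h2, h3]
    change (Complex.exp _).re = _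
    generalize -a * ‖x‖ ^ 2 = u
    rw [Complex.exp_re]
    simp
  have hint := GaussianFourier.integrable_cexp_neg_mul_sq_norm_add (V := Plane) (b := (a : ℂ))
    (by simpa using ha) (b * Complex.I) (!₂[1, 0])
  refine ⟨?_, ?_⟩
  · refine hint.re.congr (ae_of_all _ fun x => ?_)
    exact hre x
  · have h1 := GaussianFourier.integral_cexp_neg_mul_sq_norm_add (V := Plane) (b := (a : ℂ))
      (by simpa using ha) (b * Complex.I) (!₂[1, 0])
    have h2 := integral_re hint
    simp only [hre] at h2
    rw [h2, h1]
    have h4 : ‖(!₂[1, 0] : Plane)‖ = 1 := by simp [EuclideanSpace.norm_eq, Fin.sum_univ_two]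
    have h5 : ((b : ℂ) * Complex.I) ^ 2 * (‖(!₂[1, 0] : Plane)‖ : ℂ) ^ 2 / (4 * a) =
        ((-b ^ 2 / (4 * a) : ℝ) : ℂ) := by
      rw [h4]; push_cast; rw [mul_pow, Complex.I_sq]; ring
    rw [h5]
    have h6 : ((Real.pi : ℂ) / a) ^ ((Module.finrank ℝ Plane : ℂ) / 2) = ((Real.pi / a : ℝ) : ℂ) := by
      simp
    rw [h6, ← Complex.ofReal_exp, ← Complex.ofReal_mul]
    exact Complex.ofReal_re _

theorem norm_polar {r : ℝ} (hr : 0 ≤ r) (θ : ℝ) :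
    ‖(!₂[r * Real.cos θ, r * Real.sin θ] : Plane)‖ = r := by
  rw [EuclideanSpace.norm_eq, Fin.sum_univ_two]
  simp only [Matrix.cons_val_zero, Matrix.cons_val_one, Real.norm_eq_abs, sq_abs]
  rw [mul_pow, mul_pow, ← mul_add, Real.cos_sq_add_sin_sq, mul_one, Real.sqrt_sq hr]

/-- Weber's integral. -/
theorem integral_gaussian_mul_besselJ0 {a : ℝ} (ha : 0 < a) (b : ℝ) :
    IntegrableOn (fun r => r * Real.exp (-a * r ^ 2) * besselJ0 (r * b)) (Ioi 0) ∧
    ∫ r in Ioi (0 : ℝ), r * Real.exp (-a * r ^ 2) * besselJ0 (r * b) =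
      Real.exp (-b ^ 2 / (4 * a)) / (2 * a) := by
  obtain ⟨h1, h2⟩ := integrable_gaussian_mul_cos ha b
  obtain ⟨h3, h4⟩ := integral_polar h1
  -- The angular integral of the plane wave cos(br cos θ) is Bessel's integral, so Weber's formula
  -- is the planar Gaussian Fourier transform in polar coordinates.
  have h5 : ∀ r ∈ Ioi (0 : ℝ), ∫ θ in (-Real.pi)..Real.pi,
      r * (Real.exp (-a * ‖(!₂[r * Real.cos θ, r * Real.sin θ] : Plane)‖ ^ 2) *
        Real.cos (b * (!₂[r * Real.cos θ, r * Real.sin θ] : Plane) 0)) =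
      2 * Real.pi * (r * Real.exp (-a * r ^ 2) * besselJ0 (r * b)) := by
    intro r hr
    have hr : 0 < r := hr
    simp only [norm_polar hr.le, Matrix.cons_val_zero, besselJ0, ← mul_assoc,
      intervalIntegral.integral_const_mul]
    rw [mul_comm b r]
    field_simp
  have hpi := Real.pi_pos
  constructor
  · have := (h3.congr_fun h5 measurableSet_Ioi).const_mul (1 / (2 * Real.pi))
    refine this.congr (ae_of_all _ fun r => ?_)
    simp only
    field_simp
  · rw [h2, setIntegral_congr_fun measurableSet_Ioi h5, integral_const_mul] at h4
    field_simp at h4 ⊢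
    linarith

theorem profile_gaussianKernel (r : ℝ) : profile gaussianKernel r = Real.exp (-r ^ 2) / Real.pi := by
  have h : ‖(!₂[r, 0] : Plane)‖ ^ 2 = r ^ 2 := by
    rw [EuclideanSpace.norm_sq_eq, Fin.sum_univ_two]; simp
  rw [profile, gaussianKernel, h]

theorem hankel_gaussianKernel (s : ℝ) :
    hankel gaussianKernel s = Real.exp (-s ^ 2 / 4) / (2 * Real.pi) := by
  have h := (integral_gaussian_mul_besselJ0 one_pos s).2
  have h2 : ∀ r, r * profile gaussianKernel r * besselJ0 (r * s) =
      1 / Real.pi * (r * Real.exp (-1 * r ^ 2) * besselJ0 (r * s)) := fun r => by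
    rw [profile_gaussianKernel]; ring_nf
  rw [hankel]
  simp only [h2]
  rw [integral_const_mul, h]
  field_simp

theorem enstrophyIntegrand_gaussianKernel (L s : ℝ) :
    enstrophyIntegrand gaussianKernel L s =
      s * Real.exp (-(1 / 2) * s ^ 2) * besselJ0 (s * L) := by
  rw [enstrophyIntegrand, hankel_gaussianKernel, sq_abs]
  have : 2 * Real.pi * (Real.exp (-s ^ 2 / 4) / (2 * Real.pi)) = Real.exp (-s ^ 2 / 4) := by
    field_simp
  rw [this, ← Real.exp_nat_mul]
  congr 3
  push_cast; ring

theorem integrableOn_enstrophyIntegrand (L : ℝ) :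
    IntegrableOn (enstrophyIntegrand gaussianKernel L) (Ioi 0) := by
  simpa only [← enstrophyIntegrand_gaussianKernel] using
    (integral_gaussian_mul_besselJ0 (a := 1 / 2) (by norm_num) L).1

theorem enstrophyIntegral_gaussianKernel (L : ℝ) :
    enstrophyIntegral gaussianKernel L = Real.exp (-L ^ 2 / 2) := by
  rw [enstrophyIntegral]
  simp only [enstrophyIntegrand_gaussianKernel]
  rw [(integral_gaussian_mul_besselJ0 (a := 1 / 2) (by norm_num) L).2]
  norm_num

theorem funZ_gaussianKernel {r : ℝ} (hr : 0 ≤ r) :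
    funZ gaussianKernel r = Real.exp (-r / 2) := by
  rw [funZ, enstrophyIntegral_gaussianKernel, Real.sq_sqrt hr]

/-! ### The logarithmic potential -/

theorem integrable_gaussian_plane {a : ℝ} (ha : 0 < a) :
    Integrable (fun x : Plane => Real.exp (-a * ‖x‖ ^ 2)) := by
  simpa using (integrable_gaussian_mul_cos ha 0).1

theorem integral_gaussian_plane {a : ℝ} (ha : 0 < a) :
    ∫ x : Plane, Real.exp (-a * ‖x‖ ^ 2) = Real.pi / a := by
  simpa using (integrable_gaussian_mul_cos ha 0).2

theorem norm_pow_mul_exp_le (n : ℕ) : ∃ C : ℝ, 0 < C ∧ ∀ t : ℝ, 0 ≤ t →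
    t ^ n * Real.exp (-t ^ 2) ≤ C * Real.exp (-(1 / 2) * t ^ 2) := by
  -- The constant combines t^n ≤ n! e^t with t ≤ (1 + t²)/2.
  refine ⟨n.factorial * Real.exp (1 / 2), by positivity, fun t ht => ?_⟩
  have h1 : t ^ n ≤ n.factorial * Real.exp t := by
    have := Real.pow_div_factorial_le_exp t ht n
    rwa [div_le_iff₀' (by positivity)] at this
  have h2 : Real.exp t * Real.exp (-t ^ 2) ≤ Real.exp (1 / 2) * Real.exp (-(1 / 2) * t ^ 2) := by
    rw [← Real.exp_add, ← Real.exp_add]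
    apply Real.exp_le_exp.2
    nlinarith [sq_nonneg (t - 1)]
  calc t ^ n * Real.exp (-t ^ 2) ≤ n.factorial * Real.exp t * Real.exp (-t ^ 2) :=
        mul_le_mul_of_nonneg_right h1 (Real.exp_pos _).le
    _ = n.factorial * (Real.exp t * Real.exp (-t ^ 2)) := by ring
    _ ≤ n.factorial * (Real.exp (1 / 2) * Real.exp (-(1 / 2) * t ^ 2)) :=
        mul_le_mul_of_nonneg_left h2 (by positivity)
    _ = _ := by ring

theorem integrable_norm_pow_mul_gaussian (n : ℕ) :
    Integrable (fun x : Plane => ‖x‖ ^ n * Real.exp (-‖x‖ ^ 2)) := by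
  obtain ⟨C, hC, h⟩ := norm_pow_mul_exp_le n
  refine Integrable.mono' ((integrable_gaussian_plane (a := 1 / 2) (by norm_num)).const_mul C)
    (by fun_prop) (ae_of_all _ fun x => ?_)
  rw [Real.norm_of_nonneg (by positivity)]
  exact h _ (norm_nonneg _)

theorem integrable_log_norm_ball :
    Integrable (fun x : Plane => (Ioo (0 : ℝ) 1).indicator Real.log ‖x‖) := by
  rw [integrable_fun_norm_addHaar]
  have h1 : IntegrableOn (fun y : ℝ => y ^ 1 * Real.log y) (Ioo 0 1) :=
    (((Continuous.integrableOn_Icc (a := 0) (b := 1) (by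
      simpa using Real.continuous_mul_log))).mono_set Ioo_subset_Icc_self)
  have h2 : IntegrableOn (fun y : ℝ => y ^ (Module.finrank ℝ Plane - 1) •
      (Ioo (0 : ℝ) 1).indicator Real.log y) univ := by
    rw [integrableOn_univ]
    refine ((integrable_indicator_iff measurableSet_Ioo).2 h1).congr (ae_of_all _ fun y => ?_)
    by_cases hy : y ∈ Ioo (0 : ℝ) 1 <;> simp [hy]
  exact h2.mono_set (subset_univ _)

/-- Within distance 1 of x the Gaussian is bounded and the logarithm is locally integrable. Farther
away, 0 ≤ log ‖x - y‖ ≤ ‖x‖ + ‖y‖, and the Gaussian absorbs the growth. -/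
theorem integrable_log_mul_gaussian (x : Plane) :
    Integrable (fun y : Plane => Real.log ‖x - y‖ * gaussianKernel y) := by
  have h1 : Integrable (fun y : Plane => |(Ioo (0 : ℝ) 1).indicator Real.log ‖x - y‖|) := by
    have := integrable_log_norm_ball.abs.comp_sub_left x
    simpa using this
  have h2 : Integrable (fun y : Plane => ‖x‖ * Real.exp (-1 * ‖y‖ ^ 2)) :=
    (integrable_gaussian_plane one_pos).const_mul _
  have h3 := integrable_norm_pow_mul_gaussian 1
  refine Integrable.mono' ((h1.add h2).add h3) ?_ (ae_of_all _ fun y => ?_)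
  · have : Measurable (fun y : Plane => Real.log ‖x - y‖) :=
      Real.measurable_log.comp (by fun_prop)
    refine (this.mul ?_).aestronglyMeasurable
    unfold gaussianKernel
    fun_prop
  · simp only [Pi.add_apply]
    have hpi : 1 ≤ Real.pi := by linarith [Real.pi_gt_three]
    have hg0 : 0 ≤ gaussianKernel y := by unfold gaussianKernel; positivity
    have hg1 : gaussianKernel y ≤ Real.exp (-‖y‖ ^ 2) := div_le_self (Real.exp_pos _).le hpi
    have he : Real.exp (-‖y‖ ^ 2) ≤ 1 := Real.exp_le_one_iff.2 (by nlinarith [sq_nonneg ‖y‖])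
    rw [norm_mul, Real.norm_eq_abs, Real.norm_of_nonneg hg0]
    rw [neg_one_mul, pow_one]
    have h0 : 0 ≤ ‖x - y‖ := norm_nonneg _
    have hp : 0 < Real.exp (-‖y‖ ^ 2) := Real.exp_pos _
    rcases h0.eq_or_lt with h | h
    · rw [← h]
      simp only [Real.log_zero, abs_zero, zero_mul]
      positivity
    rcases lt_or_ge ‖x - y‖ 1 with h' | h'
    · rw [indicator_of_mem (show ‖x - y‖ ∈ Ioo (0 : ℝ) 1 from ⟨h, h'⟩)]
      have : |Real.log ‖x - y‖| * gaussianKernel y ≤ |Real.log ‖x - y‖| * 1 :=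
        mul_le_mul_of_nonneg_left (hg1.trans he) (abs_nonneg _)
      have h4 : 0 ≤ ‖x‖ * Real.exp (-‖y‖ ^ 2) := by positivity
      have h5 : 0 ≤ ‖y‖ * Real.exp (-‖y‖ ^ 2) := by positivity
      linarith
    · have h4 : |Real.log ‖x - y‖| ≤ ‖x‖ + ‖y‖ := by
        rw [abs_of_nonneg (Real.log_nonneg h')]
        exact (Real.log_le_self h0).trans (norm_sub_le _ _)
      have h5 : |Real.log ‖x - y‖| * gaussianKernel y ≤ (‖x‖ + ‖y‖) * Real.exp (-‖y‖ ^ 2) :=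
        mul_le_mul h4 hg1 hg0 (by positivity)
      have h6 := abs_nonneg ((Ioo (0 : ℝ) 1).indicator Real.log ‖x - y‖)
      linarith

/-- Mean value property of the logarithm: outside the circle it is harmonic, inside the average is
constant. The formula is transferred from circle averages in ℂ. -/
theorem integral_log_norm_circle {r ρ : ℝ} (hr : 0 ≤ r) (hρ : 0 < ρ) :
    ∫ θ in (-Real.pi)..Real.pi,
      Real.log ‖(!₂[r, 0] : Plane) - !₂[ρ * Real.cos θ, ρ * Real.sin θ]‖ =
      2 * Real.pi * Real.log (max r ρ) := by
  have h1 := circleAverage_log_norm_sub_const_eq_log_radius_add_posLog (a := (r : ℂ)) (c := 0)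
    hρ.ne'
  rw [Real.circleAverage_eq_integral_add (-Real.pi),
    intervalIntegral.integral_comp_add_right
      (fun θ => (fun z : ℂ => Real.log ‖z - r‖) (circleMap 0 ρ θ))] at h1
  have h2 : ∀ θ : ℝ, ‖circleMap 0 ρ θ - r‖ =
      ‖(!₂[r, 0] : Plane) - !₂[ρ * Real.cos θ, ρ * Real.sin θ]‖ := by
    intro θ
    rw [norm_sub_rev, EuclideanSpace.norm_eq, Fin.sum_univ_two, Complex.norm_def, Complex.normSq_apply]
    congr 1
    simp [circleMap, Complex.exp_re, Complex.exp_im, ← sq]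
    rw [← abs_mul, sq_abs]
  simp only [h2] at h1
  have h3 : Real.log ρ + Real.posLog (ρ⁻¹ * ‖(0 : ℂ) - r‖) = Real.log (max r ρ) := by
    rw [zero_sub, norm_neg, Complex.norm_real, Real.norm_of_nonneg hr]
    rcases le_total r ρ with h | h
    · rw [max_eq_right h, (Real.posLog_eq_zero_iff _).2, add_zero]
      rw [abs_of_nonneg (by positivity), inv_mul_le_iff₀ hρ]
      linarith
    · rw [max_eq_left h, Real.posLog_eq_log, Real.log_mul (by positivity) (by linarith),
        Real.log_inv]
      · ring
      · rw [abs_of_nonneg (by positivity), le_inv_mul_iff₀ hρ]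
        linarith
  rw [h3] at h1
  rw [show (0 : ℝ) + -Real.pi = -Real.pi by ring,
    show 2 * Real.pi + -Real.pi = Real.pi by ring] at h1
  rw [← h1, smul_eq_mul]
  field_simp

theorem integral_two_mul_comp_sq (f : ℝ → ℝ) :
    ∫ t in Ioi (0 : ℝ), 2 * t * f (t ^ 2) = ∫ u in Ioi (0 : ℝ), f u := by
  rw [← integral_comp_rpow_Ioi_of_pos (g := f) (p := 2) (by norm_num)]
  refine setIntegral_congr_fun measurableSet_Ioi fun t ht => ?_
  norm_num

/-- Averaging over circles replaces the kernel by log max(r, ρ). The substitution u = ρ² gives ½ ∫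
e^{-u} log max(r², u) du, which is split at u = r². -/
theorem profile_potential {r : ℝ} (hr : 0 ≤ r) :
    profile (potential gaussianKernel) r = -(1 / (2 * Real.pi)) * logPotential (r ^ 2) := by
  rw [profile, potential, (integral_polar (integrable_log_mul_gaussian _)).2]
  congr 1
  have h1 : ∀ ρ ∈ Ioi (0 : ℝ), ∫ θ in (-Real.pi)..Real.pi,
      ρ * (Real.log ‖(!₂[r, 0] : Plane) - !₂[ρ * Real.cos θ, ρ * Real.sin θ]‖ *
        gaussianKernel !₂[ρ * Real.cos θ, ρ * Real.sin θ]) =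
      2 * ρ * (1 / 2 * (Real.exp (-ρ ^ 2) * Real.log (max (r ^ 2) (ρ ^ 2)))) := by
    intro ρ hρ
    have hρ : 0 < ρ := hρ
    simp only [gaussianKernel, norm_polar hρ.le]
    rw [intervalIntegral.integral_const_mul, intervalIntegral.integral_mul_const,
      integral_log_norm_circle hr hρ]
    have h2 : max (r ^ 2) (ρ ^ 2) = (max r ρ) ^ 2 := by
      rcases le_total r ρ with h | h
      · rw [max_eq_right h, max_eq_right (pow_le_pow_left₀ hr h 2)]
      · rw [max_eq_left h, max_eq_left (pow_le_pow_left₀ hρ.le h 2)]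
    rw [h2, Real.log_pow]
    push_cast
    field_simp
  rw [setIntegral_congr_fun measurableSet_Ioi h1,
    integral_two_mul_comp_sq (fun u => 1 / 2 * (Real.exp (-u) * Real.log (max (r ^ 2) u))),
    integral_const_mul, logPotential]
  congr 1
  have hr2 : 0 ≤ r ^ 2 := sq_nonneg r
  have he : IntegrableOn (fun u : ℝ => Real.exp (-u)) (Ioi 0) := integrableOn_exp_neg_Ioi 0
  have e1 : EqOn (fun u : ℝ => Real.exp (-u) * Real.log (max (r ^ 2) u))
      (fun u => Real.exp (-u) * Real.log (r ^ 2)) (Ioc 0 (r ^ 2)) := fun u hu => by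
    simp only [max_eq_left hu.2]
  have e2 : EqOn (fun u : ℝ => Real.exp (-u) * Real.log (max (r ^ 2) u))
      (fun u => Real.exp (-u) * Real.log u) (Ioi (r ^ 2)) := fun u hu => by
    simp only [max_eq_right (le_of_lt (show r ^ 2 < u from hu))]
  rw [← Ioc_union_Ioi_eq_Ioi hr2, setIntegral_union (Set.Ioc_disjoint_Ioi le_rfl) measurableSet_Ioi,
    setIntegral_congr_fun measurableSet_Ioc e1, setIntegral_congr_fun measurableSet_Ioi e2,
    integral_mul_const]
  · congr 2
    rw [← intervalIntegral.integral_of_le hr2]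
    rw [intervalIntegral.integral_comp_neg (fun u => Real.exp u), integral_exp]
    simp
  · refine IntegrableOn.congr_fun ?_ e1.symm measurableSet_Ioc
    exact (he.mono_set Ioc_subset_Ioi_self).mul_const _
  · refine IntegrableOn.congr_fun ?_ e2.symm measurableSet_Ioi
    exact integrableOn_exp_neg_mul_log.mono_set (Ioi_subset_Ioi hr2)

theorem funHP_gaussianKernel {x : ℝ} (hx : 0 ≤ x) : funHP gaussianKernel x = logPotential x := by
  rw [funHP, funHG, profile_potential (Real.sqrt_nonneg x), Real.sq_sqrt hx]
  field_simp
  ring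

/-- The value is 1 - e^{-r²}, the Lamb–Oseen profile. The factored form displays the cancellation of
the singular factor 1/r² in the velocity. -/
theorem funPK_gaussianKernel {r : ℝ} (hr : 0 < r) :
    funPK gaussianKernel r = r ^ 2 * expQuotient (r ^ 2) := by
  have h1 : HasDerivAt (fun r : ℝ => logPotential (r ^ 2))
      (expQuotient (r ^ 2) / 2 * (2 * r)) r := by
    have h2 : HasDerivAt (fun r : ℝ => r ^ 2) (2 * r) r := by
      simpa using hasDerivAt_pow 2 r
    have h3 := hasDerivAt_logPotential (show 0 < r ^ 2 by positivity)
    exact HasDerivAt.comp (h₂ := logPotential) (h := fun r : ℝ => r ^ 2) r h3 h2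
  have h2 : HasDerivAt (profile (potential gaussianKernel))
      (-(1 / (2 * Real.pi)) * (expQuotient (r ^ 2) / 2 * (2 * r))) r := by
    refine (h1.const_mul (-(1 / (2 * Real.pi)))).congr_of_eventuallyEq ?_
    filter_upwards [Ioi_mem_nhds hr] with ρ hρ
    exact profile_potential (le_of_lt hρ)
  rw [funPK, h2.deriv]
  field_simp

/-! ### The Gaussian smoothing function -/

theorem gaussianKernel_pos (x : Plane) : 0 < gaussianKernel x :=
  div_pos (Real.exp_pos _) Real.pi_pos

theorem gaussianKernel_le (x : Plane) : gaussianKernel x ≤ Real.exp (-‖x‖ ^ 2) :=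
  div_le_self (Real.exp_pos _).le (by linarith [Real.pi_gt_three])

theorem contDiff_gaussianKernel : ContDiff ℝ 1 gaussianKernel := by
  unfold gaussianKernel
  exact ((contDiff_norm_sq ℝ).neg.exp).div_const _

theorem gradient_gaussianKernel :
    gradient gaussianKernel = fun x => -(2 * gaussianKernel x) • x := by
  refine gradient_eq fun x => ?_
  rw [hasGradientAt_iff_hasFDerivAt]
  have h := ((hasStrictFDerivAt_norm_sq x).hasFDerivAt.neg.exp).mul_const (Real.pi⁻¹)
  convert! h using 1
  ext y
  simp only [gaussianKernel, InnerProductSpace.toDual_apply_apply, inner_smul_left]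
  simp
  ring

theorem smoothingHypotheses_gaussianKernel : SmoothingHypotheses gaussianKernel := by
  have hcont : Continuous gaussianKernel := contDiff_gaussianKernel.continuous
  have hpos := gaussianKernel_pos
  have hgc : Continuous (gradient gaussianKernel) := by
    rw [gradient_gaussianKernel]; fun_prop
  have hgn : ∀ x, ‖gradient gaussianKernel x‖ ≤ 2 * (‖x‖ ^ 1 * Real.exp (-‖x‖ ^ 2)) := fun x => by
    rw [gradient_gaussianKernel, norm_smul, norm_neg, Real.norm_of_nonneg (by linarith [hpos x])]
    have := mul_le_mul_of_nonneg_right (gaussianKernel_le x) (norm_nonneg x)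
    linarith
  have hchi : Measurable (fun x : Plane => chi 1 x) := by unfold chi; fun_prop
  have hchin : ∀ x : Plane, ‖chi 1 x‖ = ‖x‖ := fun x => by simp [chi]
  have hint : Integrable gaussianKernel := by
    exact ((integrable_gaussian_plane one_pos).mul_const (Real.pi⁻¹)).congr
      (ae_of_all _ fun x => by simp [gaussianKernel, div_eq_mul_inv])
  have hcg : ∀ x, ‖chi 1 x • gradient gaussianKernel x‖ ≤ 2 * (‖x‖ ^ 2 * Real.exp (-‖x‖ ^ 2)) :=
    fun x => by
    rw [norm_smul, hchin]
    have := mul_le_mul_of_nonneg_left (hgn x) (norm_nonneg x)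
    linarith
  have hbd : ∀ n : ℕ, ∃ C : ℝ, 0 < C ∧ ∀ x : Plane, ‖x‖ ^ n * Real.exp (-‖x‖ ^ 2) ≤ C := fun n => by
    obtain ⟨C, hC, h⟩ := norm_pow_mul_exp_le n
    refine ⟨C, hC, fun x => (h _ (norm_nonneg x)).trans ?_⟩
    have : Real.exp (-(1 / 2) * ‖x‖ ^ 2) ≤ 1 :=
      Real.exp_le_one_iff.2 (by nlinarith [sq_nonneg ‖x‖])
    nlinarith
  refine ⟨contDiff_gaussianKernel, hpos, fun x y h => by simp [gaussianKernel, h], hint,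
    ?_, ?_, ?_, ?_, ?_, ?_, ?_, ?_, ?_⟩
  · exact Integrable.mono' ((integrable_norm_pow_mul_gaussian 1).const_mul 2)
      hgc.aestronglyMeasurable (ae_of_all _ hgn)
  · refine Integrable.mono' (integrable_norm_pow_mul_gaussian 1) ?_ (ae_of_all _ fun x => ?_)
    · refine (Measurable.mul ?_ hcont.measurable).aestronglyMeasurable
      unfold chiPlus
      exact Measurable.ite (measurableSet_le (by fun_prop) (by fun_prop)) (by fun_prop) (by fun_prop)
    · rw [norm_mul, Real.norm_of_nonneg (hpos x).le]
      refine mul_le_mul ?_ (gaussianKernel_le x) (hpos x).le (by positivity)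
      unfold chiPlus
      split_ifs <;> simp
  · refine memLp_top_of_bound (C := 1) ?_ (ae_of_all _ fun x => ?_)
    · refine (Measurable.mul ?_ hcont.measurable).aestronglyMeasurable
      unfold chiLogMinus
      exact Measurable.ite (measurableSet_le (by fun_prop) (by fun_prop))
        ((measurable_const.sub (Real.measurable_log.comp measurable_norm)).inv) (by fun_prop)
    · rw [norm_mul, Real.norm_of_nonneg (hpos x).le]
      have h1 : gaussianKernel x ≤ 1 := (gaussianKernel_le x).trans
        (Real.exp_le_one_iff.2 (by nlinarith [sq_nonneg ‖x‖]))
      have h2 : ‖chiLogMinus x‖ ≤ 1 := by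
        unfold chiLogMinus
        split_ifs with h
        · have := Real.log_nonpos (norm_nonneg x) h
          rw [norm_inv, Real.norm_of_nonneg (by linarith)]
          exact inv_le_one_of_one_le₀ (by linarith)
        · simp
      nlinarith [hpos x, norm_nonneg (chiLogMinus x)]
  · obtain ⟨C, hC, h⟩ := hbd 2
    exact memLp_top_of_bound (C := 2 * C) (hchi.aestronglyMeasurable.smul hgc.aestronglyMeasurable)
      (ae_of_all _ fun x => (hcg x).trans (by linarith [h x]))
  · exact Integrable.mono' ((integrable_norm_pow_mul_gaussian 2).const_mul 2)
      (hchi.aestronglyMeasurable.smul hgc.aestronglyMeasurable) (ae_of_all _ hcg)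
  · obtain ⟨C, hC, h⟩ := hbd 4
    -- With η = 1 the weight is the integer power ‖x‖⁴, covered by the polynomial bounds.
    refine ⟨1, one_pos, memLp_top_of_bound (C := C) ?_ (ae_of_all _ fun x => ?_)⟩
    · refine (Measurable.mul ?_ hcont.measurable).aestronglyMeasurable
      unfold chi
      fun_prop
    · have : chi (3 + 1) x = ‖x‖ ^ 4 := by
        rw [chi, show (3 + 1 : ℝ) = ((4 : ℕ) : ℝ) by norm_num, Real.rpow_natCast]
      rw [this, norm_mul, Real.norm_of_nonneg (hpos x).le, Real.norm_of_nonneg (by positivity)]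
      exact (mul_le_mul_of_nonneg_left (gaussianKernel_le x) (by positivity)).trans (h x)
  · have h := integral_gaussian_plane one_pos
    simp only [gaussianKernel, integral_div]
    simp only [neg_one_mul, div_one] at h
    rw [h]
    exact div_self Real.pi_ne_zero
  · have h := (integral_gaussian_mul_besselJ0 one_pos 0).2
    have h0 : besselJ0 0 = 1 := by
      simp [besselJ0]
      field_simp
      norm_num
    have h1 : ∀ r, r * profile gaussianKernel r =
        Real.pi⁻¹ * (r * Real.exp (-1 * r ^ 2) * besselJ0 (r * 0)) := fun r => by
      rw [profile_gaussianKernel, mul_zero, h0]; ring_nf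
    simp only [h1]
    rw [integral_const_mul, h]
    simp
    field_simp
  · intro r hr
    have h1 : HasDerivAt (fun r : ℝ => Real.exp (-r ^ 2) / Real.pi)
        (Real.exp (-r ^ 2) * -(2 * r) / Real.pi) r := by
      have h2 : HasDerivAt (fun r : ℝ => r ^ 2) (2 * r) r := by simpa using hasDerivAt_pow 2 r
      exact (h2.neg.exp).div_const _
    rw [show profile gaussianKernel = fun r => Real.exp (-r ^ 2) / Real.pi from
      funext profile_gaussianKernel, h1.deriv]
    refine div_neg_of_neg_of_pos ?_ Real.pi_pos
    nlinarith [Real.exp_pos (-r ^ 2), mul_pos (Real.exp_pos (-r ^ 2)) hr]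

/-- Complete the square about the midpoint: |x - y|² + |y|² = |x|²/2 + 2|y - x/2|². -/
theorem convolution_gaussianKernel (x : Plane) :
    ∫ y, gaussianKernel (x - y) * gaussianKernel y = Real.exp (-‖x‖ ^ 2 / 2) / (2 * Real.pi) := by
  have h1 : ∀ y : Plane, gaussianKernel (x - y) * gaussianKernel y =
      Real.exp (-‖x‖ ^ 2 / 2) / Real.pi ^ 2 *
        (fun z : Plane => Real.exp (-2 * ‖z‖ ^ 2)) (y - (1 / 2 : ℝ) • x) := by
    intro y
    have h2 : -‖x - y‖ ^ 2 + -‖y‖ ^ 2 =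
        -‖x‖ ^ 2 / 2 + -2 * ‖y - (1 / 2 : ℝ) • x‖ ^ 2 := by
      rw [norm_sub_sq_real, norm_sub_sq_real, norm_smul, inner_smul_right, real_inner_comm]
      norm_num
      ring
    simp only [gaussianKernel]
    rw [div_mul_div_comm, ← Real.exp_add, h2, Real.exp_add]
    ring
  simp only [h1]
  rw [integral_const_mul, integral_sub_right_eq_self (fun z : Plane => Real.exp (-2 * ‖z‖ ^ 2)),
    integral_gaussian_plane two_pos]
  field_simp

/-! ### The functions `Z` and `H_P` -/

theorem hasDerivAt_exp_neg_half (r : ℝ) :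
    HasDerivAt (fun r : ℝ => Real.exp (-r / 2)) (-(Real.exp (-r / 2) / 2)) r := by
  convert! ((hasDerivAt_id r).neg.div_const 2).exp using 1
  simp
  ring

theorem strictAntiOn_funZ : StrictAntiOn (funZ gaussianKernel) (Ici 0) := by
  intro x hx y hy hxy
  rw [funZ_gaussianKernel hx, funZ_gaussianKernel hy]
  exact Real.exp_lt_exp.2 (by linarith)

theorem strictConvexOn_funZ : StrictConvexOn ℝ (Ici 0) (funZ gaussianKernel) := by
  refine ⟨convex_Ici 0, fun x hx y hy hxy a b ha hb hab => ?_⟩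
  have hx' : (0 : ℝ) ≤ x := hx
  have hy' : (0 : ℝ) ≤ y := hy
  rw [funZ_gaussianKernel hx, funZ_gaussianKernel hy,
    funZ_gaussianKernel (by simp only [smul_eq_mul]; positivity)]
  have := strictConvexOn_exp.2 (mem_univ (-x / 2)) (mem_univ (-y / 2))
    (fun h => hxy (by linarith)) ha hb hab
  simp only [smul_eq_mul] at this ⊢
  convert this using 2
  ring

theorem deriv_funZ {r : ℝ} (hr : 0 < r) :
    deriv (funZ gaussianKernel) r = -(Real.exp (-r / 2) / 2) := by
  refine ((hasDerivAt_exp_neg_half r).congr_of_eventuallyEq ?_).deriv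
  filter_upwards [Ioi_mem_nhds hr] with x hx
  exact funZ_gaussianKernel (le_of_lt hx)

theorem deriv_deriv_funZ {r : ℝ} (hr : 0 < r) :
    deriv (deriv (funZ gaussianKernel)) r = Real.exp (-r / 2) / 4 := by
  have h : HasDerivAt (fun r : ℝ => -(Real.exp (-r / 2) / 2)) (-(-(Real.exp (-r / 2) / 2) / 2)) r :=
    ((hasDerivAt_exp_neg_half r).div_const 2).neg
  have h2 : HasDerivAt (deriv (funZ gaussianKernel)) _ r := h.congr_of_eventuallyEq (by
    filter_upwards [Ioi_mem_nhds hr] with x hx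
    exact deriv_funZ hx)
  rw [h2.deriv]
  ring

theorem hasDerivAt_funHP {r : ℝ} (hr : 0 < r) :
    HasDerivAt (funHP gaussianKernel) (expQuotient r / 2) r := by
  refine (hasDerivAt_logPotential hr).congr_of_eventuallyEq ?_
  filter_upwards [Ioi_mem_nhds hr] with x hx
  exact funHP_gaussianKernel (le_of_lt hx)

theorem hasDerivAt_expQuotient {r : ℝ} (hr : 0 < r) :
    HasDerivAt expQuotient ((r * Real.exp (-r) - (1 - Real.exp (-r))) / r ^ 2) r := by
  refine (hasDerivAt_one_sub_exp_div hr.ne').congr_of_eventuallyEq ?_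
  filter_upwards [isOpen_ne.mem_nhds hr.ne'] with u hu
  exact expQuotient_of_ne hu

theorem deriv_deriv_funHP {r : ℝ} (hr : 0 < r) :
    deriv (deriv (funHP gaussianKernel)) r =
      ((r * Real.exp (-r) - (1 - Real.exp (-r))) / r ^ 2) / 2 := by
  have h2 : HasDerivAt (deriv (funHP gaussianKernel)) _ r :=
    ((hasDerivAt_expQuotient hr).div_const 2).congr_of_eventuallyEq (by
    filter_upwards [Ioi_mem_nhds hr] with x hx
    exact (hasDerivAt_funHP hx).deriv)
  exact h2.deriv

theorem contDiffOn_funZ : ContDiffOn ℝ 2 (funZ gaussianKernel) (Ioi 0) := by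
  have : ContDiff ℝ 2 (fun r : ℝ => Real.exp (-r / 2)) := by fun_prop
  exact this.contDiffOn.congr fun x hx => funZ_gaussianKernel (le_of_lt hx)

theorem contDiffOn_funHP : ContDiffOn ℝ 2 (funHP gaussianKernel) (Ioi 0) := by
  rw [show (2 : WithTop ℕ∞) = 1 + 1 by norm_num, contDiffOn_succ_iff_deriv_of_isOpen isOpen_Ioi]
  refine ⟨fun x hx => (hasDerivAt_funHP hx).differentiableAt.differentiableWithinAt, by simp, ?_⟩
  exact (contDiff_expQuotient.div_const 2).contDiffOn.congr fun x hx => (hasDerivAt_funHP hx).deriv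

theorem wronskian_funZ_funHP {r : ℝ} (hr : 0 < r) :
    0 < deriv (deriv (funZ gaussianKernel)) r * deriv (funHP gaussianKernel) r
      - deriv (funZ gaussianKernel) r * deriv (deriv (funHP gaussianKernel)) r := by
  rw [deriv_deriv_funZ hr, deriv_funZ hr, (hasDerivAt_funHP hr).deriv, deriv_deriv_funHP hr]
  have := wronskian_pos hr
  linarith

/-! ### Positivity of the enstrophy density -/

/-- The quotient is -Z'/H_P', and its derivative has the sign of minus the Wronskian. This is
convexity of Z with respect to H_P. -/
theorem antitoneOn_exp_div_expQuotient :
    AntitoneOn (fun u : ℝ => Real.exp (-u / 2) / expQuotient u) (Ici 0) := by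
  have hd : ∀ u : ℝ, 0 < u → HasDerivAt (fun u : ℝ => Real.exp (-u / 2) / expQuotient u)
      ((-(Real.exp (-u / 2) / 2) * expQuotient u - Real.exp (-u / 2) *
        ((u * Real.exp (-u) - (1 - Real.exp (-u))) / u ^ 2)) / expQuotient u ^ 2) u := fun u hu =>
    (hasDerivAt_exp_neg_half u).div (hasDerivAt_expQuotient hu) (expQuotient_pos hu.le).ne'
  refine antitoneOn_of_deriv_nonpos (convex_Ici 0) ?_ ?_ ?_
  · exact ContinuousOn.div (by fun_prop) continuous_expQuotient.continuousOn
      fun u hu => (expQuotient_pos hu).ne'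
  · intro u hu
    rw [interior_Ici] at hu
    exact (hd u hu).differentiableAt.differentiableWithinAt
  · intro u hu
    rw [interior_Ici] at hu
    rw [(hd u hu).deriv]
    refine div_nonpos_of_nonpos_of_nonneg ?_ (sq_nonneg _)
    have := wronskian_pos hu
    linarith

/-- `Z` lies above its tangents when regarded as a function of the logarithmic interaction. -/
theorem exp_tangent_le {u w : ℝ} (hu : 0 ≤ u) (hw : 0 ≤ w) :
    0 ≤ Real.exp (-u / 2) - Real.exp (-w / 2) +
      Real.exp (-w / 2) / expQuotient w * (logPotential u - logPotential w) := by
  set k := Real.exp (-w / 2) / expQuotient w with hk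
  set φ : ℝ → ℝ := fun u => Real.exp (-u / 2) - Real.exp (-w / 2) +
      k * (logPotential u - logPotential w) with hφ
  have hd : ∀ u : ℝ, 0 < u → HasDerivAt φ
      (-(Real.exp (-u / 2) / 2) + k * (expQuotient u / 2)) u := fun u hu =>
    ((hasDerivAt_exp_neg_half u).sub_const _).add
      (((hasDerivAt_logPotential hu).sub_const _).const_mul k)
  have hc : ContinuousOn φ (Ici 0) := by
    have := continuousOn_logPotential
    fun_prop
  -- In this form the derivative of φ is seen to be nonpositive before w and nonnegative after it,
  -- so φ attains its minimum 0 at w.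
  have hsign : ∀ u : ℝ, 0 < u → -(Real.exp (-u / 2) / 2) + k * (expQuotient u / 2) =
      expQuotient u / 2 * (k - Real.exp (-u / 2) / expQuotient u) := fun u hu => by
    have := (expQuotient_pos hu.le).ne'
    field_simp
    ring
  have hw0 : φ w = 0 := by simp [hφ]
  change 0 ≤ φ u
  rw [← hw0]
  rcases le_total w u with h | h
  · have hm : MonotoneOn φ (Ici w) := by
      refine monotoneOn_of_deriv_nonneg (convex_Ici w) (hc.mono (Ici_subset_Ici.2 hw)) ?_ ?_
      · intro v hv
        rw [interior_Ici] at hv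
        exact (hd v (lt_of_le_of_lt hw hv)).differentiableAt.differentiableWithinAt
      · intro v hv
        rw [interior_Ici] at hv
        have hv : w < v := hv
        have hv0 := lt_of_le_of_lt hw hv
        rw [(hd v hv0).deriv, hsign v hv0]
        have h1 := expQuotient_pos hv0.le
        have h2 := antitoneOn_exp_div_expQuotient (show w ∈ Ici 0 from hw)
          (show v ∈ Ici 0 from hv0.le) hv.le
        exact mul_nonneg (by linarith) (sub_nonneg.2 h2)
    exact hm self_mem_Ici h h
  · have hm : AntitoneOn φ (Icc 0 w) := by
      refine antitoneOn_of_deriv_nonpos (convex_Icc 0 w) (hc.mono Icc_subset_Ici_self) ?_ ?_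
      · intro v hv
        rw [interior_Icc] at hv
        exact (hd v hv.1).differentiableAt.differentiableWithinAt
      · intro v hv
        rw [interior_Icc] at hv
        rw [(hd v hv.1).deriv, hsign v hv.1]
        have h1 := expQuotient_pos hv.1.le
        have h2 := antitoneOn_exp_div_expQuotient (show v ∈ Ici 0 from hv.1.le)
          (show w ∈ Ici 0 from hw) hv.2.le
        exact mul_nonpos_of_nonneg_of_nonpos (by linarith) (sub_nonpos.2 h2)
    exact hm ⟨hu, h⟩ ⟨hw, le_rfl⟩ h

/-- Jensen's inequality at the mean w of x and y with respect to `logPotential`. In the weighted sum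
of the two tangent inequalities at w the linear terms cancel; the strict sign comes from w < z. -/
theorem enstrophy_density_pos {p q x y z : ℝ} (hp : 0 < p) (hq : 0 < q) (hpq : p + q = 1)
    (hx : 0 ≤ x) (hy : 0 ≤ y) (hz : 0 ≤ z)
    (he : p * logPotential x + q * logPotential y - logPotential z < 0) :
    0 < p * Real.exp (-x / 2) + q * Real.exp (-y / 2) - Real.exp (-z / 2) := by
  have hsub : uIcc x y ⊆ Ici 0 := fun u hu => (le_min hx hy).trans hu.1
  obtain ⟨w, hw, hwe⟩ : p * logPotential x + q * logPotential y ∈ logPotential '' uIcc x y := by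
    refine intermediate_value_uIcc (continuousOn_logPotential.mono hsub) ?_
    exact convex_uIcc (logPotential x) (logPotential y) left_mem_uIcc right_mem_uIcc hp.le hq.le hpq
  have hw0 : 0 ≤ w := hsub hw
  have hwz : w < z := (strictMonoOn_logPotential.lt_iff_lt hw0 hz).1 (by linarith)
  have hZ : Real.exp (-z / 2) < Real.exp (-w / 2) := Real.exp_lt_exp.2 (by linarith)
  have h1 := mul_le_mul_of_nonneg_left (exp_tangent_le hx hw0) hp.le
  have h2 := mul_le_mul_of_nonneg_left (exp_tangent_le hy hw0) hq.le
  set k := Real.exp (-w / 2) / expQuotient w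
  have h3 : p * (Real.exp (-x / 2) - Real.exp (-w / 2) + k * (logPotential x - logPotential w)) +
      q * (Real.exp (-y / 2) - Real.exp (-w / 2) + k * (logPotential y - logPotential w)) =
      p * Real.exp (-x / 2) + q * Real.exp (-y / 2) - (p + q) * Real.exp (-w / 2) +
      k * ((p * logPotential x + q * logPotential y) - (p + q) * logPotential w) := by ring
  rw [hpq, one_mul, one_mul, ← hwe, sub_self, mul_zero, add_zero] at h3
  linarith

/-! ### The reduced system for the squared distances and the area -/

/-- The rate of change of the oriented area (times two) of a vortex triangle. -/
def areaRate (a b c x y z : ℝ) : ℝ :=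
  1 / (2 * Real.pi) * ((a + b + c) * (expQuotient y - expQuotient x) * ((z - x - y) / 2) +
    a * (expQuotient x * ((z - x - y) / 2) + expQuotient y * y +
      expQuotient z * ((x - y - z) / 2)) -
    b * (expQuotient x * x + expQuotient y * ((z - x - y) / 2) +
      expQuotient z * ((y - x - z) / 2)))

/-- The squared distances `x`, `y`, `z` and twice the oriented area `A` of three regularized
vortices with circulations `a`, `b`, `c`. -/
structure VortexTriangle (a b c p q M e : ℝ) (x y z A : ℝ → ℝ) : Prop where
  hx : ∀ t, HasDerivAt x (a / Real.pi * A t * (expQuotient (y t) - expQuotient (z t))) t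
  hy : ∀ t, HasDerivAt y (b / Real.pi * A t * (expQuotient (z t) - expQuotient (x t))) t
  hz : ∀ t, HasDerivAt z (c / Real.pi * A t * (expQuotient (x t) - expQuotient (y t))) t
  hA : ∀ t, HasDerivAt A (areaRate a b c (x t) (y t) (z t)) t
  x_nonneg : ∀ t, 0 ≤ x t
  y_nonneg : ∀ t, 0 ≤ y t
  z_nonneg : ∀ t, 0 ≤ z t
  heron : ∀ t, 4 * A t ^ 2 = 4 * x t * y t - (z t - x t - y t) ^ 2
  moment : ∀ t, p * x t + q * y t - z t = M
  energy : ∀ t, p * logPotential (x t) + q * logPotential (y t) - logPotential (z t) = e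
  hp : 0 < p
  hq : 0 < q
  hpq : p + q = 1
  hc : c < 0
  hap : a * p = -c
  hbq : b * q = -c
  he : e < 0

namespace VortexTriangle

variable {a b c p q M e : ℝ} {x y z A : ℝ → ℝ}

theorem ha (h : VortexTriangle a b c p q M e x y z A) : 0 < a := by
  have := h.hap; have := h.hc; have := h.hp
  by_contra h'
  nlinarith

theorem hb (h : VortexTriangle a b c p q M e x y z A) : 0 < b := by
  have := h.hbq; have := h.hc; have := h.hq
  by_contra h'
  nlinarith

/-- Exchanging the two positive vortices reverses the orientation, hence the sign of A. It allows
the case x ≤ y to stand for both orderings. -/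
theorem swap (h : VortexTriangle a b c p q M e x y z A) :
    VortexTriangle b a c q p M e y x z (fun t => -A t) where
  hx t := by convert! h.hy t using 1; ring
  hy t := by convert! h.hx t using 1; ring
  hz t := by convert! h.hz t using 1; ring
  hA t := by convert! (h.hA t).neg using 1; unfold areaRate; ring
  x_nonneg := h.y_nonneg
  y_nonneg := h.x_nonneg
  z_nonneg := h.z_nonneg
  heron t := by linarith [h.heron t]
  moment t := by linarith [h.moment t]
  energy t := by linarith [h.energy t]
  hp := h.hq
  hq := h.hp
  hpq := by linarith [h.hpq]
  hc := h.hc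
  hap := h.hbq
  hbq := h.hap
  he := h.he

theorem _root_.HasDerivAt.comp_reflect {f : ℝ → ℝ} {f' s t : ℝ} (h : HasDerivAt f f' (s - t)) :
    HasDerivAt (fun t => f (s - t)) (-f') t := by
  have h2 : HasDerivAt (fun t : ℝ => s - t) (-1) t := (hasDerivAt_id t).const_sub s
  have h3 := HasDerivAt.comp (h₂ := f) (h := fun t => s - t) t h h2
  rw [mul_neg_one] at h3
  exact h3

/-- Time reversal composed with a reflection of the plane: distances are kept and the oriented area
changes sign. -/
theorem reflect (h : VortexTriangle a b c p q M e x y z A) (s : ℝ) :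
    VortexTriangle a b c p q M e (fun t => x (s - t)) (fun t => y (s - t)) (fun t => z (s - t))
      (fun t => -A (s - t)) where
  hx t := by convert! (h.hx (s - t)).comp_reflect using 1; ring
  hy t := by convert! (h.hy (s - t)).comp_reflect using 1; ring
  hz t := by convert! (h.hz (s - t)).comp_reflect using 1; ring
  hA t := by convert! (h.hA (s - t)).comp_reflect.neg using 1; ring
  x_nonneg t := h.x_nonneg _
  y_nonneg t := h.y_nonneg _
  z_nonneg t := h.z_nonneg _
  heron t := by linarith [h.heron (s - t)]
  moment t := h.moment _
  energy t := h.energy _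
  hp := h.hp
  hq := h.hq
  hpq := h.hpq
  hc := h.hc
  hap := h.hap
  hbq := h.hbq
  he := h.he

end VortexTriangle

/-! ### Uniqueness and reversibility of the reduced system. -/

/-- On a bounded time interval both curves stay in a common ball, on which a C¹ field is Lipschitz.
So no global Lipschitz bound is needed. -/
theorem eq_of_hasDerivAt_of_contDiff {E : Type*} [NormedAddCommGroup E] [NormedSpace ℝ E]
    [FiniteDimensional ℝ E] {v : E → E} (hv : ContDiff ℝ 1 v) {f g : ℝ → E}
    (hf : ∀ t, HasDerivAt f (v (f t)) t) (hg : ∀ t, HasDerivAt g (v (g t)) t) {t₀ : ℝ}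
    (h0 : f t₀ = g t₀) : f = g := by
  funext t
  obtain ⟨α, β, ht, ht₀⟩ : ∃ α β, t ∈ Ioo α β ∧ t₀ ∈ Ioo α β :=
    ⟨min t t₀ - 1, max t t₀ + 1, by grind, by grind⟩
  have hfc : Continuous f := continuous_iff_continuousAt.2 fun t => (hf t).continuousAt
  have hgc : Continuous g := continuous_iff_continuousAt.2 fun t => (hg t).continuousAt
  have hK : IsCompact (f '' Icc α β ∪ g '' Icc α β) :=
    (isCompact_Icc.image hfc).union (isCompact_Icc.image hgc)
  obtain ⟨R, hR⟩ := hK.isBounded.subset_closedBall 0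
  obtain ⟨C, hC⟩ := (hv.contDiffOn (s := Metric.closedBall (0 : E) R)).exists_lipschitzOnWith
    one_ne_zero (convex_closedBall 0 R) (isCompact_closedBall 0 R)
  exact ODE_solution_unique_of_mem_Ioo (v := fun _ => v) (s := fun _ => Metric.closedBall (0 : E) R)
    (fun _ _ => hC) ht₀
    (fun s hs => ⟨hf s, hR (Or.inl (mem_image_of_mem f (Ioo_subset_Icc_self hs)))⟩)
    (fun s hs => ⟨hg s, hR (Or.inr (mem_image_of_mem g (Ioo_subset_Icc_self hs)))⟩) h0 ht

namespace VortexTriangle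

variable {a b c p q M e : ℝ} {x y z A : ℝ → ℝ}

theorem eq_of_eq_at {x' y' z' A' : ℝ → ℝ} (h : VortexTriangle a b c p q M e x y z A)
    (h' : VortexTriangle a b c p q M e x' y' z' A') {t₀ : ℝ} (hx0 : x t₀ = x' t₀)
    (hy0 : y t₀ = y' t₀) (hz0 : z t₀ = z' t₀) (hA0 : A t₀ = A' t₀) (t : ℝ) :
    x t = x' t ∧ y t = y' t ∧ z t = z' t ∧ A t = A' t := by
  let v : ℝ × ℝ × ℝ × ℝ → ℝ × ℝ × ℝ × ℝ := fun u =>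
    (a / Real.pi * u.2.2.2 * (expQuotient u.2.1 - expQuotient u.2.2.1),
      b / Real.pi * u.2.2.2 * (expQuotient u.2.2.1 - expQuotient u.1),
      c / Real.pi * u.2.2.2 * (expQuotient u.1 - expQuotient u.2.1),
      areaRate a b c u.1 u.2.1 u.2.2.1)
  have hv : ContDiff ℝ 1 v := by
    have hg := contDiff_expQuotient
    have h1 : ContDiff ℝ 1 (fun u : ℝ × ℝ × ℝ × ℝ => expQuotient u.1) := hg.comp (by fun_prop)
    have h2 : ContDiff ℝ 1 (fun u : ℝ × ℝ × ℝ × ℝ => expQuotient u.2.1) := hg.comp (by fun_prop)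
    have h3 : ContDiff ℝ 1 (fun u : ℝ × ℝ × ℝ × ℝ => expQuotient u.2.2.1) :=
      hg.comp (by fun_prop)
    unfold v areaRate
    fun_prop
  have key := eq_of_hasDerivAt_of_contDiff hv (f := fun t => (x t, y t, z t, A t))
    (g := fun t => (x' t, y' t, z' t, A' t))
    (fun t => (h.hx t).prodMk ((h.hy t).prodMk ((h.hz t).prodMk (h.hA t))))
    (fun t => (h'.hx t).prodMk ((h'.hy t).prodMk ((h'.hz t).prodMk (h'.hA t))))
    (t₀ := t₀) (by simp [hx0, hy0, hz0, hA0])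
  simpa using congrFun key t

/-- At a collinear instant the time-reversed solution has the same data, because A = -A there. -/
theorem symm_of_area_eq_zero (h : VortexTriangle a b c p q M e x y z A) {s : ℝ} (hs : A s = 0)
    (t : ℝ) : x (2 * s - t) = x t ∧ y (2 * s - t) = y t ∧ z (2 * s - t) = z t := by
  have hs2 : 2 * s - s = s := by ring
  obtain ⟨h1, h2, h3, -⟩ := (h.reflect (2 * s)).eq_of_eq_at h (t₀ := s) (by rw [hs2]) (by rw [hs2])
    (by rw [hs2]) (by rw [hs2, hs, neg_zero]) t
  exact ⟨h1, h2, h3⟩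

/-- If the triangle degenerates twice, then the distances are periodic. -/
theorem periodic_of_two_zeros (h : VortexTriangle a b c p q M e x y z A) {s s' : ℝ} (hs : A s = 0)
    (hs' : A s' = 0) (t : ℝ) : x (t + 2 * (s' - s)) = x t ∧ y (t + 2 * (s' - s)) = y t ∧
      z (t + 2 * (s' - s)) = z t := by
  -- The composition of the time reflections about s and s' is the translation by 2(s' - s).
  obtain ⟨h1, h2, h3⟩ := h.symm_of_area_eq_zero hs t
  obtain ⟨h4, h5, h6⟩ := h.symm_of_area_eq_zero hs' (2 * s - t)
  have : 2 * s' - (2 * s - t) = t + 2 * (s' - s) := by ring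
  rw [this] at h4 h5 h6
  exact ⟨h4.trans h1, h5.trans h2, h6.trans h3⟩

end VortexTriangle

/-! ### Long time behaviour of the reduced system -/

theorem pos_or_neg_of_ne_zero {A : ℝ → ℝ} (hA : Continuous A) {T : ℝ} (h0 : ∀ t, T ≤ t → A t ≠ 0) :
    (∀ t, T ≤ t → 0 < A t) ∨ ∀ t, T ≤ t → A t < 0 := by
  by_contra hcon
  push Not at hcon
  obtain ⟨⟨s, hs, hs'⟩, t, ht, ht'⟩ := hcon
  obtain ⟨r, hr, hr0⟩ := (isPreconnected_Ici (a := T)).intermediate_value (show s ∈ Ici T from hs)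
    (show t ∈ Ici T from ht) hA.continuousOn ⟨hs', ht'⟩
  exact h0 r hr hr0

/-- A function whose zeros are all upward crossings cannot become negative again once it is
nonnegative. -/
theorem eventually_nonneg_or_nonpos {u u' : ℝ → ℝ} {T : ℝ} (hu : ∀ t, HasDerivAt u (u' t) t)
    (h0 : ∀ t, T ≤ t → u t = 0 → 0 < u' t) :
    (∀ᶠ t in atTop, 0 ≤ u t) ∨ ∀ᶠ t in atTop, u t ≤ 0 := by
  by_cases h : ∃ s, T ≤ s ∧ 0 ≤ u s
  · obtain ⟨s, hs, hus⟩ := h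
    left
    filter_upwards [eventually_ge_atTop s] with t ht
    have := image_le_of_deriv_right_lt_deriv_boundary (f := fun t => -u t) (f' := fun t => -u' t)
      (B := fun _ => 0) (B' := fun _ => 0) (a := s) (b := t)
      (fun r _ => (hu r).neg.continuousAt.continuousWithinAt)
      (fun r _ => (hu r).neg.hasDerivWithinAt) (by linarith)
      (fun r => hasDerivAt_const r (0 : ℝ))
      (fun r hr hr0 => by
        have := h0 r (hs.trans hr.1) (by linarith)
        linarith) ⟨ht, le_rfl⟩
    linarith
  · right
    push Not at h
    filter_upwards [eventually_ge_atTop T] with t ht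
    exact (h t ht).le

theorem eventually_signed {u u' A : ℝ → ℝ} {T : ℝ} (hA : Continuous A)
    (hA0 : ∀ t, T ≤ t → A t ≠ 0) (hu : ∀ t, HasDerivAt u (u' t) t)
    (h0 : ∀ t, T ≤ t → u t = 0 → 0 < u' t * A t) :
    (∀ᶠ t in atTop, 0 ≤ u t) ∨ ∀ᶠ t in atTop, u t ≤ 0 := by
  rcases pos_or_neg_of_ne_zero hA hA0 with h | h
  · exact eventually_nonneg_or_nonpos hu fun t ht hut =>
      pos_of_mul_pos_left (h0 t ht hut) (h t ht).le
  · have := eventually_nonneg_or_nonpos (T := T) (u := fun t => -u t) (fun t => (hu t).neg) fun t ht hut => by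
      have h1 := h0 t ht (by linarith)
      have h2 := h t ht
      nlinarith
    rcases this with h1 | h1
    · right; filter_upwards [h1] with t ht using by linarith
    · left; filter_upwards [h1] with t ht using by linarith

theorem tendsto_or_tendsto_atTop {f f' : ℝ → ℝ} (hf : ∀ t, HasDerivAt f (f' t) t)
    (h0 : ∀ t, 0 ≤ f t)
    (hs : (∀ᶠ t in atTop, 0 ≤ f' t) ∨ ∀ᶠ t in atTop, f' t ≤ 0) :
    (∃ l, Tendsto f atTop (𝓝 l)) ∨ Tendsto f atTop atTop := by
  have hshift : ∀ T : ℝ, (fun t => f (max t T)) =ᶠ[atTop] f := fun T => by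
    filter_upwards [eventually_ge_atTop T] with t ht
    rw [max_eq_left ht]
  have hcont : Continuous f := continuous_iff_continuousAt.2 fun t => (hf t).continuousAt
  rcases hs with hs | hs <;> obtain ⟨T, hT⟩ := eventually_atTop.1 hs
  · have hm : MonotoneOn f (Ici T) := monotoneOn_of_deriv_nonneg (convex_Ici T) hcont.continuousOn
      (fun t _ => (hf t).differentiableAt.differentiableWithinAt) fun t ht => by
        rw [(hf t).deriv]; exact hT t (interior_subset ht)
    have hm' : Monotone (fun t => f (max t T)) := fun s t hst =>
      hm (show T ≤ max s T from le_max_right _ _) (show T ≤ max t T from le_max_right _ _) (max_le_max_right T hst)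
    rcases tendsto_atTop_of_monotone hm' with h | ⟨l, hl⟩
    · exact Or.inr (h.congr' (hshift T))
    · exact Or.inl ⟨l, hl.congr' (hshift T)⟩
  · have hm : AntitoneOn f (Ici T) := antitoneOn_of_deriv_nonpos (convex_Ici T) hcont.continuousOn
      (fun t _ => (hf t).differentiableAt.differentiableWithinAt) fun t ht => by
        rw [(hf t).deriv]; exact hT t (interior_subset ht)
    have hm' : Antitone (fun t => f (max t T)) := fun s t hst =>
      hm (show T ≤ max s T from le_max_right _ _) (show T ≤ max t T from le_max_right _ _) (max_le_max_right T hst)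
    rcases tendsto_atTop_of_antitone hm' with h | ⟨l, hl⟩
    · obtain ⟨t, ht⟩ := (h.eventually (eventually_lt_atBot 0)).exists
      exact absurd (h0 _) (not_le.2 ht)
    · exact Or.inl ⟨l, hl.congr' (hshift T)⟩

/-- The mean value theorem on [t, t + 1] gives points tending to infinity at which the derivative
tends to 0. -/
theorem eq_zero_of_tendsto_of_tendsto_deriv {f f' : ℝ → ℝ} (hf : ∀ t, HasDerivAt f (f' t) t)
    {l m : ℝ} (hl : Tendsto f atTop (𝓝 l)) (hm : Tendsto f' atTop (𝓝 m)) : m = 0 := by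
  have h1 : ∀ t : ℝ, ∃ s ∈ Ioo t (t + 1), f' s = (f (t + 1) - f t) / (t + 1 - t) := fun t =>
    exists_hasDerivAt_eq_slope f f' (by linarith)
      (fun s _ => (hf s).continuousAt.continuousWithinAt) (fun s _ => hf s)
  choose σ hσ hσ' using h1
  have h2 : Tendsto σ atTop atTop := tendsto_atTop_mono (fun t => (hσ t).1.le) tendsto_id
  have h3 : Tendsto (fun t => (f (t + 1) - f t) / (t + 1 - t)) atTop (𝓝 (l - l)) := by
    have := (hl.comp (tendsto_atTop_add_const_right atTop (1 : ℝ) tendsto_id)).sub hl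
    refine this.congr fun t => ?_
    simp
  have h4 := (hm.comp h2).congr hσ'
  simpa using tendsto_nhds_unique h4 h3

/-! ### Eventual ordering of the sides and their limits. -/

namespace VortexTriangle

variable {a b c p q M e : ℝ} {x y z A : ℝ → ℝ}

theorem continuous_A (h : VortexTriangle a b c p q M e x y z A) : Continuous A :=
  continuous_iff_continuousAt.2 fun t => (h.hA t).continuousAt

theorem expQuotient_lt {u v : ℝ} (hu : 0 ≤ u) (huv : u < v) : expQuotient v < expQuotient u :=
  strictAntiOn_expQuotient (show u ∈ Ici 0 from hu) (show v ∈ Ici 0 from hu.trans huv.le) huv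

theorem expQuotient_le {u v : ℝ} (hu : 0 ≤ u) (huv : u ≤ v) : expQuotient v ≤ expQuotient u :=
  strictAntiOn_expQuotient.antitoneOn (show u ∈ Ici 0 from hu) (show v ∈ Ici 0 from hu.trans huv) huv

/-- When x = z, the negative energy forces y < x. The rate of x - z then has the sign of A, so it
can vanish in one direction of crossing only. -/
theorem signed_x_sub_z (h : VortexTriangle a b c p q M e x y z A) {T : ℝ}
    (hA0 : ∀ t, T ≤ t → A t ≠ 0) :
    (∀ᶠ t in atTop, 0 ≤ x t - z t) ∨ ∀ᶠ t in atTop, x t - z t ≤ 0 := by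
  refine eventually_signed h.continuous_A hA0 (fun t => (h.hx t).sub (h.hz t)) fun t ht hu => ?_
  have hxz : z t = x t := by linarith
  have hen := h.energy t
  have := h.he
  have := h.hp
  have hq := h.hq
  have hpq := h.hpq
  rw [hxz] at hen ⊢
  have hL : q * logPotential (y t) < q * logPotential (x t) := by
    have : p * logPotential (x t) + q * logPotential (x t) = logPotential (x t) := by
      rw [← add_mul, hpq, one_mul]
    linarith
  have hyx : y t < x t := (strictMonoOn_logPotential.lt_iff_lt (h.y_nonneg t) (h.x_nonneg t)).1
    (lt_of_mul_lt_mul_left hL hq.le)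
  have hg := expQuotient_lt (h.y_nonneg t) hyx
  -- The rates of x and z combine with factor a + c, which is positive in this form.
  have hac : a + c = a * q := by linear_combination (-a) * hpq + h.hap
  have hapos := h.ha
  have hA2 : 0 < A t ^ 2 := by have := hA0 t ht; positivity
  have : (a / Real.pi * A t * (expQuotient (y t) - expQuotient (x t)) -
      c / Real.pi * A t * (expQuotient (x t) - expQuotient (y t))) * A t =
      A t ^ 2 / Real.pi * (a * q) * (expQuotient (y t) - expQuotient (x t)) := by
    rw [← hac]; ring
  rw [this]
  have hpi := Real.pi_pos
  have := sub_pos.2 hg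
  positivity

theorem signed_y_sub_z (h : VortexTriangle a b c p q M e x y z A) {T : ℝ}
    (hA0 : ∀ t, T ≤ t → A t ≠ 0) :
    (∀ᶠ t in atTop, 0 ≤ y t - z t) ∨ ∀ᶠ t in atTop, y t - z t ≤ 0 :=
  h.swap.signed_x_sub_z fun t ht => neg_ne_zero.2 (hA0 t ht)

/-- When x = y, the negative energy forces x < z, and the rate of x - y has the sign of A. -/
theorem signed_x_sub_y (h : VortexTriangle a b c p q M e x y z A) {T : ℝ}
    (hA0 : ∀ t, T ≤ t → A t ≠ 0) :
    (∀ᶠ t in atTop, 0 ≤ x t - y t) ∨ ∀ᶠ t in atTop, x t - y t ≤ 0 := by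
  refine eventually_signed h.continuous_A hA0 (fun t => (h.hx t).sub (h.hy t)) fun t ht hu => ?_
  have hxy : y t = x t := by linarith
  have hen := h.energy t
  have := h.he
  have hpq := h.hpq
  rw [hxy] at hen ⊢
  have hL : logPotential (x t) < logPotential (z t) := by
    have : p * logPotential (x t) + q * logPotential (x t) = logPotential (x t) := by
      rw [← add_mul, hpq, one_mul]
    linarith
  have hxz : x t < z t := (strictMonoOn_logPotential.lt_iff_lt (h.x_nonneg t) (h.z_nonneg t)).1 hL
  have hg := expQuotient_lt (h.x_nonneg t) hxz
  have hapos := h.ha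
  have hbpos := h.hb
  have hA2 : 0 < A t ^ 2 := by have := hA0 t ht; positivity
  have : (a / Real.pi * A t * (expQuotient (x t) - expQuotient (z t)) -
      b / Real.pi * A t * (expQuotient (z t) - expQuotient (x t))) * A t =
      A t ^ 2 / Real.pi * (a + b) * (expQuotient (x t) - expQuotient (z t)) := by
    ring
  rw [this]
  have hpi := Real.pi_pos
  have := sub_pos.2 hg
  positivity

theorem eventually_signed_rate {k : ℝ} {u v : ℝ → ℝ} {T : ℝ}
    (hA : Continuous A) (hA0 : ∀ t, T ≤ t → A t ≠ 0) (hu : ∀ t, 0 ≤ u t) (hv : ∀ t, 0 ≤ v t)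
    (huv : (∀ᶠ t in atTop, 0 ≤ u t - v t) ∨ ∀ᶠ t in atTop, u t - v t ≤ 0) :
    (∀ᶠ t in atTop, 0 ≤ k * A t * (expQuotient (u t) - expQuotient (v t))) ∨
      ∀ᶠ t in atTop, k * A t * (expQuotient (u t) - expQuotient (v t)) ≤ 0 := by
  have h1 : (∀ᶠ t in atTop, 0 ≤ k * A t) ∨ ∀ᶠ t in atTop, k * A t ≤ 0 := by
    rcases pos_or_neg_of_ne_zero hA hA0 with h | h <;> rcases le_total 0 k with hk | hk
    · left; filter_upwards [eventually_ge_atTop T] with t ht using mul_nonneg hk (h t ht).le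
    · right; filter_upwards [eventually_ge_atTop T] with t ht
      using mul_nonpos_of_nonpos_of_nonneg hk (h t ht).le
    · right; filter_upwards [eventually_ge_atTop T] with t ht
      using mul_nonpos_of_nonneg_of_nonpos hk (h t ht).le
    · left; filter_upwards [eventually_ge_atTop T] with t ht
      using mul_nonneg_of_nonpos_of_nonpos hk (h t ht).le
  have h2 : (∀ᶠ t in atTop, 0 ≤ expQuotient (u t) - expQuotient (v t)) ∨
      ∀ᶠ t in atTop, expQuotient (u t) - expQuotient (v t) ≤ 0 := by
    rcases huv with h | h
    · right; filter_upwards [h] with t ht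
      using sub_nonpos.2 (expQuotient_le (hv t) (by linarith))
    · left; filter_upwards [h] with t ht
      using sub_nonneg.2 (expQuotient_le (hu t) (by linarith))
  rcases h1 with h1 | h1 <;> rcases h2 with h2 | h2
  · left; filter_upwards [h1, h2] with t ht ht' using mul_nonneg ht ht'
  · right; filter_upwards [h1, h2] with t ht ht' using mul_nonpos_of_nonneg_of_nonpos ht ht'
  · right; filter_upwards [h1, h2] with t ht ht' using mul_nonpos_of_nonpos_of_nonneg ht ht'
  · left; filter_upwards [h1, h2] with t ht ht' using mul_nonneg_of_nonpos_of_nonpos ht ht'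

theorem x_limit (h : VortexTriangle a b c p q M e x y z A) {T : ℝ}
    (hA0 : ∀ t, T ≤ t → A t ≠ 0) :
    (∃ l, Tendsto x atTop (𝓝 l)) ∨ Tendsto x atTop atTop :=
  tendsto_or_tendsto_atTop h.hx h.x_nonneg
    (eventually_signed_rate h.continuous_A hA0 h.y_nonneg h.z_nonneg (h.signed_y_sub_z hA0))

theorem y_limit (h : VortexTriangle a b c p q M e x y z A) {T : ℝ}
    (hA0 : ∀ t, T ≤ t → A t ≠ 0) :
    (∃ l, Tendsto y atTop (𝓝 l)) ∨ Tendsto y atTop atTop :=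
  h.swap.x_limit fun t ht => neg_ne_zero.2 (hA0 t ht)

/-- Heron's formula controls only A²; the fixed sign of A recovers its own limit. -/
theorem tendsto_A {T l : ℝ} (hA : Continuous A) (hA0 : ∀ t, T ≤ t → A t ≠ 0)
    (hl : Tendsto (fun t => A t ^ 2) atTop (𝓝 l)) :
    ∃ k, Tendsto A atTop (𝓝 k) ∧ k ^ 2 = l := by
  have h1 : Tendsto (fun t => |A t|) atTop (𝓝 (Real.sqrt l)) :=
    ((Real.continuous_sqrt.tendsto l).comp hl).congr fun t => Real.sqrt_sq_eq_abs _
  have h2 : ∃ k, Tendsto A atTop (𝓝 k) := by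
    rcases pos_or_neg_of_ne_zero hA hA0 with h | h
    · refine ⟨_, h1.congr' ?_⟩
      filter_upwards [eventually_ge_atTop T] with t ht using abs_of_pos (h t ht)
    · refine ⟨_, h1.neg.congr' ?_⟩
      filter_upwards [eventually_ge_atTop T] with t ht
      rw [abs_of_neg (h t ht), neg_neg]
  obtain ⟨k, hk⟩ := h2
  exact ⟨k, hk, tendsto_nhds_unique (hk.pow 2) hl⟩

theorem continuous_areaRate (a b c : ℝ) :
    Continuous (fun u : ℝ × ℝ × ℝ => areaRate a b c u.1 u.2.1 u.2.2) := by
  have := continuous_expQuotient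
  unfold areaRate
  fun_prop

/-- If the distances converge, the limit is a collinear equilibrium of the reduced system. -/
theorem limit_equilibrium (h : VortexTriangle a b c p q M e x y z A) {T l₁ l₂ l₃ : ℝ}
    (hA0 : ∀ t, T ≤ t → A t ≠ 0) (h1 : Tendsto x atTop (𝓝 l₁)) (h2 : Tendsto y atTop (𝓝 l₂))
    (h3 : Tendsto z atTop (𝓝 l₃)) :
    0 ≤ l₁ ∧ 0 ≤ l₂ ∧ 0 ≤ l₃ ∧ 4 * l₁ * l₂ = (l₃ - l₁ - l₂) ^ 2 ∧
      areaRate a b c l₁ l₂ l₃ = 0 ∧ (l₁ ≠ 0 ∨ l₂ ≠ 0) := by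
  have n1 : 0 ≤ l₁ := ge_of_tendsto' h1 h.x_nonneg
  have n2 : 0 ≤ l₂ := ge_of_tendsto' h2 h.y_nonneg
  have n3 : 0 ≤ l₃ := ge_of_tendsto' h3 h.z_nonneg
  have g1 := (continuous_expQuotient.tendsto l₁).comp h1
  have g2 := (continuous_expQuotient.tendsto l₂).comp h2
  have g3 := (continuous_expQuotient.tendsto l₃).comp h3
  have hL : ∀ {u : ℝ → ℝ} {l : ℝ}, (∀ t, 0 ≤ u t) → 0 ≤ l → Tendsto u atTop (𝓝 l) →
      Tendsto (fun t => logPotential (u t)) atTop (𝓝 (logPotential l)) := fun hu hl hul =>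
    (continuousOn_logPotential.continuousWithinAt hl).tendsto.comp
      (tendsto_nhdsWithin_iff.2 ⟨hul, Eventually.of_forall hu⟩)
  have hen : p * logPotential l₁ + q * logPotential l₂ - logPotential l₃ = e := by
    refine tendsto_nhds_unique ((((hL h.x_nonneg n1 h1).const_mul p).add
      ((hL h.y_nonneg n2 h2).const_mul q)).sub (hL h.z_nonneg n3 h3)) ?_
    exact tendsto_const_nhds.congr fun t => (h.energy t).symm
  -- Equal sides would have energy (p + q - 1)L = 0, against e < 0.
  have hne : ¬ (l₁ = l₂ ∧ l₂ = l₃) := by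
    rintro ⟨rfl, rfl⟩
    have := h.he
    have h5 : p * logPotential l₁ + q * logPotential l₁ = logPotential l₁ := by
      rw [← add_mul, h.hpq, one_mul]
    linarith
  have hA2 : Tendsto (fun t => A t ^ 2) atTop
      (𝓝 ((4 * l₁ * l₂ - (l₃ - l₁ - l₂) ^ 2) / 4)) := by
    have := ((((h1.const_mul 4).mul h2).sub (((h3.sub h1).sub h2).pow 2)).div_const 4)
    refine this.congr fun t => ?_
    have := h.heron t
    linarith
  obtain ⟨k, hk, hk2⟩ := tendsto_A h.continuous_A hA0 hA2
  have e1 := eq_zero_of_tendsto_of_tendsto_deriv h.hx h1 ((hk.const_mul (a / Real.pi)).mul (g2.sub g3))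
  have e3 := eq_zero_of_tendsto_of_tendsto_deriv h.hz h3 ((hk.const_mul (c / Real.pi)).mul (g1.sub g2))
  have eA : areaRate a b c l₁ l₂ l₃ = 0 := by
    refine eq_zero_of_tendsto_of_tendsto_deriv h.hA hk ?_
    have h5 : Tendsto (fun t => (x t, y t, z t)) atTop (𝓝 (l₁, l₂, l₃)) :=
      h1.prodMk_nhds (h2.prodMk_nhds h3)
    have h6 := ((continuous_areaRate a b c).tendsto (l₁, l₂, l₃)).comp h5
    simpa only [Function.comp_def] using h6
  -- With nonzero limiting area, vanishing rates and injectivity of `expQuotient` would make the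
  -- limit equilateral.
  have hk0 : k = 0 := by
    by_contra hk0
    have hpi := Real.pi_ne_zero
    have ha0 := h.ha.ne'
    have hc0 := h.hc.ne
    have e1' : expQuotient l₂ = expQuotient l₃ := by
      rcases mul_eq_zero.1 e1 with h' | h'
      · exact absurd h' (by positivity)
      · linarith
    have e3' : expQuotient l₁ = expQuotient l₂ := by
      rcases mul_eq_zero.1 e3 with h' | h'
      · exact absurd h' (by positivity)
      · linarith
    exact hne ⟨strictAntiOn_expQuotient.injOn n1 n2 e3', strictAntiOn_expQuotient.injOn n2 n3 e1'⟩
  have hher : 4 * l₁ * l₂ = (l₃ - l₁ - l₂) ^ 2 := by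
    rw [hk0] at hk2; linarith
  refine ⟨n1, n2, n3, hher, eA, ?_⟩
  by_contra hcon
  push Not at hcon
  obtain ⟨rfl, rfl⟩ := hcon
  refine hne ⟨rfl, ?_⟩
  have : l₃ ^ 2 = 0 := by linarith
  exact (pow_eq_zero_iff two_ne_zero).1 this |>.symm

end VortexTriangle

/-! ### Expanding triangles -/

/-- The logarithmic interaction of an infinitely large triangle as a function of the ratio of two
squared sides. -/
def logRatio (p q k : ℝ) : ℝ := q * Real.log k - Real.log (p + q * k)

theorem continuousOn_logRatio {p q : ℝ} (hp : 0 < p) (hq : 0 < q) :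
    ContinuousOn (logRatio p q) (Ici 1) := by
  unfold logRatio
  refine ContinuousOn.sub (continuousOn_const.mul (ContinuousOn.log continuousOn_id ?_))
    (ContinuousOn.log (by fun_prop) ?_)
  · intro k hk
    have : (1 : ℝ) ≤ k := hk
    exact (show (0 : ℝ) < k by linarith).ne'
  · intro k hk
    have : (1 : ℝ) ≤ k := hk
    positivity

theorem strictAntiOn_logRatio {p q : ℝ} (hp : 0 < p) (hq : 0 < q) (hpq : p + q = 1) :
    StrictAntiOn (logRatio p q) (Ici 1) := by
  refine strictAntiOn_of_deriv_neg (convex_Ici 1) (continuousOn_logRatio hp hq) fun k hk => ?_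
  rw [interior_Ici] at hk
  have hk : 1 < k := hk
  have hk0 : 0 < k := by linarith
  have hden : 0 < p + q * k := by positivity
  have h1 : HasDerivAt (fun k : ℝ => p + q * k) q k := by
    simpa using ((hasDerivAt_id k).const_mul q).const_add p
  have h2 : HasDerivAt (logRatio p q) (q * k⁻¹ - q / (p + q * k)) k :=
    ((Real.hasDerivAt_log hk0.ne').const_mul q).sub (h1.log hden.ne')
  rw [h2.deriv]
  have h3 : q * k⁻¹ - q / (p + q * k) = q * p * (1 - k) / (k * (p + q * k)) := by
    field_simp
    linear_combination k * hpq
  rw [h3]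
  refine div_neg_of_neg_of_pos ?_ (by positivity)
  exact mul_neg_of_pos_of_neg (by positivity) (by linarith)

theorem exists_logRatio_eq {p q v : ℝ} (hp : 0 < p) (hq : 0 < q) (hpq : p + q = 1) (hv : v < 0) :
    ∃ k, 1 < k ∧ logRatio p q k = v := by
  have hlogq : Real.log q < 0 := Real.log_neg hq (by linarith)
  -- K solves p log K = -log q - v; together with log(p + qK) ≥ log(qK) this brings `logRatio` down
  -- to at most v.
  set K := Real.exp ((-Real.log q - v) / p) with hK
  have hK1 : 1 < K := by
    rw [hK, Real.one_lt_exp_iff]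
    exact div_pos (by linarith) hp
  have hKv : logRatio p q K ≤ v := by
    have h1 : Real.log (q * K) ≤ Real.log (p + q * K) :=
      Real.log_le_log (by positivity) (by linarith)
    rw [Real.log_mul hq.ne' (by positivity)] at h1
    have h2 : p * Real.log K = -Real.log q - v := by
      rw [hK, Real.log_exp]
      field_simp
    have h3 : p * Real.log K + q * Real.log K = Real.log K := by rw [← add_mul, hpq, one_mul]
    unfold logRatio
    linarith
  have h1v : logRatio p q 1 = 0 := by simp [logRatio, hpq]
  obtain ⟨k, hk, hkv⟩ := intermediate_value_Icc' hK1.le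
    ((continuousOn_logRatio hp hq).mono Icc_subset_Ici_self) ⟨hKv, by rw [h1v]; exact hv.le⟩
  refine ⟨k, lt_of_le_of_ne hk.1 ?_, hkv⟩
  rintro rfl
  rw [h1v] at hkv
  exact hv.ne' hkv

/-- A strictly monotone function has a continuous inverse, here in order form. -/
theorem tendsto_of_tendsto_logRatio {p q k : ℝ} (hp : 0 < p) (hq : 0 < q) (hpq : p + q = 1)
    (hk : 1 < k) {κ : ℝ → ℝ} (hκ : ∀ᶠ t in atTop, 1 ≤ κ t)
    (hlim : Tendsto (fun t => logRatio p q (κ t)) atTop (𝓝 (logRatio p q k))) :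
    Tendsto κ atTop (𝓝 k) := by
  have hanti := strictAntiOn_logRatio hp hq hpq
  rw [tendsto_order]
  constructor
  · intro u hu
    have h1 : max u 1 < k := max_lt hu hk
    have h2 := hanti (show max u 1 ∈ Ici 1 from le_max_right u 1) (show k ∈ Ici 1 from hk.le) h1
    filter_upwards [hκ, hlim.eventually (gt_mem_nhds h2)] with t ht ht'
    exact (le_max_left u 1).trans_lt
      ((hanti.lt_iff_gt (show κ t ∈ Ici 1 from ht) (show max u 1 ∈ Ici 1 from le_max_right u 1)).1 ht')
  · intro u hu
    have h2 := hanti (show k ∈ Ici 1 from hk.le) (show u ∈ Ici 1 from hk.le.trans hu.le) hu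
    filter_upwards [hκ, hlim.eventually (lt_mem_nhds h2)] with t ht ht'
    exact (hanti.lt_iff_gt (show u ∈ Ici 1 from hk.le.trans hu.le) (show κ t ∈ Ici 1 from ht)).1 ht'

namespace VortexTriangle

variable {a b c p q M e : ℝ} {x y z A : ℝ → ℝ}

theorem z_eq (h : VortexTriangle a b c p q M e x y z A) (t : ℝ) : z t = p * x t + q * y t - M := by
  linarith [h.moment t]

theorem tendsto_z (h : VortexTriangle a b c p q M e x y z A) (hy : Tendsto y atTop atTop) :
    Tendsto z atTop atTop := by
  refine tendsto_atTop_mono (fun t => ?_)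
    (tendsto_atTop_add_const_right atTop (-M) (hy.const_mul_atTop h.hq))
  have := mul_nonneg h.hp.le (h.x_nonneg t)
  rw [h.z_eq]
  linarith

/-- Since z ≥ (q/2) y eventually, L(z) - qL(y) grows at least like (p/2) log y. Conservation of
energy then forces pL(x) to infinity. -/
theorem tendsto_x (h : VortexTriangle a b c p q M e x y z A) (hy : Tendsto y atTop atTop) :
    Tendsto x atTop atTop := by
  have hp := h.hp
  have hq := h.hq
  have hz := h.tendsto_z hy
  have hlog : Tendsto (fun t => 2 * e + Real.log (q / 2) - q + p * Real.log (y t)) atTop atTop :=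
    tendsto_atTop_add_const_left atTop _ ((Real.tendsto_log_atTop.comp hy).const_mul_atTop hp)
  have hmain : Tendsto (fun t => 2 * p * logPotential (x t)) atTop atTop := by
    refine tendsto_atTop_mono' atTop ?_ hlog
    filter_upwards [hy.eventually_gt_atTop 0, hz.eventually_gt_atTop 0,
      hy.eventually_ge_atTop (2 * M / q), (tendsto_logTail.comp hy).eventually (gt_mem_nhds one_pos)]
      with t hy0 hz0 hyM hty
    have hzq : q / 2 * y t ≤ z t := by
      rw [div_le_iff₀ hq] at hyM
      have := mul_nonneg hp.le (h.x_nonneg t)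
      rw [h.z_eq]
      linarith
    have h1 := Real.log_le_log (by positivity) hzq
    rw [Real.log_mul (by positivity) (by positivity)] at h1
    have h2 := logTail_pos hz0
    have h3 : p * Real.log (y t) + q * Real.log (y t) = Real.log (y t) := by
      rw [← add_mul, h.hpq, one_mul]
    have h4 : q * logTail (y t) ≤ q := by
      have : logTail (y t) < 1 := hty
      nlinarith
    have h5 := h.energy t
    simp only [logTail] at h2 h4
    linarith
  refine tendsto_atTop.2 fun R => ?_
  filter_upwards [hmain.eventually_gt_atTop (2 * p * logPotential (max R 0))] with t ht
  have h1 : logPotential (max R 0) < logPotential (x t) := lt_of_mul_lt_mul_left ht (by positivity)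
  exact (le_max_left R 0).trans ((strictMonoOn_logPotential.lt_iff_lt
    (show max R 0 ∈ Ici 0 from le_max_right R 0) (h.x_nonneg t)).1 h1).le

/-- The energy relation in terms of the ratio of the squared sides. -/
theorem logRatio_eq (h : VortexTriangle a b c p q M e x y z A) {t : ℝ} (hx : 0 < x t)
    (hy : 0 < y t) (hz : 0 < z t) :
    logRatio p q (y t / x t) = 2 * e -
      (p * logTail (x t) + q * logTail (y t) - logTail (z t)) - Real.log ((z t + M) / z t) := by
  have hp := h.hp
  have hq := h.hq
  have h1 : z t + M = x t * (p + q * (y t / x t)) := by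
    rw [h.z_eq]; field_simp; ring
  have h2 : 0 < p + q * (y t / x t) := by positivity
  rw [h1, Real.log_div (by positivity) hz.ne', Real.log_mul hx.ne' h2.ne', logRatio,
    Real.log_div hy.ne' hx.ne']
  have h3 := h.energy t
  simp only [logTail]
  linear_combination 2 * h3 - Real.log (x t) * h.hpq

theorem heron' (h : VortexTriangle a b c p q M e x y z A) (t : ℝ) :
    4 * A t ^ 2 = 4 * x t * y t - (q * x t + p * y t + M) ^ 2 := by
  have h1 : z t - x t - y t = -(q * x t + p * y t + M) := by
    rw [h.z_eq]
    linear_combination (x t + y t) * h.hpq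
  rw [h.heron, h1]
  ring

theorem heron_ratio (h : VortexTriangle a b c p q M e x y z A) {t : ℝ} (hx : 0 < x t) :
    4 * A t ^ 2 / x t ^ 2 = 4 * (y t / x t) - (q + p * (y t / x t) + M / x t) ^ 2 := by
  rw [h.heron']
  field_simp

/-- For large sides the tails and log((z + M)/z) vanish, so the energy relation fixes `logRatio` of
the ratio in the limit. -/
theorem tendsto_ratio (h : VortexTriangle a b c p q M e x y z A) (hxy : ∀ᶠ t in atTop, x t ≤ y t)
    (hx : Tendsto x atTop atTop) (hy : Tendsto y atTop atTop) (hz : Tendsto z atTop atTop)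
    {k : ℝ} (hk : 1 < k) (hke : logRatio p q k = 2 * e) :
    Tendsto (fun t => y t / x t) atTop (𝓝 k) := by
  refine tendsto_of_tendsto_logRatio h.hp h.hq h.hpq hk ?_ ?_
  · filter_upwards [hxy, hx.eventually_gt_atTop 0] with t ht hx0
    rwa [one_le_div hx0]
  · rw [hke]
    have h1 : Tendsto (fun t => (z t + M) / z t) atTop (𝓝 1) := by
      have : Tendsto (fun t => 1 + M / z t) atTop (𝓝 (1 + 0)) :=
        tendsto_const_nhds.add (hz.const_div_atTop M)
      rw [add_zero] at this
      refine this.congr' ?_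
      filter_upwards [hz.eventually_gt_atTop 0] with t ht
      field_simp
    have h2 := (h1.log one_ne_zero)
    have h3 := (((tendsto_logTail.comp hx).const_mul p).add
      ((tendsto_logTail.comp hy).const_mul q)).sub (tendsto_logTail.comp hz)
    have h4 := (tendsto_const_nhds (x := 2 * e)).sub h3 |>.sub h2
    simp only [mul_zero, add_zero, sub_zero, Real.log_one] at h4
    refine h4.congr' ?_
    filter_upwards [hx.eventually_gt_atTop 0, hy.eventually_gt_atTop 0, hz.eventually_gt_atTop 0]
      with t h1 h2 h3
    rw [h.logRatio_eq h1 h2 h3]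
    rfl

/-- The area of an expanding triangle stays away from zero. -/
theorem eventually_one_le_area (h : VortexTriangle a b c p q M e x y z A)
    (hxy : ∀ᶠ t in atTop, x t ≤ y t)
    (hx : Tendsto x atTop atTop) (hy : Tendsto y atTop atTop) (hz : Tendsto z atTop atTop)
    {k : ℝ} (hk : 1 < k) (hke : logRatio p q k = 2 * e) :
    ∀ᶠ t in atTop, 1 ≤ 4 * A t ^ 2 := by
  have hp := h.hp
  have hq := h.hq
  have hpq := h.hpq
  have hratio := h.tendsto_ratio hxy hx hy hz hk hke
  have hlim : Tendsto (fun t => 4 * A t ^ 2 / x t ^ 2) atTop (𝓝 (4 * k - (q + p * k + 0) ^ 2)) := by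
    refine ((hratio.const_mul 4).sub (((hratio.const_mul p).const_add q |>.add
      (hx.const_div_atTop M)).pow 2)).congr' ?_
    filter_upwards [hx.eventually_gt_atTop 0] with t ht
    exact (h.heron_ratio ht).symm
  rw [add_zero] at hlim
  -- Q(κ) = 4κ - (q + pκ)² is Heron's formula for the limiting shape. If Q(k) > 0 the area grows
  -- like x²; if Q(k) = 0 the limiting shape is collinear and lower order terms decide.
  have hQ0 : 0 ≤ 4 * k - (q + p * k) ^ 2 := ge_of_tendsto' hlim fun t => by positivity
  have hanti := strictAntiOn_logRatio hp hq hpq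
  -- Exact interpolation of the concave quadratic Q between 1, where Q(1) = 3, and k; its leading
  -- coefficient -p² gives the last term.
  have hconc : ∀ κ : ℝ, (k - 1) * (4 * κ - (q + p * κ) ^ 2) = (k - κ) * 3 +
      (κ - 1) * (4 * k - (q + p * k) ^ 2) + p ^ 2 * (κ - 1) * (k - κ) * (k - 1) := fun κ => by
    have : q = 1 - p := by linarith
    rw [this]; ring
  rcases hQ0.eq_or_lt with hQ | hQ
  -- The sign of M determines from which side the ratio approaches k. For M < 0 it stays at most k,
  -- so Q ≥ 0 along the motion and the term -M(2(qx + py) + M) in 4A² tends to infinity.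
  · rcases lt_or_ge M 0 with hM | hM
    · have hlin : Tendsto (fun t => -M * (2 * (q * x t + p * y t) + M)) atTop atTop := by
        refine Tendsto.const_mul_atTop (by linarith) (tendsto_atTop_add_const_right atTop M ?_)
        exact ((hx.const_mul_atTop hq).atTop_add_atTop (hy.const_mul_atTop hp)).const_mul_atTop
          two_pos
      have hexp : Tendsto (fun t => Real.exp (-x t)) atTop (𝓝 0) :=
        Real.tendsto_exp_neg_atTop_nhds_zero.comp hx
      have hρ : 0 < p + q * k + 1 := by positivity
      have hzx : ∀ᶠ t in atTop, z t ≤ (p + q * k + 1) * x t := by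
        have h1 : Tendsto (fun t => p + q * (y t / x t) - M / x t) atTop (𝓝 (p + q * k - 0)) :=
          ((hratio.const_mul q).const_add p).sub (hx.const_div_atTop M)
        filter_upwards [h1.eventually (gt_mem_nhds (show p + q * k - 0 < p + q * k + 1 by linarith)),
          hx.eventually_gt_atTop 0] with t ht hx0
        have h2 : z t = (p + q * (y t / x t) - M / x t) * x t := by
          rw [h.z_eq]; field_simp
        rw [h2]
        exact mul_le_mul_of_nonneg_right ht.le hx0.le
      filter_upwards [hlin.eventually_ge_atTop 1, hxy, hx.eventually_gt_atTop 0,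
        hy.eventually_gt_atTop 0, hz.eventually_gt_atTop 0, hzx,
        hz.eventually_gt_atTop (-M),
        hexp.eventually (gt_mem_nhds (show 0 < -M / (p + q * k + 1) by
          exact div_pos (by linarith) hρ))] with t h1 hle hx0 hy0 hz0 hzx hzM hex
      -- The tails are exponentially small, hence below -M/z, since z is at most a multiple of x.
      have htail : p * logTail (x t) + q * logTail (y t) ≤ -M / z t := by
        have t1 : logTail (y t) ≤ logTail (x t) := strictAntiOn_logTail.antitoneOn hx0 hy0 hle
        have t2 := logTail_le hx0
        have t3 : p * logTail (x t) + q * logTail (y t) ≤ logTail (x t) := by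
          have := mul_le_mul_of_nonneg_left t1 hq.le
          have : p * logTail (x t) + q * logTail (x t) = logTail (x t) := by
            rw [← add_mul, hpq, one_mul]
          linarith
        refine t3.trans (t2.trans ?_)
        rw [div_le_div_iff₀ hx0 hz0]
        rw [lt_div_iff₀ hρ] at hex
        have := mul_le_mul_of_nonneg_left hzx (Real.exp_pos (-x t)).le
        have := mul_le_mul_of_nonneg_right hex.le hx0.le
        linarith
      have hlog : Real.log ((z t + M) / z t) ≤ M / z t := by
        have := Real.log_le_sub_one_of_pos (show 0 < (z t + M) / z t from div_pos (by linarith) hz0)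
        have h2 : (z t + M) / z t - 1 = M / z t := by field_simp; ring
        linarith
      have hκk : y t / x t ≤ k := by
        rw [← hanti.le_iff_ge (show k ∈ Ici 1 from hk.le)
          (show y t / x t ∈ Ici 1 from (one_le_div hx0).2 hle), hke, h.logRatio_eq hx0 hy0 hz0]
        have := logTail_pos hz0
        rw [neg_div] at htail
        linarith
      have hκ1 : 1 ≤ y t / x t := (one_le_div hx0).2 hle
      have hQκ : 0 ≤ 4 * (y t / x t) - (q + p * (y t / x t)) ^ 2 := by
        have h2 := hconc (y t / x t)
        rw [← hQ] at h2
        have h3 : 0 ≤ p ^ 2 * (y t / x t - 1) * (k - y t / x t) * (k - 1) := by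
          have := sub_nonneg.2 hκ1
          have := sub_nonneg.2 hκk
          have := sub_nonneg.2 hk.le
          positivity
        have h4 : 0 ≤ (k - 1) * (4 * (y t / x t) - (q + p * (y t / x t)) ^ 2) := by
          rw [h2]; linarith
        exact nonneg_of_mul_nonneg_right h4 (by linarith)
      have h5 : x t ^ 2 * (4 * (y t / x t) - (q + p * (y t / x t)) ^ 2) =
          4 * x t * y t - (q * x t + p * y t) ^ 2 := by field_simp
      have h6 := mul_nonneg (sq_nonneg (x t)) hQκ
      rw [h.heron']
      nlinarith
    -- For M ≥ 0 the tail of z is dominated by that of x, so both corrections lower `logRatio` and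
    -- push the ratio above k. There Q < 0, and Heron's formula would give A² < 0.
    · exfalso
      have hdiff : Tendsto (fun t => z t - x t) atTop atTop := by
        have h1 : Tendsto (fun t => q * ((y t / x t - 1) * x t) + -M) atTop atTop := by
          refine tendsto_atTop_add_const_right atTop _ (Tendsto.const_mul_atTop hq ?_)
          exact (hratio.sub_const 1).pos_mul_atTop (by linarith) hx
        refine h1.congr' ?_
        filter_upwards [hx.eventually_gt_atTop 0] with t hx0
        rw [h.z_eq]
        field_simp
        linear_combination (-x t) * hpq
      have hexp : Tendsto (fun t => Real.exp (-(z t - x t))) atTop (𝓝 0) :=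
        Real.tendsto_exp_neg_atTop_nhds_zero.comp hdiff
      obtain ⟨t, hle, hx0, hy0, hz0, hzx, hex⟩ := (hxy.and ((hx.eventually_gt_atTop 0).and
        ((hy.eventually_gt_atTop 0).and ((hz.eventually_gt_atTop 0).and
        ((hdiff.eventually_gt_atTop 0).and (hexp.eventually (gt_mem_nhds hp))))))).exists
      have htail : 0 < p * logTail (x t) + q * logTail (y t) - logTail (z t) := by
        have t1 := logTail_add_le hx0 hzx.le
        rw [add_sub_cancel] at t1
        have t2 := mul_lt_mul_of_pos_right hex (logTail_pos hx0)
        have t3 := mul_pos hq (logTail_pos hy0)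
        linarith
      have hlog : 0 ≤ Real.log ((z t + M) / z t) :=
        Real.log_nonneg ((one_le_div hz0).2 (by linarith))
      have hκk : k < y t / x t := by
        rw [← hanti.lt_iff_gt (show y t / x t ∈ Ici 1 from (one_le_div hx0).2 hle)
          (show k ∈ Ici 1 from hk.le), hke, h.logRatio_eq hx0 hy0 hz0]
        linarith
      have h2 := hconc (y t / x t)
      rw [← hQ] at h2
      have h3 : p ^ 2 * (y t / x t - 1) * (k - y t / x t) * (k - 1) ≤ 0 := by
        have h31 : 0 ≤ p ^ 2 * (y t / x t - 1) := mul_nonneg (sq_nonneg p) (by linarith)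
        exact mul_nonpos_of_nonpos_of_nonneg (mul_nonpos_of_nonneg_of_nonpos h31 (by linarith))
          (by linarith)
      have h4 : (k - 1) * (4 * (y t / x t) - (q + p * (y t / x t)) ^ 2) < 0 := by
        rw [h2]; linarith
      have hQκ : 4 * (y t / x t) - (q + p * (y t / x t)) ^ 2 < 0 := by
        by_contra hcon
        have := mul_nonneg (show 0 ≤ k - 1 by linarith) (not_lt.1 hcon)
        linarith
      have h5 : x t ^ 2 * (4 * (y t / x t) - (q + p * (y t / x t)) ^ 2) =
          4 * x t * y t - (q * x t + p * y t) ^ 2 := by field_simp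
      have h6 := mul_neg_of_pos_of_neg (show 0 < x t ^ 2 by positivity) hQκ
      have h7 := h.heron' t
      have h8 : 0 ≤ (q * x t + p * y t) * M := by positivity
      nlinarith [sq_nonneg (A t), sq_nonneg M]
  · have hx2 : Tendsto (fun t => (4 * k - (q + p * k) ^ 2) / 2 * x t ^ 2) atTop atTop :=
      ((tendsto_pow_atTop two_ne_zero).comp hx).const_mul_atTop (by linarith)
    filter_upwards [hlim.eventually (lt_mem_nhds (half_lt_self hQ)), hx.eventually_gt_atTop 0,
      hx2.eventually_ge_atTop 1] with t h1 hx0 h2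
    rw [lt_div_iff₀ (by positivity)] at h1
    linarith

end VortexTriangle

/-! ### Integrability of the enstrophy along expanding triangles. -/

/-- One factor e^{-f/4} is at most 4/f ≤ (4/k) f'. The remaining e^{-f/4} f' is the derivative of
-4e^{-f/4}, which has a limit. -/
theorem integrableOn_exp_of_deriv_ge {f f' : ℝ → ℝ} {k : ℝ} (hk : 0 < k)
    (hf : ∀ t, HasDerivAt f (f' t) t) (hlim : Tendsto f atTop atTop)
    (hf' : ∀ᶠ t in atTop, k / f t ≤ f' t) :
    ∃ T, IntegrableOn (fun t => Real.exp (-f t / 2)) (Ioi T) := by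
  obtain ⟨T, hT⟩ := eventually_atTop.1 (hf'.and (hlim.eventually_gt_atTop 0))
  have hcont : Continuous f := continuous_iff_continuousAt.2 fun t => (hf t).continuousAt
  have hd : ∀ t, HasDerivAt (fun t => -4 * Real.exp (-f t / 4)) (Real.exp (-f t / 4) * f' t) t := by
    intro t
    convert! (((hf t).neg.div_const 4).exp).const_mul (-4) using 1
    simp
    ring
  have hi : IntegrableOn (fun t => Real.exp (-f t / 4) * f' t) (Ioi T) := by
    refine integrableOn_Ioi_deriv_of_nonneg' (l := -4 * 0) (fun t _ => hd t) (fun t ht => ?_) ?_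
    · obtain ⟨h1, h2⟩ := hT t (le_of_lt ht)
      exact mul_nonneg (Real.exp_pos _).le ((div_pos hk h2).le.trans h1)
    · refine Tendsto.const_mul (-4) (Real.tendsto_exp_atBot.comp ?_)
      have := tendsto_neg_atTop_atBot.comp (hlim.atTop_div_const (show (0 : ℝ) < 4 by norm_num))
      refine this.congr fun t => ?_
      simp [neg_div]
  refine ⟨T, Integrable.mono' (hi.const_mul (4 / k)) (by fun_prop)
    ((ae_restrict_iff' measurableSet_Ioi).2 (ae_of_all _ fun t ht => ?_))⟩
  obtain ⟨h1, h2⟩ := hT t (le_of_lt ht)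
  rw [Real.norm_of_nonneg (Real.exp_pos _).le]
  have h3 : f t / 4 ≤ Real.exp (f t / 4) := by linarith [Real.add_one_le_exp (f t / 4)]
  have h4 : Real.exp (-f t / 4) * Real.exp (f t / 4) = 1 := by
    rw [← Real.exp_add]; ring_nf; exact Real.exp_zero
  have h5 : Real.exp (-f t / 4) * (f t / 4) ≤ 1 := by
    rw [← h4]; exact mul_le_mul_of_nonneg_left h3 (Real.exp_pos _).le
  have h6 : Real.exp (-f t / 4) ≤ 4 / f t := by
    rw [le_div_iff₀ h2]; linarith
  have h7 : Real.exp (-f t / 2) = Real.exp (-f t / 4) * Real.exp (-f t / 4) := by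
    rw [← Real.exp_add]; ring_nf
  rw [h7]
  calc Real.exp (-f t / 4) * Real.exp (-f t / 4) ≤ Real.exp (-f t / 4) * (4 / f t) :=
        mul_le_mul_of_nonneg_left h6 (Real.exp_pos _).le
    _ = 4 / k * (Real.exp (-f t / 4) * (k / f t)) := by field_simp
    _ ≤ 4 / k * (Real.exp (-f t / 4) * f' t) := by gcongr

namespace VortexTriangle

variable {a b c p q M e : ℝ} {x y z A : ℝ → ℝ}

/-- The limits of z/x and y/x differ, so g(z) - g(y) is at least a multiple of 1/x, with g =
`expQuotient`. As |A| is bounded below, so is |x'| · x. -/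
theorem integrableOn_exp_x (h : VortexTriangle a b c p q M e x y z A) {T : ℝ}
    (hA0 : ∀ t, T ≤ t → A t ≠ 0) (hxy : ∀ᶠ t in atTop, x t ≤ y t)
    (hy : Tendsto y atTop atTop) :
    ∃ T', IntegrableOn (fun t => Real.exp (-x t / 2)) (Ioi T') := by
  have hp := h.hp
  have hq := h.hq
  have ha := h.ha
  have hpi := Real.pi_pos
  have hx := h.tendsto_x hy
  have hz := h.tendsto_z hy
  obtain ⟨k, hk, hke⟩ := exists_logRatio_eq hp hq h.hpq (show 2 * e < 0 by linarith [h.he])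
  have hratio := h.tendsto_ratio hxy hx hy hz hk hke
  have hρ : 0 < p + q * k := by positivity
  have hρk : p + q * k < k := by
    have : p = 1 - q := by linarith [h.hpq]
    have hq1 : q < 1 := by linarith
    rw [this]
    nlinarith
  have hzx : Tendsto (fun t => z t / x t) atTop (𝓝 (p + q * k - 0)) := by
    refine (((hratio.const_mul q).const_add p).sub (hx.const_div_atTop M)).congr' ?_
    filter_upwards [hx.eventually_gt_atTop 0] with t hx0
    rw [h.z_eq]; field_simp
  rw [sub_zero] at hzx
  have hexp : Tendsto (fun t => Real.exp (-z t)) atTop (𝓝 0) :=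
    Real.tendsto_exp_neg_atTop_nhds_zero.comp hz
  have hlim : Tendsto (fun t => (z t / x t)⁻¹ * (1 - Real.exp (-z t)) - (y t / x t)⁻¹) atTop
      (𝓝 ((p + q * k)⁻¹ * (1 - 0) - k⁻¹)) :=
    ((hzx.inv₀ hρ.ne').mul (hexp.const_sub 1)).sub (hratio.inv₀ (by linarith))
  rw [sub_zero, mul_one] at hlim
  set δ := (p + q * k)⁻¹ - k⁻¹ with hδ
  have hδ0 : 0 < δ := sub_pos.2 (inv_strictAnti₀ hρ hρk)
  have harea := h.eventually_one_le_area hxy hx hy hz hk hke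
  have hgap : ∀ᶠ t in atTop, δ / 2 / x t ≤ expQuotient (z t) - expQuotient (y t) := by
    filter_upwards [hlim.eventually (lt_mem_nhds (half_lt_self hδ0)), hx.eventually_gt_atTop 0,
      hy.eventually_gt_atTop 0, hz.eventually_gt_atTop 0] with t h1 hx0 hy0 hz0
    rw [div_le_iff₀ hx0, expQuotient_of_ne hy0.ne', expQuotient_of_ne hz0.ne']
    have h2 : ((1 - Real.exp (-z t)) / z t - (1 - Real.exp (-y t)) / y t) * x t =
        (z t / x t)⁻¹ * (1 - Real.exp (-z t)) - (y t / x t)⁻¹ +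
          Real.exp (-y t) * (x t / y t) := by
      field_simp
      ring
    rw [h2]
    have : 0 < Real.exp (-y t) * (x t / y t) := by positivity
    linarith
  have hlarge : ∀ᶠ t in atTop, a / Real.pi * (δ / 4) / x t ≤
      a / Real.pi * |A t| * (expQuotient (z t) - expQuotient (y t)) := by
    filter_upwards [hgap, harea, hx.eventually_gt_atTop 0] with t h1 h2 hx0
    have h3 : 1 / 2 ≤ |A t| := by
      have h4 := abs_nonneg (A t)
      have h5 := sq_abs (A t)
      nlinarith
    calc a / Real.pi * (δ / 4) / x t = a / Real.pi * (1 / 2) * (δ / 2 / x t) := by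
          field_simp; ring
      _ ≤ a / Real.pi * |A t| * (expQuotient (z t) - expQuotient (y t)) := by gcongr
  rcases pos_or_neg_of_ne_zero h.continuous_A hA0 with hA | hA
  -- A positive area would make x decrease eventually, contradicting x → ∞.
  · exfalso
    obtain ⟨S, hS⟩ := eventually_atTop.1 (hlarge.and ((hx.eventually_gt_atTop 0).and
      (eventually_ge_atTop T)))
    have hanti : AntitoneOn x (Ici S) := by
      refine antitoneOn_of_deriv_nonpos (convex_Ici S)
        (fun t _ => (h.hx t).continuousAt.continuousWithinAt)
        (fun t _ => (h.hx t).differentiableAt.differentiableWithinAt) fun t ht => ?_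
      obtain ⟨h1, h2, h3⟩ := hS t (interior_subset ht)
      rw [(h.hx t).deriv]
      rw [abs_of_pos (hA t h3)] at h1
      have : 0 < a / Real.pi * (δ / 4) / x t := by positivity
      linarith
    obtain ⟨t, ht1, ht2⟩ := ((hx.eventually_gt_atTop (x S)).and (eventually_ge_atTop S)).exists
    exact absurd (hanti self_mem_Ici ht2 ht2) (not_le.2 ht1)
  · refine integrableOn_exp_of_deriv_ge (k := a / Real.pi * (δ / 4)) (by positivity) h.hx hx ?_
    filter_upwards [hlarge, eventually_ge_atTop T] with t h1 h2
    rw [abs_of_neg (hA t h2)] at h1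
    linarith

/-- The enstrophy density of a triangle, up to normalization. -/
theorem density_pos (h : VortexTriangle a b c p q M e x y z A) (t : ℝ) :
    0 < p * Real.exp (-x t / 2) + q * Real.exp (-y t / 2) - Real.exp (-z t / 2) :=
  enstrophy_density_pos h.hp h.hq h.hpq (h.x_nonneg t) (h.y_nonneg t) (h.z_nonneg t)
    (by rw [h.energy]; exact h.he)

theorem continuous_density (h : VortexTriangle a b c p q M e x y z A) :
    Continuous fun t => p * Real.exp (-x t / 2) + q * Real.exp (-y t / 2) - Real.exp (-z t / 2) := by
  have h1 : Continuous x := continuous_iff_continuousAt.2 fun t => (h.hx t).continuousAt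
  have h2 : Continuous y := continuous_iff_continuousAt.2 fun t => (h.hy t).continuousAt
  have h3 : Continuous z := continuous_iff_continuousAt.2 fun t => (h.hz t).continuousAt
  fun_prop

theorem integrableOn_density_of_le (h : VortexTriangle a b c p q M e x y z A) {T : ℝ}
    (hA0 : ∀ t, T ≤ t → A t ≠ 0) (hxy : ∀ᶠ t in atTop, x t ≤ y t)
    (hy : Tendsto y atTop atTop) :
    ∃ T', IntegrableOn (fun t => p * Real.exp (-x t / 2) + q * Real.exp (-y t / 2) -
      Real.exp (-z t / 2)) (Ioi T') := by
  obtain ⟨T', hT'⟩ := h.integrableOn_exp_x hA0 hxy hy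
  obtain ⟨S, hS⟩ := eventually_atTop.1 hxy
  refine ⟨max S T', Integrable.mono' (hT'.mono_set (Ioi_subset_Ioi (le_max_right _ _)))
    h.continuous_density.aestronglyMeasurable
    ((ae_restrict_iff' measurableSet_Ioi).2 (ae_of_all _ fun t ht => ?_))⟩
  have hle := hS t ((le_max_left _ _).trans (le_of_lt ht))
  rw [Real.norm_of_nonneg (h.density_pos t).le]
  have h1 : Real.exp (-y t / 2) ≤ Real.exp (-x t / 2) := Real.exp_le_exp.2 (by linarith)
  have h2 := mul_le_mul_of_nonneg_left h1 h.hq.le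
  have h3 : p * Real.exp (-x t / 2) + q * Real.exp (-x t / 2) = Real.exp (-x t / 2) := by
    rw [← add_mul, h.hpq, one_mul]
  have := Real.exp_pos (-z t / 2)
  linarith

theorem tendsto_of_bounded (h : VortexTriangle a b c p q M e x y z A) {T : ℝ}
    (hA0 : ∀ t, T ≤ t → A t ≠ 0) (hxy : ∀ᶠ t in atTop, x t ≤ y t) {l : ℝ}
    (hy : Tendsto y atTop (𝓝 l)) : ∃ l', Tendsto x atTop (𝓝 l') := by
  rcases h.x_limit hA0 with hx | hx
  · exact hx
  · exfalso
    obtain ⟨t, ht1, ht2, ht3⟩ := ((hx.eventually_gt_atTop (l + 1)).and (hxy.and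
      (hy.eventually (gt_mem_nhds (lt_add_one l))))).exists
    linarith

/-- A triangle which does not degenerate at late times either expands, with integrable enstrophy, or
converges to a collinear equilibrium. -/
theorem integrableOn_density_or_equilibrium (h : VortexTriangle a b c p q M e x y z A) {T : ℝ}
    (hA0 : ∀ t, T ≤ t → A t ≠ 0) :
    (∃ T', IntegrableOn (fun t => p * Real.exp (-x t / 2) + q * Real.exp (-y t / 2) -
      Real.exp (-z t / 2)) (Ioi T')) ∨
    ∃ l₁ l₂ l₃, Tendsto x atTop (𝓝 l₁) ∧ Tendsto y atTop (𝓝 l₂) ∧ Tendsto z atTop (𝓝 l₃) ∧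
      0 ≤ l₁ ∧ 0 ≤ l₂ ∧ 0 ≤ l₃ ∧ 4 * l₁ * l₂ = (l₃ - l₁ - l₂) ^ 2 ∧
      areaRate a b c l₁ l₂ l₃ = 0 ∧ (l₁ ≠ 0 ∨ l₂ ≠ 0) := by
  have hA0' : ∀ t, T ≤ t → -A t ≠ 0 := fun t ht => neg_ne_zero.2 (hA0 t ht)
  have hfin : ∀ {l₁ l₂ : ℝ}, Tendsto x atTop (𝓝 l₁) → Tendsto y atTop (𝓝 l₂) →
      ∃ l₁ l₂ l₃, Tendsto x atTop (𝓝 l₁) ∧ Tendsto y atTop (𝓝 l₂) ∧ Tendsto z atTop (𝓝 l₃) ∧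
      0 ≤ l₁ ∧ 0 ≤ l₂ ∧ 0 ≤ l₃ ∧ 4 * l₁ * l₂ = (l₃ - l₁ - l₂) ^ 2 ∧
      areaRate a b c l₁ l₂ l₃ = 0 ∧ (l₁ ≠ 0 ∨ l₂ ≠ 0) := by
    intro l₁ l₂ h1 h2
    have h3 : Tendsto z atTop (𝓝 (p * l₁ + q * l₂ - M)) :=
      (((h1.const_mul p).add (h2.const_mul q)).sub_const M).congr fun t => (h.z_eq t).symm
    exact ⟨l₁, l₂, _, h1, h2, h3, h.limit_equilibrium hA0 h1 h2 h3⟩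
  rcases h.signed_x_sub_y hA0 with hs | hs
  · have hyx : ∀ᶠ t in atTop, y t ≤ x t := by filter_upwards [hs] with t ht using by linarith
    rcases h.x_limit hA0 with ⟨l₁, h1⟩ | hx
    · obtain ⟨l₂, h2⟩ := h.swap.tendsto_of_bounded hA0' hyx h1
      exact Or.inr (hfin h1 h2)
    · left
      obtain ⟨T', hT'⟩ := h.swap.integrableOn_density_of_le hA0' hyx hx
      refine ⟨T', hT'.congr_fun (fun t _ => ?_) measurableSet_Ioi⟩
      ring
  · have hxy : ∀ᶠ t in atTop, x t ≤ y t := by filter_upwards [hs] with t ht using by linarith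
    rcases h.y_limit hA0 with ⟨l₂, h2⟩ | hy
    · obtain ⟨l₁, h1⟩ := h.tendsto_of_bounded hA0 hxy h2
      exact Or.inr (hfin h1 h2)
    · exact Or.inl (h.integrableOn_density_of_le hA0 hxy hy)

end VortexTriangle

/-! ### Three regularized vortices -/

theorem hasDerivAt_plane_iff {f : ℝ → Plane} {f' : Plane} {t : ℝ} :
    HasDerivAt f f' t ↔ HasDerivAt (fun t => f t 0) (f' 0) t ∧ HasDerivAt (fun t => f t 1) (f' 1) t := by
  have h1 : HasDerivAt f f' t ↔ HasDerivAt (fun t => (f t).ofLp) f'.ofLp t := by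
    constructor
    · intro h
      exact (PiLp.continuousLinearEquiv 2 ℝ (fun _ : Fin 2 => ℝ)).hasFDerivAt.comp_hasDerivAt t h
    · intro h
      exact (PiLp.continuousLinearEquiv 2 ℝ (fun _ : Fin 2 => ℝ)).symm.hasFDerivAt.comp_hasDerivAt t h
  rw [h1, hasDerivAt_pi, Fin.forall_fin_two]

theorem dist_sq_plane (u v : Plane) : dist u v ^ 2 = (u 0 - v 0) ^ 2 + (u 1 - v 1) ^ 2 := by
  rw [EuclideanSpace.dist_sq_eq, Fin.sum_univ_two, Real.dist_eq, Real.dist_eq, sq_abs, sq_abs]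

/-- At coincident points both sides vanish because `perp 0 = 0`, so the singular coefficient may be
replaced everywhere by a smooth one. -/
theorem kernel_smul_perp (γ : ℝ) (u v : Plane) :
    (γ / dist u v ^ 2 * funPK gaussianKernel (dist u v / 1)) • perp (v - u) =
      (γ * expQuotient (dist u v ^ 2)) • perp (v - u) := by
  rcases eq_or_ne u v with rfl | huv
  · have : perp (u - u) = 0 := by
      ext i; fin_cases i <;> simp [perp]
    rw [this, smul_zero, smul_zero]
  · have hd : 0 < dist u v := dist_pos.2 huv
    rw [div_one, funPK_gaussianKernel hd]
    congr 1
    field_simp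

theorem isSolution_one_iff {N : ℕ} {Γ : Fin N → ℝ} {X : Fin N → ℝ → Plane} :
    IsSolution gaussianKernel 1 Γ X ↔ ∀ n t,
      HasDerivAt (fun t => X n t 0) (-(1 / (2 * Real.pi)) *
        ∑ m, Γ m * expQuotient (dist (X m t) (X n t) ^ 2) * (X n t 1 - X m t 1)) t ∧
      HasDerivAt (fun t => X n t 1) (1 / (2 * Real.pi) *
        ∑ m, Γ m * expQuotient (dist (X m t) (X n t) ^ 2) * (X n t 0 - X m t 0)) t := by
  unfold IsSolution
  refine forall_congr' fun n => forall_congr' fun t => ?_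
  rw [hasDerivAt_plane_iff]
  simp only [kernel_smul_perp]
  have h0 : ∀ f : Fin N → Plane, f n = 0 → ∑ m ∈ Finset.univ.erase n, f m = ∑ m, f m :=
    fun f hf => Finset.sum_erase _ hf
  rw [h0 _ (by
    have : perp (X n t - X n t) = 0 := by
      ext i; fin_cases i <;> simp [perp]
    rw [this, smul_zero])]
  have e0 : (-(1 / (2 * Real.pi)) • ∑ m, (Γ m * expQuotient (dist (X m t) (X n t) ^ 2)) •
      perp (X n t - X m t)) 0 = -(1 / (2 * Real.pi)) *
        ∑ m, Γ m * expQuotient (dist (X m t) (X n t) ^ 2) * (X n t 1 - X m t 1) := by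
    simp [perp, WithLp.ofLp_sum]
  have e1 : (-(1 / (2 * Real.pi)) • ∑ m, (Γ m * expQuotient (dist (X m t) (X n t) ^ 2)) •
      perp (X n t - X m t)) 1 = 1 / (2 * Real.pi) *
        ∑ m, Γ m * expQuotient (dist (X m t) (X n t) ^ 2) * (X n t 0 - X m t 0) := by
    simp [perp, WithLp.ofLp_sum, -neg_sub, ← Finset.sum_neg_distrib, Finset.mul_sum]
  rw [e0, e1]

theorem logPotential_eq {x : ℝ} (hx : 0 ≤ x) :
    logPotential x = logPotential 0 + 1 / 2 * ∫ u in (0 : ℝ)..x, expQuotient u := by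
  have h := intervalIntegral.integral_eq_sub_of_hasDerivAt_of_le hx
    (continuousOn_logPotential.mono Icc_subset_Ici_self)
    (fun u hu => hasDerivAt_logPotential hu.1)
    ((continuous_expQuotient.div_const 2).intervalIntegrable 0 x)
  rw [intervalIntegral.integral_div] at h
  linarith

/-- On [0, ∞) the function `logPotential` is a primitive of a continuous function on ℝ, so the chain
rule holds also at times when the side vanishes. -/
theorem HasDerivAt.logPotential_comp {f : ℝ → ℝ} {f' t : ℝ} (hf : HasDerivAt f f' t)
    (h0 : ∀ t, 0 ≤ f t) :
    HasDerivAt (fun t => logPotential (f t)) (expQuotient (f t) / 2 * f') t := by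
  have h1 : HasDerivAt (fun x => ∫ u in (0 : ℝ)..x, expQuotient u) (expQuotient (f t)) (f t) :=
    intervalIntegral.integral_hasDerivAt_right (continuous_expQuotient.intervalIntegrable _ _)
      (continuous_expQuotient.stronglyMeasurableAtFilter _ _) continuous_expQuotient.continuousAt
  have h2 := HasDerivAt.comp (h₂ := fun x => ∫ u in (0 : ℝ)..x, expQuotient u) (h := f) t h1 hf
  have h3 := (h2.const_mul (1 / 2)).const_add (logPotential 0)
  have h4 : (fun t => logPotential (f t)) = fun t => logPotential 0 +
      1 / 2 * ((fun x => ∫ u in (0 : ℝ)..x, expQuotient u) ∘ f) t :=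
    funext fun t => logPotential_eq (h0 t)
  rw [h4]
  exact h3.congr_deriv (by ring)

theorem eq_of_hasDerivAt_zero {f : ℝ → ℝ} (hf : ∀ t, HasDerivAt f 0 t) (s t : ℝ) : f s = f t :=
  is_const_of_deriv_eq_zero (fun t => (hf t).differentiableAt) (fun t => (hf t).deriv) s t

/-- Law of cosines for the side vectors, which sum to zero. -/
theorem areaRate_coordinates {x y z u₀ v₀ u₁ v₁ u₂ v₂ : ℝ}
    (hx : x = (u₁ - u₂) ^ 2 + (v₁ - v₂) ^ 2) (hy : y = (u₂ - u₀) ^ 2 + (v₂ - v₀) ^ 2)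
    (hz : z = (u₀ - u₁) ^ 2 + (v₀ - v₁) ^ 2) :
    (z - x - y) / 2 = (u₁ - u₂) * (u₂ - u₀) + (v₁ - v₂) * (v₂ - v₀) ∧
    (x - y - z) / 2 = (u₀ - u₁) * (u₂ - u₀) + (v₀ - v₁) * (v₂ - v₀) ∧
    (y - x - z) / 2 = (u₀ - u₁) * (u₁ - u₂) + (v₀ - v₁) * (v₁ - v₂) := by
  subst hx hy hz
  refine ⟨?_, ?_, ?_⟩ <;> ring

variable {Γ : Fin 3 → ℝ} {X : Fin 3 → ℝ → Plane}

/-- Twice the oriented area of the triangle of three vortices. -/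
def orientedArea (X : Fin 3 → ℝ → Plane) (t : ℝ) : ℝ :=
  (X 1 t 0 - X 2 t 0) * (X 2 t 1 - X 0 t 1) - (X 1 t 1 - X 2 t 1) * (X 2 t 0 - X 0 t 0)

theorem hamiltonian_eq (Γ : Fin 3 → ℝ) (X : Fin 3 → Plane) : hamiltonian gaussianKernel Γ X =
    -(1 / (2 * Real.pi)) * (Γ 0 * Γ 1 * logPotential (dist (X 0) (X 1) ^ 2) +
      Γ 0 * Γ 2 * logPotential (dist (X 2) (X 0) ^ 2) +
      Γ 1 * Γ 2 * logPotential (dist (X 1) (X 2) ^ 2)) := by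
  have h0 : Finset.Ioi (0 : Fin 3) = {1, 2} := by decide
  have h1 : Finset.Ioi (1 : Fin 3) = {2} := by decide
  have h2 : Finset.Ioi (2 : Fin 3) = ∅ := by decide
  rw [hamiltonian, Fin.sum_univ_three, h0, h1, h2, Finset.sum_pair (by decide),
    Finset.sum_singleton, Finset.sum_empty, add_zero]
  simp only [funHP_gaussianKernel (sq_nonneg _)]
  rw [dist_comm (X 1) (X 0), dist_comm (X 2) (X 1)]

theorem scaledEnstrophy_eq (Γ : Fin 3 → ℝ) (X : Fin 3 → ℝ → Plane) (t : ℝ) :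
    scaledEnstrophy gaussianKernel Γ X t =
    -(1 / (2 * Real.pi)) * (Γ 0 * Γ 1 * Real.exp (-dist (X 0 t) (X 1 t) ^ 2 / 2) +
      Γ 0 * Γ 2 * Real.exp (-dist (X 2 t) (X 0 t) ^ 2 / 2) +
      Γ 1 * Γ 2 * Real.exp (-dist (X 1 t) (X 2 t) ^ 2 / 2)) := by
  have h0 : Finset.Ioi (0 : Fin 3) = {1, 2} := by decide
  have h1 : Finset.Ioi (1 : Fin 3) = {2} := by decide
  have h2 : Finset.Ioi (2 : Fin 3) = ∅ := by decide
  rw [scaledEnstrophy, Fin.sum_univ_three, h0, h1, h2, Finset.sum_pair (by decide),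
    Finset.sum_singleton, Finset.sum_empty, add_zero]
  simp only [enstrophyIntegral_gaussianKernel]
  rw [dist_comm (X 1 t) (X 0 t), dist_comm (X 2 t) (X 1 t)]

theorem vortexTriangle_derivatives (hX : IsSolution gaussianKernel 1 Γ X) (t : ℝ) :
    HasDerivAt (fun t => dist (X 1 t) (X 2 t) ^ 2) (Γ 0 / Real.pi * orientedArea X t *
      (expQuotient (dist (X 2 t) (X 0 t) ^ 2) - expQuotient (dist (X 0 t) (X 1 t) ^ 2))) t ∧
    HasDerivAt (fun t => dist (X 2 t) (X 0 t) ^ 2) (Γ 1 / Real.pi * orientedArea X t *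
      (expQuotient (dist (X 0 t) (X 1 t) ^ 2) - expQuotient (dist (X 1 t) (X 2 t) ^ 2))) t ∧
    HasDerivAt (fun t => dist (X 0 t) (X 1 t) ^ 2) (Γ 2 / Real.pi * orientedArea X t *
      (expQuotient (dist (X 1 t) (X 2 t) ^ 2) - expQuotient (dist (X 2 t) (X 0 t) ^ 2))) t ∧
    HasDerivAt (orientedArea X) (areaRate (Γ 0) (Γ 1) (Γ 2) (dist (X 1 t) (X 2 t) ^ 2)
      (dist (X 2 t) (X 0 t) ^ 2) (dist (X 0 t) (X 1 t) ^ 2)) t := by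
  rw [isSolution_one_iff] at hX
  have h0 := hX 0 t
  have h1 := hX 1 t
  have h2 := hX 2 t
  simp only [Fin.sum_univ_three, sub_self, mul_zero, zero_add, add_zero] at h0 h1 h2
  rw [dist_comm (X 1 t) (X 0 t)] at h0
  rw [dist_comm (X 2 t) (X 1 t)] at h1
  rw [dist_comm (X 0 t) (X 2 t)] at h2
  obtain ⟨e1, e2, e3⟩ := areaRate_coordinates (dist_sq_plane (X 1 t) (X 2 t))
    (dist_sq_plane (X 2 t) (X 0 t)) (dist_sq_plane (X 0 t) (X 1 t))
  have hr : HasDerivAt (orientedArea X) (areaRate (Γ 0) (Γ 1) (Γ 2) (dist (X 1 t) (X 2 t) ^ 2)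
      (dist (X 2 t) (X 0 t) ^ 2) (dist (X 0 t) (X 1 t) ^ 2)) t := by
    unfold areaRate orientedArea
    rw [e1, e2, e3]
    generalize hg1 : expQuotient (dist (X 1 t) (X 2 t) ^ 2) = g1 at h0 h1 h2 ⊢
    generalize hg2 : expQuotient (dist (X 2 t) (X 0 t) ^ 2) = g2 at h0 h1 h2 ⊢
    generalize hg3 : expQuotient (dist (X 0 t) (X 1 t) ^ 2) = g3 at h0 h1 h2 ⊢
    rw [dist_sq_plane (X 1 t) (X 2 t), dist_sq_plane (X 2 t) (X 0 t)]
    convert! ((h1.1.sub h2.1).mul (h2.2.sub h0.2)).sub ((h1.2.sub h2.2).mul (h2.1.sub h0.1)) using 1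
    simp only [Pi.sub_apply]
    ring
  refine ⟨?_, ?_, ?_, hr⟩
  · simp only [dist_sq_plane (X 1 _) (X 2 _)] at h0 h1 h2 ⊢
    convert! ((h1.1.sub h2.1).pow 2).add ((h1.2.sub h2.2).pow 2) using 1
    simp only [Pi.sub_apply, orientedArea]
    ring
  · simp only [dist_sq_plane (X 2 _) (X 0 _)] at h0 h1 h2 ⊢
    convert! ((h2.1.sub h0.1).pow 2).add ((h2.2.sub h0.2).pow 2) using 1
    simp only [Pi.sub_apply, orientedArea]
    ring
  · simp only [dist_sq_plane (X 0 _) (X 1 _)] at h0 h1 h2 ⊢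
    convert! ((h0.1.sub h1.1).pow 2).add ((h0.2.sub h1.2).pow 2) using 1
    simp only [Pi.sub_apply, orientedArea]
    ring

/-- The weights satisfy ap = bq = -c, so in the derivatives of moment and energy the products of A
with differences of `expQuotient` cancel cyclically. The same relations turn the Hamiltonian into a
multiple of e. -/
theorem exists_vortexTriangle (hX : IsSolution gaussianKernel 1 Γ X) (h01 : Γ 1 ≤ Γ 0)
    (h1 : 0 < Γ 1) (h2 : Γ 2 < 0) (hsum : 1 / Γ 0 + 1 / Γ 1 + 1 / Γ 2 = 0) {Hc : ℝ} (hHc : Hc < 0)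
    (hH : hamiltonian gaussianKernel Γ (fun n => X n 0) = Hc) :
    ∃ M, VortexTriangle (Γ 0) (Γ 1) (Γ 2) (Γ 1 / (Γ 0 + Γ 1)) (Γ 0 / (Γ 0 + Γ 1)) M
      (2 * Real.pi * Hc / (Γ 0 * Γ 1))
      (fun t => dist (X 1 t) (X 2 t) ^ 2) (fun t => dist (X 2 t) (X 0 t) ^ 2)
      (fun t => dist (X 0 t) (X 1 t) ^ 2) (orientedArea X) := by
  have h0 : 0 < Γ 0 := h1.trans_le h01
  have hs : 0 < Γ 0 + Γ 1 := by positivity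
  have hpi := Real.pi_pos
  have hd := vortexTriangle_derivatives hX
  set p := Γ 1 / (Γ 0 + Γ 1) with hp
  set q := Γ 0 / (Γ 0 + Γ 1) with hq
  have hpq : p + q = 1 := by rw [hp, hq]; field_simp; ring
  have hc : Γ 2 = -(Γ 0 * Γ 1 / (Γ 0 + Γ 1)) := by
    have h2' := h2.ne
    field_simp at hsum ⊢
    linarith
  have hap : Γ 0 * p = -Γ 2 := by rw [hp, hc]; ring
  have hbq : Γ 1 * q = -Γ 2 := by rw [hq, hc]; ring
  have hp0 : 0 < p := by positivity
  have hq0 : 0 < q := by positivity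
  clear_value p q
  have hmom : ∀ t, HasDerivAt (fun t => p * dist (X 1 t) (X 2 t) ^ 2 +
      q * dist (X 2 t) (X 0 t) ^ 2 - dist (X 0 t) (X 1 t) ^ 2) 0 t := fun t => by
    obtain ⟨d1, d2, d3, -⟩ := hd t
    convert! ((d1.const_mul p).add (d2.const_mul q)).sub d3 using 1
    generalize expQuotient (dist (X 1 t) (X 2 t) ^ 2) = g1
    generalize expQuotient (dist (X 2 t) (X 0 t) ^ 2) = g2
    generalize expQuotient (dist (X 0 t) (X 1 t) ^ 2) = g3
    linear_combination (-(orientedArea X t / Real.pi) * (g2 - g3)) * hap -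
      (orientedArea X t / Real.pi) * (g3 - g1) * hbq
  have hen : ∀ t, HasDerivAt (fun t => p * logPotential (dist (X 1 t) (X 2 t) ^ 2) +
      q * logPotential (dist (X 2 t) (X 0 t) ^ 2) - logPotential (dist (X 0 t) (X 1 t) ^ 2)) 0 t :=
      fun t => by
    obtain ⟨d1, d2, d3, -⟩ := hd t
    convert! (((HasDerivAt.logPotential_comp d1 fun t => sq_nonneg _).const_mul p).add
      ((HasDerivAt.logPotential_comp d2 fun t => sq_nonneg _).const_mul q)).sub
      (HasDerivAt.logPotential_comp d3 fun t => sq_nonneg _) using 1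
    generalize expQuotient (dist (X 1 t) (X 2 t) ^ 2) = g1
    generalize expQuotient (dist (X 2 t) (X 0 t) ^ 2) = g2
    generalize expQuotient (dist (X 0 t) (X 1 t) ^ 2) = g3
    linear_combination (-(orientedArea X t / Real.pi) * (g2 - g3) * (g1 / 2)) * hap -
      (orientedArea X t / Real.pi) * (g3 - g1) * (g2 / 2) * hbq
  refine ⟨p * dist (X 1 0) (X 2 0) ^ 2 + q * dist (X 2 0) (X 0 0) ^ 2 - dist (X 0 0) (X 1 0) ^ 2,
    fun t => (hd t).1, fun t => (hd t).2.1, fun t => (hd t).2.2.1, fun t => (hd t).2.2.2,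
    fun t => sq_nonneg _, fun t => sq_nonneg _, fun t => sq_nonneg _, fun t => ?_,
    fun t => eq_of_hasDerivAt_zero hmom t 0, fun t => ?_, hp0, hq0, hpq, h2,
    hap, hbq, ?_⟩
  · rw [dist_sq_plane, dist_sq_plane, dist_sq_plane, orientedArea]
    ring
  · rw [eq_of_hasDerivAt_zero hen t 0, ← hH, hamiltonian_eq]
    have e1 : Γ 0 * Γ 2 = -(Γ 0 * Γ 1) * q := by linear_combination Γ 0 * hbq
    have e2 : Γ 1 * Γ 2 = -(Γ 0 * Γ 1) * p := by linear_combination Γ 1 * hap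
    rw [e1, e2]
    field_simp
    ring
  · exact div_neg_of_neg_of_pos (mul_neg_of_pos_of_neg (by positivity) hHc) (by positivity)

/-! ### Collinear relative equilibria -/

/-- The rigid motion `y ↦ e^{iwt} y + β ∫₀ᵗ i e^{iws} ds` applied to points of the first axis. -/
def rigidMotion {N : ℕ} (w β : ℝ) (y : Fin N → ℝ) (n : Fin N) (t : ℝ) : Plane :=
  !₂[y n * Real.cos (w * t) - β * ∫ s in (0 : ℝ)..t, Real.sin (w * s),
    y n * Real.sin (w * t) + β * ∫ s in (0 : ℝ)..t, Real.cos (w * s)]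

theorem dist_sq_rigidMotion {N : ℕ} (w β : ℝ) (y : Fin N → ℝ) (m n : Fin N) (t : ℝ) :
    dist (rigidMotion w β y m t) (rigidMotion w β y n t) ^ 2 = (y m - y n) ^ 2 := by
  rw [dist_sq_plane]
  simp only [rigidMotion, Matrix.cons_val_zero, Matrix.cons_val_one]
  linear_combination (y m - y n) ^ 2 * Real.sin_sq_add_cos_sq (w * t)

/-- Collinear vortices move normally to their line; the motion is rigid when this velocity is affine
in position. The integral form of the translation covers w = 0 and w ≠ 0 at once. -/
theorem isSolution_rigidMotion {N : ℕ} {Γ : Fin N → ℝ} {w β : ℝ} {y : Fin N → ℝ}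
    (h : ∀ n, 1 / (2 * Real.pi) * ∑ m, Γ m * expQuotient ((y m - y n) ^ 2) * (y n - y m) =
      w * y n + β) :
    IsSolution gaussianKernel 1 Γ (rigidMotion w β y) := by
  rw [isSolution_one_iff]
  intro n t
  simp only [dist_sq_rigidMotion]
  have hlin : HasDerivAt (fun t : ℝ => w * t) w t := by
    simpa using (hasDerivAt_id t).const_mul w
  have hS : HasDerivAt (fun t => ∫ s in (0 : ℝ)..t, Real.sin (w * s)) (Real.sin (w * t)) t :=
    intervalIntegral.integral_hasDerivAt_right
      ((by fun_prop : Continuous fun s => Real.sin (w * s)).intervalIntegrable _ _)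
      ((by fun_prop : Continuous fun s => Real.sin (w * s)).stronglyMeasurableAtFilter _ _)
      (by fun_prop)
  have hC : HasDerivAt (fun t => ∫ s in (0 : ℝ)..t, Real.cos (w * s)) (Real.cos (w * t)) t :=
    intervalIntegral.integral_hasDerivAt_right
      ((by fun_prop : Continuous fun s => Real.cos (w * s)).intervalIntegrable _ _)
      ((by fun_prop : Continuous fun s => Real.cos (w * s)).stronglyMeasurableAtFilter _ _)
      (by fun_prop)
  constructor
  · have h1 : ∑ m, Γ m * expQuotient ((y m - y n) ^ 2) * (rigidMotion w β y n t 1 -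
        rigidMotion w β y m t 1) =
        (∑ m, Γ m * expQuotient ((y m - y n) ^ 2) * (y n - y m)) * Real.sin (w * t) := by
      rw [Finset.sum_mul]
      refine Finset.sum_congr rfl fun m _ => ?_
      simp only [rigidMotion, Matrix.cons_val_one, Matrix.cons_val_fin_one]
      ring
    rw [h1]
    have h2 := ((hlin.cos).const_mul (y n)).sub (hS.const_mul β)
    refine h2.congr_deriv ?_
    linear_combination Real.sin (w * t) * h n
  · have h1 : ∑ m, Γ m * expQuotient ((y m - y n) ^ 2) * (rigidMotion w β y n t 0 -
        rigidMotion w β y m t 0) =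
        (∑ m, Γ m * expQuotient ((y m - y n) ^ 2) * (y n - y m)) * Real.cos (w * t) := by
      rw [Finset.sum_mul]
      refine Finset.sum_congr rfl fun m _ => ?_
      simp only [rigidMotion, Matrix.cons_val_zero]
      ring
    rw [h1]
    have h2 := ((hlin.sin).const_mul (y n)).add (hC.const_mul β)
    refine h2.congr_deriv ?_
    linear_combination (-Real.cos (w * t)) * h n

/-- An equilibrium of the reduced system is realized by a relative equilibrium. -/
theorem exists_relativeEquilibrium (Γ : Fin 3 → ℝ) {l₁ l₂ l₃ : ℝ} (h1 : 0 ≤ l₁) (h2 : 0 ≤ l₂)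
    (h4 : 4 * l₁ * l₂ = (l₃ - l₁ - l₂) ^ 2)
    (hrate : areaRate (Γ 0) (Γ 1) (Γ 2) l₁ l₂ l₃ = 0) (hne : l₁ ≠ 0 ∨ l₂ ≠ 0) :
    ∃ Y : Fin 3 → ℝ → Plane, IsSolution gaussianKernel 1 Γ Y ∧
      (∀ m n t, dist (Y m t) (Y n t) = dist (Y m 0) (Y n 0)) ∧
      dist (Y 1 0) (Y 2 0) ^ 2 = l₁ ∧ dist (Y 2 0) (Y 0 0) ^ 2 = l₂ ∧
      dist (Y 0 0) (Y 1 0) ^ 2 = l₃ := by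
  -- Signed sides along a line; the collinearity relation fixes their product up to sign, and the
  -- sign is put into d₂.
  obtain ⟨d₁, d₂, hd₁, hd₂, hd₃⟩ : ∃ d₁ d₂ : ℝ, d₁ ^ 2 = l₁ ∧ d₂ ^ 2 = l₂ ∧
      2 * d₁ * d₂ = l₃ - l₁ - l₂ := by
    have hs : (2 * Real.sqrt l₁ * Real.sqrt l₂) ^ 2 = (l₃ - l₁ - l₂) ^ 2 := by
      rw [mul_pow, mul_pow, Real.sq_sqrt h1, Real.sq_sqrt h2]
      linarith
    rcases sq_eq_sq_iff_eq_or_eq_neg.1 hs with h | h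
    · exact ⟨Real.sqrt l₁, Real.sqrt l₂, Real.sq_sqrt h1, Real.sq_sqrt h2, h⟩
    · refine ⟨Real.sqrt l₁, -Real.sqrt l₂, Real.sq_sqrt h1, ?_, by linarith⟩
      rw [neg_sq, Real.sq_sqrt h2]
  have hl₃ : l₃ = (d₁ + d₂) ^ 2 := by rw [add_sq, hd₁, hd₂]; linarith
  subst hd₁ hd₂ hl₃
  have hd : d₁ ≠ 0 ∨ d₂ ≠ 0 := by
    rcases hne with h | h
    · left; rintro rfl; simp at h
    · right; rintro rfl; simp at h
  obtain ⟨g1, hg1⟩ : ∃ g, expQuotient (d₁ ^ 2) = g := ⟨_, rfl⟩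
  obtain ⟨g2, hg2⟩ : ∃ g, expQuotient (d₂ ^ 2) = g := ⟨_, rfl⟩
  obtain ⟨g3, hg3⟩ : ∃ g, expQuotient ((d₁ + d₂) ^ 2) = g := ⟨_, rfl⟩
  set κ := 1 / (2 * Real.pi) with hκ
  set β₀ := κ * (Γ 1 * g3 * (-d₂ - d₁) + Γ 2 * g2 * (-d₂)) with hβ₀
  set β₁ := κ * (Γ 0 * g3 * (d₁ + d₂) + Γ 2 * g1 * d₁) with hβ₁
  set β₂ := κ * (Γ 0 * g2 * d₂ + Γ 1 * g1 * (-d₁)) with hβ₂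
  -- Vanishing of the area rate says exactly that velocity differences are proportional to position
  -- differences. The common factor is the angular velocity w, which exists because d₁ and d₂ are
  -- not both zero.
  have hcol : (β₁ - β₂) * d₂ = d₁ * (β₂ - β₀) := by
    unfold areaRate at hrate
    rw [hg1, hg2, hg3, ← hκ] at hrate
    rw [hβ₀, hβ₁, hβ₂]
    linear_combination (-1) * hrate
  obtain ⟨w, hw1, hw2⟩ : ∃ w, β₁ - β₂ = w * d₁ ∧ β₂ - β₀ = w * d₂ := by
    by_cases h : d₁ = 0
    · have h' : d₂ ≠ 0 := by
        rcases hd with h'' | h''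
        · exact absurd h h''
        · exact h''
      refine ⟨(β₂ - β₀) / d₂, ?_, by field_simp⟩
      rw [h, zero_mul] at hcol
      rw [h, mul_zero]
      exact (mul_eq_zero.1 hcol).resolve_right h'
    · refine ⟨(β₁ - β₂) / d₁, by field_simp, ?_⟩
      field_simp
      linarith
  have hsol : IsSolution gaussianKernel 1 Γ (rigidMotion w β₂ ![-d₂, d₁, 0]) := by
    refine isSolution_rigidMotion fun n => ?_
    have e0 : (-d₂ - d₁) ^ 2 = (d₁ + d₂) ^ 2 := by ring
    have e1 : (d₁ - -d₂) ^ 2 = (d₁ + d₂) ^ 2 := by ring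
    have e2 : (0 - -d₂) ^ 2 = d₂ ^ 2 := by ring
    have e3 : (-d₂ - 0) ^ 2 = d₂ ^ 2 := by ring
    have e4 : (0 - d₁) ^ 2 = d₁ ^ 2 := by ring
    have e5 : (d₁ - 0) ^ 2 = d₁ ^ 2 := by ring
    rw [Fin.sum_univ_three]
    fin_cases n
    · change κ * (Γ 0 * expQuotient ((-d₂ - -d₂) ^ 2) * (-d₂ - -d₂) +
        Γ 1 * expQuotient ((d₁ - -d₂) ^ 2) * (-d₂ - d₁) +
        Γ 2 * expQuotient ((0 - -d₂) ^ 2) * (-d₂ - 0)) = w * -d₂ + β₂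
      rw [e1, e2, hg2, hg3]
      linear_combination (-1) * hw2 - hβ₀
    · change κ * (Γ 0 * expQuotient ((-d₂ - d₁) ^ 2) * (d₁ - -d₂) +
        Γ 1 * expQuotient ((d₁ - d₁) ^ 2) * (d₁ - d₁) +
        Γ 2 * expQuotient ((0 - d₁) ^ 2) * (d₁ - 0)) = w * d₁ + β₂
      rw [e0, e4, hg1, hg3]
      linear_combination hw1 - hβ₁
    · change κ * (Γ 0 * expQuotient ((-d₂ - 0) ^ 2) * (0 - -d₂) +
        Γ 1 * expQuotient ((d₁ - 0) ^ 2) * (0 - d₁) +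
        Γ 2 * expQuotient ((0 - 0) ^ 2) * (0 - 0)) = w * 0 + β₂
      rw [e3, e5, hg1, hg2]
      linear_combination (-1) * hβ₂
  refine ⟨_, hsol, fun m n t => ?_, ?_, ?_, ?_⟩
  · rw [← sq_eq_sq₀ dist_nonneg dist_nonneg, dist_sq_rigidMotion, dist_sq_rigidMotion]
  · rw [dist_sq_rigidMotion]; simp
  · rw [dist_sq_rigidMotion]; simp
  · rw [dist_sq_rigidMotion]; simp; ring

theorem convergesToRelativeEquilibrium_of_tendsto {Γ : Fin 3 → ℝ} {X : Fin 3 → ℝ → Plane}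
    {l : Filter ℝ} {l₁ l₂ l₃ : ℝ}
    (t1 : Tendsto (fun t => dist (X 1 t) (X 2 t) ^ 2) l (𝓝 l₁))
    (t2 : Tendsto (fun t => dist (X 2 t) (X 0 t) ^ 2) l (𝓝 l₂))
    (t3 : Tendsto (fun t => dist (X 0 t) (X 1 t) ^ 2) l (𝓝 l₃)) (h1 : 0 ≤ l₁) (h2 : 0 ≤ l₂)
    (h4 : 4 * l₁ * l₂ = (l₃ - l₁ - l₂) ^ 2)
    (hrate : areaRate (Γ 0) (Γ 1) (Γ 2) l₁ l₂ l₃ = 0) (hne : l₁ ≠ 0 ∨ l₂ ≠ 0) :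
    ConvergesToRelativeEquilibrium gaussianKernel Γ X l := by
  obtain ⟨Y, hY, hconst, rfl, rfl, rfl⟩ := exists_relativeEquilibrium Γ h1 h2 h4 hrate hne
  refine ⟨Y, hY, hconst, ?_⟩
  have hsq : ∀ {m n : Fin 3}, Tendsto (fun t => dist (X m t) (X n t) ^ 2) l
      (𝓝 (dist (Y m 0) (Y n 0) ^ 2)) →
      Tendsto (fun t => dist (X m t) (X n t)) l (𝓝 (dist (Y m 0) (Y n 0))) ∧
      Tendsto (fun t => dist (X n t) (X m t)) l (𝓝 (dist (Y n 0) (Y m 0))) := by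
    intro m n h
    have h5 := (Real.continuous_sqrt.tendsto _).comp h
    simp only [Function.comp_def, Real.sqrt_sq dist_nonneg] at h5
    refine ⟨h5, ?_⟩
    simpa only [dist_comm] using h5
  intro m n
  fin_cases m <;> fin_cases n
  · simpa using tendsto_const_nhds
  · exact (hsq t3).1
  · exact (hsq t2).2
  · exact (hsq t3).2
  · simpa using tendsto_const_nhds
  · exact (hsq t1).1
  · exact (hsq t2).1
  · exact (hsq t1).2
  · simpa using tendsto_const_nhds

theorem hasPeriodicDistances_of_sq {X : Fin 3 → ℝ → Plane} {T : ℝ} (hT : 0 < T)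
    (h : ∀ t, dist (X 1 (t + T)) (X 2 (t + T)) ^ 2 = dist (X 1 t) (X 2 t) ^ 2 ∧
      dist (X 2 (t + T)) (X 0 (t + T)) ^ 2 = dist (X 2 t) (X 0 t) ^ 2 ∧
      dist (X 0 (t + T)) (X 1 (t + T)) ^ 2 = dist (X 0 t) (X 1 t) ^ 2) :
    HasPeriodicDistances X := by
  refine ⟨T, hT, fun m n t => ?_⟩
  obtain ⟨h1, h2, h3⟩ := h t
  rw [sq_eq_sq₀ dist_nonneg dist_nonneg] at h1 h2 h3
  fin_cases m <;> fin_cases n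
  · simp
  · exact h3
  · exact (dist_comm _ _).trans (h2.trans (dist_comm _ _))
  · exact (dist_comm _ _).trans (h3.trans (dist_comm _ _))
  · simp
  · exact h1
  · exact h2
  · exact (dist_comm _ _).trans (h1.trans (dist_comm _ _))
  · simp

/-! ### Integrability of the enstrophy -/

theorem integrable_of_continuous_of_tails {f : ℝ → ℝ} (hf : Continuous f) {S T : ℝ}
    (h1 : IntegrableOn f (Ioi T)) (h2 : IntegrableOn (fun t => f (0 - t)) (Ioi S)) :
    Integrable f := by
  have h3 : IntegrableOn f (Iio (-S)) := by
    have A : MeasurePreserving (fun x : ℝ => -x) := Measure.measurePreserving_neg volume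
    have B : MeasurableEmbedding fun x : ℝ => -x :=
      (Homeomorph.neg ℝ).isClosedEmbedding.measurableEmbedding
    rw [← A.integrableOn_comp_preimage B]
    simpa [Function.comp_def] using h2
  rw [← integrableOn_univ]
  refine ((h3.union (hf.integrableOn_Icc (a := -S) (b := T))).union h1).mono_set fun t _ => ?_
  rcases lt_or_ge t (-S) with h | h
  · exact Or.inl (Or.inl h)
  · rcases le_or_gt t T with h' | h'
    · exact Or.inl (Or.inr ⟨h, h'⟩)
    · exact Or.inr h'

theorem scaledEnstrophy_of_vortexTriangle {Γ : Fin 3 → ℝ} {X : Fin 3 → ℝ → Plane}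
    {p q M e : ℝ} {x y z A : ℝ → ℝ} (h : VortexTriangle (Γ 0) (Γ 1) (Γ 2) p q M e x y z A)
    (hx : ∀ t, x t = dist (X 1 t) (X 2 t) ^ 2) (hy : ∀ t, y t = dist (X 2 t) (X 0 t) ^ 2)
    (hz : ∀ t, z t = dist (X 0 t) (X 1 t) ^ 2) :
    scaledEnstrophy gaussianKernel Γ X = fun t => Γ 0 * Γ 1 / (2 * Real.pi) *
      (p * Real.exp (-x t / 2) + q * Real.exp (-y t / 2) - Real.exp (-z t / 2)) := by
  funext t
  rw [scaledEnstrophy_eq, ← hx, ← hy, ← hz]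
  have e1 : Γ 0 * Γ 2 = -(Γ 0 * Γ 1) * q := by linear_combination Γ 0 * h.hbq
  have e2 : Γ 1 * Γ 2 = -(Γ 0 * Γ 1) * p := by linear_combination Γ 1 * h.hap
  rw [e1, e2]
  ring

/-- Along motions which are neither periodic nor asymptotic to a relative equilibrium, the scaled
enstrophy is positive, continuous and integrable. -/
theorem scaledEnstrophy_properties {Γ : Fin 3 → ℝ} {Hc : ℝ} {X : Fin 3 → ℝ → Plane}
    (h01 : Γ 1 ≤ Γ 0) (h1 : 0 < Γ 1) (h2 : Γ 2 < 0) (hsum : 1 / Γ 0 + 1 / Γ 1 + 1 / Γ 2 = 0)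
    (hHc : Hc < 0) (hX : IsSolution gaussianKernel 1 Γ X)
    (hH : hamiltonian gaussianKernel Γ (fun n => X n 0) = Hc)
    (htop : ¬ ConvergesToRelativeEquilibrium gaussianKernel Γ X atTop)
    (hbot : ¬ ConvergesToRelativeEquilibrium gaussianKernel Γ X atBot)
    (hper : ¬ HasPeriodicDistances X) :
    Continuous (scaledEnstrophy gaussianKernel Γ X) ∧
    (∀ t, 0 < scaledEnstrophy gaussianKernel Γ X t) ∧
    Integrable (scaledEnstrophy gaussianKernel Γ X) := by
  obtain ⟨M, h⟩ := exists_vortexTriangle hX h01 h1 h2 hsum hHc hH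
  -- Nonperiodicity allows at most one collinear instant, hence none for large |t|.
  have hzero : ∀ s s', orientedArea X s = 0 → orientedArea X s' = 0 → s = s' := by
    intro s s' hs hs'
    by_contra hne
    rcases lt_or_gt_of_ne hne with hlt | hlt
    · exact hper (hasPeriodicDistances_of_sq (by linarith) (h.periodic_of_two_zeros hs hs'))
    · exact hper (hasPeriodicDistances_of_sq (by linarith) (h.periodic_of_two_zeros hs' hs))
  obtain ⟨T, hT⟩ : ∃ T, ∀ t, T ≤ |t| → orientedArea X t ≠ 0 := by
    by_cases hex : ∃ s, orientedArea X s = 0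
    · obtain ⟨s, hs⟩ := hex
      refine ⟨|s| + 1, fun t ht h0 => ?_⟩
      rw [hzero t s h0 hs] at ht
      linarith
    · push Not at hex
      exact ⟨0, fun t _ => hex t⟩
  rw [scaledEnstrophy_of_vortexTriangle h (fun _ => rfl) (fun _ => rfl) (fun _ => rfl)]
  have hk : 0 < Γ 0 * Γ 1 / (2 * Real.pi) :=
    div_pos (mul_pos h.ha h1) (by linarith [Real.pi_pos])
  have hcont := h.continuous_density
  refine ⟨continuous_const.mul hcont, fun t => mul_pos hk (h.density_pos t), Integrable.const_mul ?_ _⟩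
  obtain ⟨T₁, hT₁⟩ : ∃ T', IntegrableOn (fun t => Γ 1 / (Γ 0 + Γ 1) *
      Real.exp (-dist (X 1 t) (X 2 t) ^ 2 / 2) + Γ 0 / (Γ 0 + Γ 1) *
      Real.exp (-dist (X 2 t) (X 0 t) ^ 2 / 2) - Real.exp (-dist (X 0 t) (X 1 t) ^ 2 / 2))
      (Ioi T') := by
    rcases h.integrableOn_density_or_equilibrium (T := T)
      (fun t ht => hT t (ht.trans (le_abs_self t))) with hc | ⟨l₁, l₂, l₃, t1, t2, t3, n1, n2, n3, h4, hr, hne⟩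
    · exact hc
    · exact absurd (convergesToRelativeEquilibrium_of_tendsto t1 t2 t3 n1 n2 h4 hr hne) htop
  obtain ⟨T₂, hT₂⟩ : ∃ T', IntegrableOn (fun t => Γ 1 / (Γ 0 + Γ 1) *
      Real.exp (-dist (X 1 (0 - t)) (X 2 (0 - t)) ^ 2 / 2) + Γ 0 / (Γ 0 + Γ 1) *
      Real.exp (-dist (X 2 (0 - t)) (X 0 (0 - t)) ^ 2 / 2) -
      Real.exp (-dist (X 0 (0 - t)) (X 1 (0 - t)) ^ 2 / 2)) (Ioi T') := by
    rcases (h.reflect 0).integrableOn_density_or_equilibrium (T := T)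
      (fun t ht => neg_ne_zero.2 (hT _ (ht.trans (by rw [zero_sub, abs_neg]; exact le_abs_self t))))
      with hc | ⟨l₁, l₂, l₃, t1, t2, t3, n1, n2, n3, h4, hr, hne⟩
    · exact hc
    · have hneg : ∀ {f : ℝ → ℝ} {l : ℝ}, Tendsto (fun t => f (0 - t)) atTop (𝓝 l) →
          Tendsto f atBot (𝓝 l) := fun hf => by
        have := hf.comp tendsto_neg_atBot_atTop
        simpa [Function.comp_def] using this
      exact absurd (convergesToRelativeEquilibrium_of_tendsto
        (hneg (f := fun t => dist (X 1 t) (X 2 t) ^ 2) t1)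
        (hneg (f := fun t => dist (X 2 t) (X 0 t) ^ 2) t2)
        (hneg (f := fun t => dist (X 0 t) (X 1 t) ^ 2) t3) n1 n2 h4 hr hne) hbot
  exact integrable_of_continuous_of_tails hcont hT₁ hT₂

/-! ### The limit of the enstrophy variation -/

theorem dist_unscale {N : ℕ} {ε : ℝ} (hε : 0 < ε) (tstar : ℝ) (X : Fin N → ℝ → Plane) (m n : Fin N)
    (t : ℝ) : dist (unscale ε tstar X m t) (unscale ε tstar X n t) =
      ε * dist (X m ((t - tstar) / ε ^ 2)) (X n ((t - tstar) / ε ^ 2)) := by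
  rw [unscale, unscale, dist_smul₀, Real.norm_of_nonneg hε.le]

theorem perp_smul (r : ℝ) (v : Plane) : perp (r • v) = r • perp v := by
  ext i
  fin_cases i <;> simp [perp]

/-- The velocity field is homogeneous of degree -1 when lengths and the parameter scale together,
matching lengths ε against times ε². -/
theorem isSolution_unscale {h : Plane → ℝ} {N : ℕ} {Γ : Fin N → ℝ} {X : Fin N → ℝ → Plane}
    (hX : IsSolution h 1 Γ X) {ε : ℝ} (hε : 0 < ε) (tstar : ℝ) :
    IsSolution h ε Γ (unscale ε tstar X) := by
  intro n t
  set τ := (t - tstar) / ε ^ 2 with hτ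
  have h1 : HasDerivAt (fun t : ℝ => (t - tstar) / ε ^ 2) (1 / ε ^ 2) t :=
    ((hasDerivAt_id t).sub_const tstar).div_const _
  have h2 := ((HasDerivAt.scomp (g₁ := X n) (h := fun t : ℝ => (t - tstar) / ε ^ 2) t (hX n τ) h1)).const_smul ε
  refine h2.congr_deriv ?_
  simp only [dist_unscale hε]
  rw [← hτ, smul_smul, smul_smul, Finset.smul_sum, Finset.smul_sum]
  refine Finset.sum_congr rfl fun m _ => ?_
  have h3 : unscale ε tstar X n t - unscale ε tstar X m t = ε • (X n τ - X m τ) := by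
    rw [unscale, unscale, ← hτ, smul_sub]
  rw [h3, perp_smul, mul_div_cancel_left₀ _ hε.ne', div_one, smul_smul, smul_smul, smul_smul]
  congr 1
  rw [mul_pow, div_mul_eq_div_div]
  field_simp

theorem enstrophyVariation_unscale {N : ℕ} {h : Plane → ℝ} {Γ : Fin N → ℝ} {X : Fin N → ℝ → Plane}
    {ε : ℝ} (hε : 0 < ε) (tstar t : ℝ) :
    enstrophyVariation h ε Γ (unscale ε tstar X) t =
      -(1 / ε ^ 2) * scaledEnstrophy h Γ X ((t - tstar) / ε ^ 2) := by
  unfold enstrophyVariation scaledEnstrophy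
  simp only [dist_unscale hε, mul_div_cancel_left₀ _ hε.ne']
  field_simp

theorem integral_rescaled_mul {Z φ : ℝ → ℝ} {ε : ℝ} (hε : 0 < ε) (tstar : ℝ) :
    ∫ t, -(1 / ε ^ 2) * Z ((t - tstar) / ε ^ 2) * φ t =
      -∫ τ, Z τ * φ (tstar + ε ^ 2 * τ) := by
  have hε2 : 0 < ε ^ 2 := by positivity
  have h1 := integral_sub_right_eq_self (μ := volume)
    (fun t => -(1 / ε ^ 2) * Z (t / ε ^ 2) * φ (tstar + t)) tstar
  simp only [add_sub_cancel] at h1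
  rw [h1]
  have h2 := Measure.integral_comp_div
    (fun τ => -(1 / ε ^ 2) * Z τ * φ (tstar + ε ^ 2 * τ)) (ε ^ 2)
  simp only [mul_div_cancel₀ _ hε2.ne'] at h2
  rw [h2, abs_of_pos hε2, smul_eq_mul, ← integral_const_mul, ← integral_neg]
  refine integral_congr_ae (Eventually.of_forall fun τ => ?_)
  field_simp

/-- Rescalings of an integrable function concentrate at a point. -/
theorem tendsto_integral_rescaled_mul {Z φ : ℝ → ℝ} (hZ : Integrable Z) (hφ : Continuous φ)
    (hc : HasCompactSupport φ) (tstar : ℝ) :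
    Tendsto (fun ε : ℝ => ∫ τ, Z τ * φ (tstar + ε ^ 2 * τ)) (𝓝[>] 0)
      (𝓝 ((∫ τ, Z τ) * φ tstar)) := by
  obtain ⟨C, hC⟩ := hc.exists_bound_of_continuous hφ
  rw [← integral_mul_const]
  refine tendsto_integral_filter_of_dominated_convergence (fun τ => ‖Z τ‖ * C)
    (Eventually.of_forall fun ε => hZ.aestronglyMeasurable.mul
      (by fun_prop : Continuous fun τ => φ (tstar + ε ^ 2 * τ)).aestronglyMeasurable)
    (Eventually.of_forall fun ε => Eventually.of_forall fun τ => ?_) (hZ.norm.mul_const C)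
    (Eventually.of_forall fun τ => ?_)
  · rw [norm_mul]
    exact mul_le_mul_of_nonneg_left (hC _) (norm_nonneg _)
  · have h1 : Tendsto (fun ε : ℝ => Z τ * φ (tstar + ε ^ 2 * τ)) (𝓝 0)
        (𝓝 (Z τ * φ (tstar + 0 ^ 2 * τ))) :=
      (by fun_prop : Continuous fun ε : ℝ => Z τ * φ (tstar + ε ^ 2 * τ)).tendsto 0
    simpa using h1.mono_left nhdsWithin_le_nhds

end EulerPoincare

end

/-! ### Assembly of the theorem. -/

theorem mainTheorem5 :
    SmoothingHypotheses gaussianKernel ∧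
    (∀ r : ℝ, 0 ≤ r →
      IntegrableOn (enstrophyIntegrand gaussianKernel (Real.sqrt r)) (Ioi 0) ∧
      funZ gaussianKernel r = Real.exp (-r / 2)) ∧
    (∀ x : Plane,
      1 / (2 * Real.pi) * funZ gaussianKernel (‖x‖ ^ 2)
        = ∫ y, gaussianKernel (x - y) * gaussianKernel y ∧
      ∫ y, gaussianKernel (x - y) * gaussianKernel y
        = Real.exp (-‖x‖ ^ 2 / 2) / (2 * Real.pi)) ∧
    StrictAntiOn (funZ gaussianKernel) (Ici 0) ∧
    StrictConvexOn ℝ (Ici 0) (funZ gaussianKernel) ∧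
    ContDiffOn ℝ 2 (funZ gaussianKernel) (Ioi 0) ∧
    ContDiffOn ℝ 2 (funHP gaussianKernel) (Ioi 0) ∧
    (∀ r : ℝ, 0 < r →
      0 < deriv (deriv (funZ gaussianKernel)) r * deriv (funHP gaussianKernel) r
        - deriv (funZ gaussianKernel) r * deriv (deriv (funHP gaussianKernel)) r) ∧
    ∀ (Γ : Fin 3 → ℝ) (Hc : ℝ) (X : Fin 3 → ℝ → Plane),
      Γ 1 ≤ Γ 0 → 0 < Γ 1 → Γ 2 < 0 → 1 / Γ 0 + 1 / Γ 1 + 1 / Γ 2 = 0 →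
      hamiltonianLowerBound (Γ 0) (Γ 1) < Hc → Hc < 0 →
      IsSolution gaussianKernel 1 Γ X →
      (∀ m n, m ≠ n → X m 0 ≠ X n 0) →
      hamiltonian gaussianKernel Γ (fun n => X n 0) = Hc →
      ¬ ConvergesToRelativeEquilibrium gaussianKernel Γ X atTop →
      ¬ ConvergesToRelativeEquilibrium gaussianKernel Γ X atBot →
      ¬ HasPeriodicDistances X →
      Integrable (scaledEnstrophy gaussianKernel Γ X) ∧
      0 < enstrophyMass gaussianKernel Γ X ∧
      ∀ tstar : ℝ,
        (∀ ε : ℝ, 0 < ε → IsSolution gaussianKernel ε Γ (unscale ε tstar X) ∧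
          Continuous (enstrophyVariation gaussianKernel ε Γ (unscale ε tstar X))) ∧
        (∀ m n, Tendsto
          (fun ε : ℝ => dist (unscale ε tstar X m tstar) (unscale ε tstar X n tstar))
          (𝓝[>] 0) (𝓝 0)) ∧
        ∀ φ : ℝ → ℝ, ContDiff ℝ ∞ φ → HasCompactSupport φ →
          Tendsto
            (fun ε : ℝ =>
              ∫ t, enstrophyVariation gaussianKernel ε Γ (unscale ε tstar X) t * φ t)
            (𝓝[>] 0) (𝓝 (-enstrophyMass gaussianKernel Γ X * φ tstar)) := by
  refine ⟨smoothingHypotheses_gaussianKernel, fun r hr => ⟨integrableOn_enstrophyIntegrand _,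
    funZ_gaussianKernel hr⟩, fun x => ⟨?_, convolution_gaussianKernel x⟩, strictAntiOn_funZ,
    strictConvexOn_funZ, contDiffOn_funZ, contDiffOn_funHP, fun r hr => wronskian_funZ_funHP hr, ?_⟩
  · rw [convolution_gaussianKernel, funZ_gaussianKernel (sq_nonneg _)]
    ring
  intro Γ Hc X h01 h1 h2 hsum _ hHc hX _ hH htop hbot hper
  obtain ⟨hcont, hpos, hint⟩ :=
    scaledEnstrophy_properties h01 h1 h2 hsum hHc hX hH htop hbot hper
  refine ⟨hint, integral_pos_of_integrable_nonneg_nonzero hcont hint (fun t => (hpos t).le)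
    (hpos 0).ne', fun tstar => ⟨fun ε hε => ⟨isSolution_unscale hX hε tstar, ?_⟩,
    fun m n => ?_, fun φ hφ hc => ?_⟩⟩
  · have h3 : enstrophyVariation gaussianKernel ε Γ (unscale ε tstar X) = fun t =>
        -(1 / ε ^ 2) * scaledEnstrophy gaussianKernel Γ X ((t - tstar) / ε ^ 2) :=
      funext fun t => enstrophyVariation_unscale hε tstar t
    rw [h3]
    fun_prop
  · have h3 : Tendsto (fun ε : ℝ => ε * dist (X m 0) (X n 0)) (𝓝[>] 0) (𝓝 0) := by
      have h4 := (continuous_mul_const (dist (X m 0) (X n 0))).tendsto 0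
      rw [zero_mul] at h4
      exact h4.mono_left nhdsWithin_le_nhds
    refine h3.congr' ?_
    filter_upwards [self_mem_nhdsWithin] with ε hε
    rw [dist_unscale hε, sub_self, zero_div]
  · rw [enstrophyMass, neg_mul]
    refine (tendsto_integral_rescaled_mul hint hφ.continuous hc tstar).neg.congr' ?_
    filter_upwards [self_mem_nhdsWithin] with ε hε
    simp only [enstrophyVariation_unscale hε]
    exact (integral_rescaled_mul hε tstar).symm
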